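/- Let $\mathbb K$ be a field, $R$ an associative unital $\mathbb K$-algebra, $\Lambda$ a non-empty finite set and $X$ a finite set. Write $M_\Lambda(R)$ for the $\mathbb K$-algebra of all maps $\Lambda\to R$ (pointwise operations), $\delta_\lambda\in M_\Lambda(R)$ for the indicator function of $\lambda\in\Lambda$, and $r_M$ for the constant map with value $r\in R$. **Weak bialgebras.** A weak bialgebra is a $\mathbb K$-algebra $B$ with a $\mathbb K$-coalgebra structure $(\Delta,\varepsilon)$, $\Delta(a)=a_{(1)}\otimes a_{(2)}$, such that $\Delta(ab)=\Delta(a)\Delta(b)$, $(\Delta(1)\otimes1)(1\otimes\Delta(1))=1_{(1)}\otimes1_{(2)}\otimes1_{(3)}=(1\otimes\Delta(1))(\Delta(1)\otimes1)$ and $\varepsilon(ab_{(1)})\varepsilon(b_{(2)}c)=\varepsilon(abc)=\varepsilon(ab_{(2)})\varepsilon(b_{(1)}c)$. Put $\varepsilon_s(a)=1_{(1)}\varepsilon(a1_{(2)})$ and $\varepsilon_t(a)=\varepsilon(1_{(1)}a)1_{(2)}$. $B$ is a weak Hopf algebra if there is a linear $S\colon B\to B$ with $S(h_{(1)})h_{(2)}=\varepsilon_s(h)$,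 $h_{(1)}S(h_{(2)})=\varepsilon_t(h)$, $S(h_{(1)})h_{(2)}S(h_{(3)})=S(h)$. A weak bialgebra homomorphism is a map that is both an algebra and a coalgebra homomorphism. For a weak bialgebra $H$, an algebra $A$ and an algebra homomorphism $f^+\colon H\to A$, an antipode of $f^+$ is a linear map $f^-\colon H\to A$ with $f^+\star f^-=f^+\circ\varepsilon_t$, $f^-\star f^+=f^+\circ\varepsilon_s$, $f^+\star f^-\star f^+=f^+$, $f^-\star f^+\star f^-=f^-$, where $(f\star g)(h)=f(h_{(1)})g(h_{(2)})$. A *Hopf closure* of a weak bialgebra $H$ is a pair $(\overline H,\iota)$ of a weak Hopf algebra $\overline H$ and a weak bialgebra homomorphism $\iota\colon H\to\overline H$ such that for every weak bialgebra $B$ and every weak bialgebra homomorphism $f^+\colon H\to B$ that has an antipode there is a unique weak bialgebra homomorphism $F\colon\overline H\to B$ with $F\circ\iota=f^+$. **Data.** Let permutations act on $\Lambda$ from the right by $\lambda\alpha=\alpha(\lambda)$ (so $\lambda\alpha\beta=\beta(\alpha(\lambda))$), let $\deg$ be a map from $X$ to the permutations of $\Lambda$, and put $T_\alpha(f)(\lambda)=f(\lambda\alpha)$.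 Let $\sigma=(\sigma^{ab}_{cd})_{a,b,c,d\in X}$ be a family in $M_\Lambda(R)$ such that every value $\sigma^{ab}_{cd}(\lambda)$ is central in $R$, and $\sigma^{bd}_{ac}(\lambda)=0$ whenever $\lambda\deg(d)\deg(b)\neq\lambda\deg(c)\deg(a)$. **The algebra $A_\sigma$** is generated by the algebra $M_\Lambda(R)\otimes_{\mathbb K} M_\Lambda(R)^{op}$ and elements $L_{ab},(L^{-1})_{ab}$ ($a,b\in X$), subject to $\sum_cL_{ac}(L^{-1})_{cb}=\delta_{a,b}=\sum_c(L^{-1})_{ac}L_{cb}$; $(T_{\deg a}(f)\otimes1)L_{ab}=L_{ab}(f\otimes1)$; $(1\otimes T_{\deg b}(f))L_{ab}=L_{ab}(1\otimes f)$; $(f\otimes1)(L^{-1})_{ab}=(L^{-1})_{ab}(T_{\deg b}(f)\otimes1)$; $(1\otimes f)(L^{-1})_{ab}=(L^{-1})_{ab}(1\otimes T_{\deg a}(f))$; $\sum_{x,y}(\sigma^{xy}_{ac}\otimes1)L_{yd}L_{xb}=\sum_{x,y}(1\otimes\sigma^{bd}_{xy})L_{cy}L_{ax}$, for all $f\in M_\Lambda(R)$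 and $a,b,c,d\in X$. Put $s(f)=f\otimes1$, $t(f)=1\otimes f$. For an algebra $A$ with such maps $s,t$, let $A\otimes_{M_\Lambda(R)}A$ be the quotient of $A\otimes_{\mathbb K}A$ by the right ideal generated by all $t(f)\otimes1-1\otimes s(f)$. The map $\Delta_{M_\Lambda(R)}\colon A_\sigma\to A_\sigma\otimes_{M_\Lambda(R)}A_\sigma$ is induced by the multiplicative assignment $f\otimes g\mapsto s(f)\otimes t(g)$, $L_{ab}\mapsto\sum_cL_{ac}\otimes L_{cb}$, $(L^{-1})_{ab}\mapsto\sum_c(L^{-1})_{cb}\otimes(L^{-1})_{ac}$. The map $\pi_{M_\Lambda(R)}\colon A_\sigma\to M_\Lambda(R)$ is $\pi_{M_\Lambda(R)}(a)=\chi(a)(1)$, where $\chi\colon A_\sigma\to\mathrm{End}_{\mathbb K}(M_\Lambda(R))$ is the algebra homomorphism with $\chi(f\otimes g)(h)=fhg$, $\chi(L_{ab})=\delta_{a,b}T_{\deg a}$, $\chi((L^{-1})_{ab})=\delta_{a,b}T_{\deg(a)^{-1}}$. The family $\sigma$ is *rigid* if there are $x_{ab},y_{ab}\in A_\sigma$ ($a,b\in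 X$) with $\sum_c(L^{-1})_{cb}x_{ac}=\sum_cx_{cb}(L^{-1})_{ac}=\sum_cL_{cb}y_{ac}=\sum_cy_{cb}L_{ac}=\delta_{a,b}1$ for all $a,b\in X$. **The algebra $\mathfrak A(w_\sigma)$.** Let $Q=\Lambda\times X$ be the quiver over $\Lambda$ with $\mathfrak s(\lambda,x)=\lambda$, $\mathfrak t(\lambda,x)=\lambda\deg(x)$, and let $Q^{(m)}$ be its set of paths of length $m$ ($Q^{(0)}=\Lambda$). For $(a,b)=((\lambda,a'),(\lambda',b'))$ and $(c,d)=((\mu,c'),(\mu',d'))$ in $Q^{(2)}$ let $w(a,b;c,d)=\delta_{\lambda,\mu}\,\sigma^{b'a'}_{d'c'}(\lambda)$. Let $\mathfrak G(Q)$ be the algebra with basis $\mathbf e[p;q]$ ($p,q\in Q^{(m)}$, $m\ge0$), product $\mathbf e[p;q]\,\mathbf e[p';q']=\delta_{\mathfrak t(p),\mathfrak s(p')}\delta_{\mathfrak t(q),\mathfrak s(q')}\mathbf e[pp';qq']$ and unit $\sum_{\lambda,\mu\in\Lambda}\mathbf e[\lambda;\mu]$. Then $\mathfrak A(w_\sigma)$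 is the quotient of $R\otimes R^{op}\otimes\mathfrak G(Q)$ by the two-sided ideal generated by $$\sum_{(x,y)\in Q^{(2)}}w(x,y;a,b)\otimes1\otimes\mathbf e[x;c]\,\mathbf e[y;d]-\sum_{(x,y)\in Q^{(2)}}1\otimes w(c,d;x,y)\otimes\mathbf e[a;x]\,\mathbf e[b;y]$$ for all $(a,b),(c,d)\in Q^{(2)}$. Here $s(f)=\sum_{\lambda,\mu}f(\lambda)\otimes1\otimes\mathbf e[\lambda;\mu]$, $t(f)=\sum_{\lambda,\mu}1\otimes f(\lambda)\otimes\mathbf e[\mu;\lambda]$, $\Delta_{M_\Lambda(R)}(r\otimes r'\otimes\mathbf e[p;q])=\sum_{u\in Q^{(m)}}(r\otimes1\otimes\mathbf e[p;u])\otimes(1\otimes r'\otimes\mathbf e[u;q])$ for $p,q\in Q^{(m)}$, and $\pi_{M_\Lambda(R)}(r\otimes r'\otimes\mathbf e[p;q])=\delta_{p,q}(rr')_M\delta_{\mathfrak s(q)}$. Finally let $\Phi\colon\mathfrak A(w_\sigma)\to A_\sigma$ be the algebra homomorphism $$\Phi(r\otimes r'\otimes\mathbf e[p;q])=(r_M\otimes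 r'_M)(\delta_{\mathfrak s(p)}\otimes\delta_{\mathfrak s(q)})L_{x_1y_1}\cdots L_{x_my_m}$$ for $p=((\lambda_1,x_1),\dots,(\lambda_m,x_m))$, $q=((\mu_1,y_1),\dots,(\mu_m,y_m))$ in $Q^{(m)}$, $m\ge0$. **Frobenius-separability.** Suppose that $R$ is Frobenius-separable with idempotent Frobenius system $(\psi,e^{(1)}\otimes e^{(2)})$: $\psi\colon R\to\mathbb K$ is linear, $e^{(1)}\otimes e^{(2)}\in R\otimes_{\mathbb K} R$, $l=\psi(le^{(1)})e^{(2)}=e^{(1)}\psi(e^{(2)}l)$ for all $l\in R$, and $e^{(1)}e^{(2)}=1$. Equip $M_\Lambda(R)$ with the idempotent Frobenius system $\Psi(f)=\sum_{\lambda}\psi(f(\lambda))$, $E^{(1)}\otimes E^{(2)}=\sum_\lambda e^{(1)}_M\delta_\lambda\otimes e^{(2)}_M\delta_\lambda$, and equip each of $A=\mathfrak A(w_\sigma)$ and $A=A_\sigma$ with $$\Delta(a)=t(E^{(1)})a_{[1]}\otimes s(E^{(2)})a_{[2]},\qquad\varepsilon(a)=\Psi(\pi_{M_\Lambda(R)}(a)),\qquad\text{where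 }\Delta_{M_\Lambda(R)}(a)=a_{[1]}\otimes a_{[2]}.$$ **Statement.** If $\sigma$ is rigid, then $\mathfrak A(w_\sigma)$ and $A_\sigma$ are weak bialgebras with these structures, $\Phi$ is a weak bialgebra homomorphism, and the pair $(A_\sigma,\Phi)$ is a Hopf closure of $\mathfrak A(w_\sigma)$. -/

import Mathlib

open TensorProduct

set_option linter.unusedSectionVars false

noncomputable section

namespace FRT

/-! ### Weak bialgebras, weak Hopf algebras, Hopf closures -/

section Weak

variable {K : Type*} [Field K]

/-- A weak bialgebra over `K`: a `K`-algebra with a `K`-coalgebra structure such that `Δ` is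
multiplicative, `(Δ(1) ⊗ 1)(1 ⊗ Δ(1)) = Δ²(1) = (1 ⊗ Δ(1))(Δ(1) ⊗ 1)` and
`ε(a b₍₁₎) ε(b₍₂₎ c) = ε(abc) = ε(a b₍₂₎) ε(b₍₁₎ c)`. -/
class WeakBialgebra (K : Type*) (B : Type*) [Field K] [Ring B] [Algebra K B] extends
    Coalgebra K B where
  comul_mul : ∀ a b : B, comul (a * b) = comul a * comul b
  comul_one_left :
    TensorProduct.assoc K B B B (comul (1 : B) ⊗ₜ[K] (1 : B)) * ((1 : B) ⊗ₜ[K] comul (1 : B)) =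
      comul.lTensor B (comul (1 : B))
  comul_one_right :
    ((1 : B) ⊗ₜ[K] comul (1 : B)) * TensorProduct.assoc K B B B (comul (1 : B) ⊗ₜ[K] (1 : B)) =
      comul.lTensor B (comul (1 : B))
  counit_mul_left : ∀ a b c : B,
    LinearMap.mul' K K (TensorProduct.map (counit ∘ₗ LinearMap.mulLeft K a)
      (counit ∘ₗ LinearMap.mulRight K c) (comul b)) = counit (a * b * c)
  counit_mul_right : ∀ a b c : B,
    LinearMap.mul' K K (TensorProduct.map (counit ∘ₗ LinearMap.mulRight K c)
      (counit ∘ₗ LinearMap.mulLeft K a) (comul b)) = counit (a * b * c)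

variable {B : Type*} [Ring B] [Algebra K B]

/-- The source counital map `ε_s(a) = 1₍₁₎ ε(a 1₍₂₎)`. -/
def sourceCounital (K B : Type*) [Field K] [Ring B] [Algebra K B] [WeakBialgebra K B] :
    B →ₗ[K] B :=
  (TensorProduct.rid K B).toLinearMap ∘ₗ (Coalgebra.counit (R := K) (A := B)).lTensor B ∘ₗ
    LinearMap.mulRight K (Coalgebra.comul (R := K) (1 : B)) ∘ₗ TensorProduct.mk K B B 1

/-- The target counital map `ε_t(a) = ε(1₍₁₎ a) 1₍₂₎`. -/
def targetCounital (K B : Type*) [Field K] [Ring B] [Algebra K B] [WeakBialgebra K B] :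
    B →ₗ[K] B :=
  (TensorProduct.lid K B).toLinearMap ∘ₗ (Coalgebra.counit (R := K) (A := B)).rTensor B ∘ₗ
    LinearMap.mulLeft K (Coalgebra.comul (R := K) (1 : B)) ∘ₗ (TensorProduct.mk K B B).flip 1

/-- The convolution product `(f ⋆ g)(c) = f(c₍₁₎) g(c₍₂₎)`. -/
def conv {C A : Type*} [AddCommGroup C] [Module K C] [Coalgebra K C] [Ring A] [Algebra K A]
    (f g : C →ₗ[K] A) : C →ₗ[K] A :=
  LinearMap.mul' K A ∘ₗ TensorProduct.map f g ∘ₗ Coalgebra.comul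

/-- `S` is an antipode of the weak bialgebra `B`, making it a weak Hopf algebra. -/
structure IsWeakHopfAntipode [WeakBialgebra K B] (S : B →ₗ[K] B) : Prop where
  antipode_id : conv S LinearMap.id = sourceCounital K B
  id_antipode : conv LinearMap.id S = targetCounital K B
  antipode_id_antipode : conv (conv S LinearMap.id) S = S

/-- `g` (the map `f⁻`) is an antipode of the algebra homomorphism `f` (the map `f⁺`) from a weak
bialgebra `H` to an algebra `A`: it is the `(f ∘ ε_s, f ∘ ε_t)`-generalized inverse of `f` for the
convolution product. -/
structure IsAntipodeOf {H A : Type*} [Ring H] [Algebra K H] [WeakBialgebra K H] [Ring A]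
    [Algebra K A] (f : H →ₐ[K] A) (g : H →ₗ[K] A) : Prop where
  right_inv : conv f.toLinearMap g = f.toLinearMap ∘ₗ targetCounital K H
  left_inv : conv g f.toLinearMap = f.toLinearMap ∘ₗ sourceCounital K H
  mul_mul_self : conv (conv f.toLinearMap g) f.toLinearMap = f.toLinearMap
  self_mul_mul : conv (conv g f.toLinearMap) g = g

/-- A weak bialgebra homomorphism `ι : H → Hbar` (algebra and coalgebra homomorphism) exhibits
`Hbar` as a Hopf closure of the weak bialgebra `H`: `Hbar` is a weak Hopf algebra, and every weak
bialgebra homomorphism from `H` that has an antipode factors uniquely through `ι`. -/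
structure IsHopfClosure.{w, u₀, u₁, u₂} {K : Type u₀} {H : Type u₁} {Hbar : Type u₂} [Field K]
    [Ring H] [Algebra K H] [WeakBialgebra K H] [Ring Hbar] [Algebra K Hbar]
    [WeakBialgebra K Hbar] (ι : H →ₐc[K] Hbar) : Prop where
  isWeakHopf : ∃ S : Hbar →ₗ[K] Hbar, IsWeakHopfAntipode S
  universal : ∀ (B : Type w) [Ring B] [Algebra K B] [WeakBialgebra K B] (f : H →ₐc[K] B)
    (g : H →ₗ[K] B), IsAntipodeOf (f : H →ₐ[K] B) g → ∃! F : Hbar →ₐc[K] B, F.comp ι = f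

end Weak

/-! ### Frobenius-separable algebras and the passage from bialgebroids to weak bialgebras -/

section Frobenius

/-- An idempotent Frobenius system `(ψ, e)` on a `K`-algebra `L`:
`l = ψ(l e⁽¹⁾) e⁽²⁾ = e⁽¹⁾ ψ(e⁽²⁾ l)` for all `l`, and `e⁽¹⁾ e⁽²⁾ = 1`. An algebra with such a
system is Frobenius-separable. -/
structure FrobeniusSystem (K L : Type*) [Field K] [Ring L] [Algebra K L] where
  ψ : L →ₗ[K] K
  e : L ⊗[K] L
  left_dual : ∀ l : L,
    TensorProduct.lid K L (TensorProduct.map (ψ ∘ₗ LinearMap.mulLeft K l) LinearMap.id e) = l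
  right_dual : ∀ l : L,
    TensorProduct.rid K L (TensorProduct.map LinearMap.id (ψ ∘ₗ LinearMap.mulRight K l) e) = l
  mul_eq_one : LinearMap.mul' K L e = 1

variable {K L A : Type*} [Field K] [Ring L] [Algebra K L] [Ring A] [Algebra K A]

/-- The Casimir property `l e⁽¹⁾ ⊗ e⁽²⁾ = e⁽¹⁾ ⊗ e⁽²⁾ l`. -/
theorem FrobeniusSystem.casimir (F : FrobeniusSystem K L) (l : L) :
    (LinearMap.mulLeft K l).rTensor L F.e = (LinearMap.mulRight K l).lTensor L F.e := by
  -- both sides equal `e⁽¹⁾ ψ(e⁽²⁾ l e'⁽¹⁾) ⊗ e'⁽²⁾`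
  let T : L ⊗[K] L →ₗ[K] L ⊗[K] L →ₗ[K] L ⊗[K] L :=
    TensorProduct.lift (LinearMap.mk₂ K
      (fun a b => TensorProduct.map
        (LinearMap.toSpanSingleton K L a ∘ₗ F.ψ ∘ₗ LinearMap.mulLeft K (b * l)) LinearMap.id)
      (by intro a a' b; ext x y; simp [TensorProduct.add_tmul, smul_add])
      (by intro c a b; ext x y
          change ((F.ψ (b * l * x)) • (c • a)) ⊗ₜ[K] y = c • ((F.ψ (b * l * x) • a) ⊗ₜ[K] y)
          rw [TensorProduct.smul_tmul', smul_comm])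
      (by intro a b b'; ext x y; simp [TensorProduct.add_tmul, add_smul, add_mul, mul_assoc])
      (by intro c a b; ext x y
          simp [TensorProduct.smul_tmul', smul_smul, mul_assoc]))
  have h1 : T F.e F.e = (LinearMap.mulRight K l).lTensor L F.e := by
    have : ∀ z : L ⊗[K] L, T z F.e = (LinearMap.mulRight K l).lTensor L z := by
      intro z
      induction z with
      | zero => simp
      | add x y hx hy => simp [hx, hy]
      | tmul a b =>
        have hb := F.left_dual (b * l)
        have key : ∀ y : L ⊗[K] L, T (a ⊗ₜ b) y = a ⊗ₜ[K] (TensorProduct.lid K L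
            (TensorProduct.map (F.ψ ∘ₗ LinearMap.mulLeft K (b * l)) LinearMap.id y)) := by
          intro y
          induction y with
          | zero => simp
          | add x y hx hy => rw [map_add, hx, hy, map_add, map_add, TensorProduct.tmul_add]
          | tmul c d => simp [T, TensorProduct.smul_tmul]
        rw [key, hb]; simp
    exact this _
  have h2 : T F.e F.e = (LinearMap.mulLeft K l).rTensor L F.e := by
    have : ∀ z : L ⊗[K] L, T F.e z = (LinearMap.mulLeft K l).rTensor L z := by
      intro z
      induction z with
      | zero => simp
      | add x y hx hy => rw [map_add, hx, hy, map_add]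
      | tmul c d =>
        have hb := F.right_dual (l * c)
        have key : ∀ y : L ⊗[K] L, T y (c ⊗ₜ d) = (TensorProduct.rid K L
            (TensorProduct.map LinearMap.id (F.ψ ∘ₗ LinearMap.mulRight K (l * c)) y)) ⊗ₜ[K] d := by
          intro y
          induction y with
          | zero => simp
          | add x y hx hy =>
            rw [map_add, LinearMap.add_apply, hx, hy, map_add, map_add, TensorProduct.add_tmul]
          | tmul a b => simp [T, mul_assoc]
        rw [key, hb]; simp
    exact this _
  rw [← h2, h1]

/-- The idempotent Frobenius system on `M_Λ(R)` induced pointwise by one on `R`: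
`ψ(f) = ∑ ψ(f(v))` and `e = ∑ e⁽¹⁾ δ_v ⊗ e⁽²⁾ δ_v`. -/
def FrobeniusSystem.pi {K R : Type*} [Field K] [Ring R] [Algebra K R] (F : FrobeniusSystem K R)
    (Λ : Type*) [Fintype Λ] [DecidableEq Λ] : FrobeniusSystem K (Λ → R) where
  ψ := ∑ v : Λ, F.ψ ∘ₗ LinearMap.proj v
  e := ∑ v : Λ, TensorProduct.map (LinearMap.single K (fun _ : Λ => R) v)
    (LinearMap.single K (fun _ : Λ => R) v) F.e
  left_dual f := by
    have key : ∀ (v : Λ) (y : R ⊗[K] R),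
        TensorProduct.lid K (Λ → R) (TensorProduct.map
          ((∑ v : Λ, F.ψ ∘ₗ LinearMap.proj v) ∘ₗ LinearMap.mulLeft K f) LinearMap.id
          (TensorProduct.map (LinearMap.single K (fun _ : Λ => R) v)
            (LinearMap.single K (fun _ : Λ => R) v) y)) =
        Pi.single v (TensorProduct.lid K R
          (TensorProduct.map (F.ψ ∘ₗ LinearMap.mulLeft K (f v)) LinearMap.id y)) := by
      intro v y
      induction y with
      | zero => simp
      | add x y hx hy => simp only [map_add, hx, hy, Pi.single_add]
      | tmul a b =>
        have : ∑ x : Λ, F.ψ (f x * (Pi.single v a : Λ → R) x) = F.ψ (f v * a) := by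
          rw [Finset.sum_eq_single v] <;> simp +contextual
        simp [this, Pi.single_smul]
    rw [map_sum, map_sum]
    simp only [key, F.left_dual]
    exact Finset.univ_sum_single f
  right_dual f := by
    have key : ∀ (v : Λ) (y : R ⊗[K] R),
        TensorProduct.rid K (Λ → R) (TensorProduct.map LinearMap.id
          ((∑ v : Λ, F.ψ ∘ₗ LinearMap.proj v) ∘ₗ LinearMap.mulRight K f)
          (TensorProduct.map (LinearMap.single K (fun _ : Λ => R) v)
            (LinearMap.single K (fun _ : Λ => R) v) y)) =
        Pi.single v (TensorProduct.rid K R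
          (TensorProduct.map LinearMap.id (F.ψ ∘ₗ LinearMap.mulRight K (f v)) y)) := by
      intro v y
      induction y with
      | zero => simp
      | add x y hx hy => simp only [map_add, hx, hy, Pi.single_add]
      | tmul a b =>
        have : ∑ x : Λ, F.ψ ((Pi.single v b : Λ → R) x * f x) = F.ψ (b * f v) := by
          rw [Finset.sum_eq_single v] <;> simp +contextual
        simp [this, Pi.single_smul]
    rw [map_sum, map_sum]
    simp only [key, F.right_dual]
    exact Finset.univ_sum_single f
  mul_eq_one := by
    have key : ∀ (v : Λ) (y : R ⊗[K] R),
        LinearMap.mul' K (Λ → R) (TensorProduct.map (LinearMap.single K (fun _ : Λ => R) v)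
            (LinearMap.single K (fun _ : Λ => R) v) y) =
        Pi.single v (LinearMap.mul' K R y) := by
      intro v y
      induction y with
      | zero => simp
      | add x y hx hy => simp only [map_add, hx, hy, Pi.single_add]
      | tmul a b => simp [Pi.single_mul]
    rw [map_sum]
    simp only [key, F.mul_eq_one]
    exact Finset.univ_sum_single (1 : Λ → R)

/-- For `s : L → A` and `t : L^op → A`, the right ideal of `A ⊗ A` generated by the elements
`t(l) ⊗ 1 - 1 ⊗ s(l)`. -/
def balancedIdeal (s : L →ₐ[K] A) (t : Lᵐᵒᵖ →ₐ[K] A) : Submodule K (A ⊗[K] A) :=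
  Submodule.span K {y | ∃ (l : L) (x : A ⊗[K] A),
    y = (t (.op l) ⊗ₜ[K] 1 - 1 ⊗ₜ[K] s l) * x}

/-- The tensor product `A ⊗_L A` for the right action `a · l = t(l) a` and the left action
`l · a = s(l) a`, as the quotient of `A ⊗ A` by the right ideal `balancedIdeal s t`. -/
abbrev BalancedTensor (s : L →ₐ[K] A) (t : Lᵐᵒᵖ →ₐ[K] A) : Type _ :=
  (A ⊗[K] A) ⧸ balancedIdeal s t

variable (s : L →ₐ[K] A) (t : Lᵐᵒᵖ →ₐ[K] A)

theorem balancedIdeal_mul {x : A ⊗[K] A} (hx : x ∈ balancedIdeal s t) (y : A ⊗[K] A) :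
    x * y ∈ balancedIdeal s t := by
  induction hx using Submodule.span_induction with
  | mem x h =>
    obtain ⟨l, z, rfl⟩ := h
    exact Submodule.subset_span ⟨l, z * y, mul_assoc _ _ _⟩
  | zero => simp
  | add a b _ _ ha hb => rw [add_mul]; exact add_mem ha hb
  | smul c a _ ha => rw [smul_mul_assoc]; exact Submodule.smul_mem _ _ ha

/-- The elements of `A ⊗ A` which, modulo the balancing relations, may be multiplied from the
left. -/
def takeuchi : Subalgebra K (A ⊗[K] A) where
  carrier := {x | ∀ y ∈ balancedIdeal s t, x * y ∈ balancedIdeal s t}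
  mul_mem' {a b} ha hb y hy := by rw [mul_assoc]; exact ha _ (hb _ hy)
  add_mem' {a b} ha hb y hy := by rw [add_mul]; exact add_mem (ha _ hy) (hb _ hy)
  algebraMap_mem' r y hy := by
    rw [← Algebra.smul_def]; exact Submodule.smul_mem _ _ hy

theorem mem_takeuchi {x : A ⊗[K] A}
    (h : ∀ l : L, x * (t (.op l) ⊗ₜ[K] 1 - 1 ⊗ₜ[K] s l) ∈ balancedIdeal s t) :
    x ∈ takeuchi s t := by
  intro y hy
  induction hy using Submodule.span_induction with
  | mem y hy =>
    obtain ⟨l, z, rfl⟩ := hy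
    rw [← mul_assoc]
    exact balancedIdeal_mul s t (h l) z
  | zero => simp
  | add a b _ _ ha hb => rw [mul_add]; exact add_mem ha hb
  | smul c a _ ha => rw [mul_smul_comm]; exact Submodule.smul_mem _ _ ha

/-- The left multiplication action on `A ⊗_L A`. -/
def takeuchiAct : takeuchi s t →ₐ[K] Module.End K (BalancedTensor s t) :=
  AlgHom.ofLinearMap
    { toFun := fun x => Submodule.mapQ _ _ (LinearMap.mulLeft K x.1) (fun y hy => x.2 y hy)
      map_add' := fun x y => by
        apply Submodule.linearMap_qext; ext a b; simp [add_mul]; rfl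
      map_smul' := fun c x => by
        apply Submodule.linearMap_qext; ext a b; simp; rfl }
    (by apply Submodule.linearMap_qext; ext a b; simp)
    (by intro x y; apply Submodule.linearMap_qext; ext a b; simp; rfl)

theorem takeuchiAct_mk (x : takeuchi s t) (y : A ⊗[K] A) :
    takeuchiAct s t x (Submodule.Quotient.mk y) = Submodule.Quotient.mk (x.1 * y) := rfl

theorem takeuchiAct_congr {x y : takeuchi s t} (h : x.1 - y.1 ∈ balancedIdeal s t) :
    takeuchiAct s t x = takeuchiAct s t y := by
  apply LinearMap.ext
  intro m
  obtain ⟨z, rfl⟩ := Submodule.Quotient.mk_surjective _ m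
  rw [takeuchiAct_mk, takeuchiAct_mk, Submodule.Quotient.eq, ← sub_mul]
  exact balancedIdeal_mul s t h z

/-- The element `t(e⁽¹⁾) ⊗ s(e⁽²⁾)`. -/
def FrobeniusSystem.idem (F : FrobeniusSystem K L) : A ⊗[K] A :=
  TensorProduct.map (t.toLinearMap ∘ₗ (MulOpposite.opLinearEquiv K).toLinearMap)
    s.toLinearMap F.e

theorem FrobeniusSystem.idem_mul (F : FrobeniusSystem K L) {y : A ⊗[K] A}
    (hy : y ∈ balancedIdeal s t) : F.idem s t * y = 0 := by
  have key : ∀ l : L, F.idem s t * (t (.op l) ⊗ₜ[K] 1 - 1 ⊗ₜ[K] s l) = 0 := by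
    intro l
    have h1 : ∀ z : L ⊗[K] L,
        TensorProduct.map (t.toLinearMap ∘ₗ (MulOpposite.opLinearEquiv K).toLinearMap)
          s.toLinearMap z * (t (.op l) ⊗ₜ[K] 1) =
        TensorProduct.map (t.toLinearMap ∘ₗ (MulOpposite.opLinearEquiv K).toLinearMap)
          s.toLinearMap ((LinearMap.mulLeft K l).rTensor L z) := by
      intro z
      induction z with
      | zero => simp
      | add x y hx hy => simp only [map_add, add_mul, hx, hy]
      | tmul a b => simp [← map_mul, ← MulOpposite.op_mul]
    have h2 : ∀ z : L ⊗[K] L,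
        TensorProduct.map (t.toLinearMap ∘ₗ (MulOpposite.opLinearEquiv K).toLinearMap)
          s.toLinearMap z * (1 ⊗ₜ[K] s l) =
        TensorProduct.map (t.toLinearMap ∘ₗ (MulOpposite.opLinearEquiv K).toLinearMap)
          s.toLinearMap ((LinearMap.mulRight K l).lTensor L z) := by
      intro z
      induction z with
      | zero => simp
      | add x y hx hy => simp only [map_add, add_mul, hx, hy]
      | tmul a b => simp [← map_mul]
    rw [mul_sub, FrobeniusSystem.idem, h1, h2, F.casimir, sub_self]
  induction hy using Submodule.span_induction with
  | mem y hy =>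
    obtain ⟨l, z, rfl⟩ := hy
    rw [← mul_assoc, key, zero_mul]
  | zero => simp
  | add a b _ _ ha hb => rw [mul_add, ha, hb, add_zero]
  | smul c a _ ha => rw [mul_smul_comm, ha, smul_zero]

/-- The map `A → A ⊗ A`, `Δ(a) = t(e⁽¹⁾) a₍₁₎ ⊗ s(e⁽²⁾) a₍₂₎`, obtained from a map
`Δ_L : A → A ⊗_L A`, `a ↦ a₍₁₎ ⊗ a₍₂₎`. -/
def weakComul (F : FrobeniusSystem K L) (ΔL : A →ₗ[K] BalancedTensor s t) : A →ₗ[K] A ⊗[K] A :=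
  (balancedIdeal s t).liftQ (LinearMap.mulLeft K (F.idem s t))
    (fun _ hy => F.idem_mul s t hy) ∘ₗ ΔL

/-- The counit `ε = ψ ∘ π_L`. -/
def weakCounit (F : FrobeniusSystem K L) (π : A →ₗ[K] L) : A →ₗ[K] K := F.ψ ∘ₗ π

end Frobenius

/-! ### The algebra `A_σ` -/

section Asigma

/-- The conditions on `deg : X → Perm(Λ)` and on the family `σ`, where `σ a b c d` is
`σ^{ab}_{cd} ∈ M_Λ(R)`: the values are central in `R`, and `σ^{bd}_{ac}(v) = 0` whenever
`v deg(d) deg(b) ≠ v deg(c) deg(a)`. The group acting on `Λ` from the right is the opposite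
of the symmetric group, so `v deg(d) deg(b)` is `deg b (deg d v)`. -/
structure IsFRTFamily {R Λ X : Type*} [Ring R] (deg : X → Equiv.Perm Λ)
    (σ : X → X → X → X → Λ → R) : Prop where
  central : ∀ a b c d v, σ a b c d v ∈ Subring.center R
  invariant : ∀ a b c d v, deg b (deg d v) ≠ deg a (deg c v) → σ b d a c v = 0

/-- The generators of `A_σ`: the elements of `M_Λ(R) ⊗ M_Λ(R)^op` and the symbols `L_{ab}`,
`(L⁻¹)_{ab}`. -/
inductive Gen (K R Λ X : Type*) [Field K] [Ring R] [Algebra K R]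
  | base : (Λ → R) ⊗[K] (Λ → R)ᵐᵒᵖ → Gen K R Λ X
  | L : X → X → Gen K R Λ X
  | Linv : X → X → Gen K R Λ X

variable (K : Type*) {R Λ X : Type*} [Field K] [Ring R] [Algebra K R] [Fintype X]
  [DecidableEq X]

/-- The defining relations of `A_σ`. -/
inductive Rel (deg : X → Equiv.Perm Λ) (σ : X → X → X → X → Λ → R) :
    FreeAlgebra K (Gen K R Λ X) → FreeAlgebra K (Gen K R Λ X) → Prop
  | add (ξ η : (Λ → R) ⊗[K] (Λ → R)ᵐᵒᵖ) : Rel deg σ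
      (FreeAlgebra.ι K (.base ξ) + FreeAlgebra.ι K (.base η)) (FreeAlgebra.ι K (.base (ξ + η)))
  | smul (c : K) (ξ : (Λ → R) ⊗[K] (Λ → R)ᵐᵒᵖ) : Rel deg σ
      (c • FreeAlgebra.ι K (.base ξ)) (FreeAlgebra.ι K (.base (c • ξ)))
  | mul (ξ η : (Λ → R) ⊗[K] (Λ → R)ᵐᵒᵖ) : Rel deg σ
      (FreeAlgebra.ι K (.base ξ) * FreeAlgebra.ι K (.base η)) (FreeAlgebra.ι K (.base (ξ * η)))
  | L_Linv (a b : X) : Rel deg σ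
      (∑ c, FreeAlgebra.ι K (.L a c) * FreeAlgebra.ι K (.Linv c b)) (if a = b then 1 else 0)
  | Linv_L (a b : X) : Rel deg σ
      (∑ c, FreeAlgebra.ι K (.Linv a c) * FreeAlgebra.ι K (.L c b)) (if a = b then 1 else 0)
  | L_left (f : Λ → R) (a b : X) : Rel deg σ
      (FreeAlgebra.ι K (.base ((f ∘ deg a) ⊗ₜ 1)) * FreeAlgebra.ι K (.L a b))
      (FreeAlgebra.ι K (.L a b) * FreeAlgebra.ι K (.base (f ⊗ₜ 1)))
  | L_right (f : Λ → R) (a b : X) : Rel deg σ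
      (FreeAlgebra.ι K (.base (1 ⊗ₜ .op (f ∘ deg b))) * FreeAlgebra.ι K (.L a b))
      (FreeAlgebra.ι K (.L a b) * FreeAlgebra.ι K (.base (1 ⊗ₜ .op f)))
  | Linv_left (f : Λ → R) (a b : X) : Rel deg σ
      (FreeAlgebra.ι K (.base (f ⊗ₜ 1)) * FreeAlgebra.ι K (.Linv a b))
      (FreeAlgebra.ι K (.Linv a b) * FreeAlgebra.ι K (.base ((f ∘ deg b) ⊗ₜ 1)))
  | Linv_right (f : Λ → R) (a b : X) : Rel deg σ
      (FreeAlgebra.ι K (.base (1 ⊗ₜ .op f)) * FreeAlgebra.ι K (.Linv a b))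
      (FreeAlgebra.ι K (.Linv a b) * FreeAlgebra.ι K (.base (1 ⊗ₜ .op (f ∘ deg a))))
  | yangBaxter (a b c d : X) : Rel deg σ
      (∑ x, ∑ y, FreeAlgebra.ι K (.base (σ x y a c ⊗ₜ 1)) * FreeAlgebra.ι K (.L y d) *
        FreeAlgebra.ι K (.L x b))
      (∑ x, ∑ y, FreeAlgebra.ι K (.base (1 ⊗ₜ .op (σ b d x y))) * FreeAlgebra.ι K (.L c y) *
        FreeAlgebra.ι K (.L a x))
  | one : Rel deg σ 1 (FreeAlgebra.ι K (.base (1 ⊗ₜ 1)))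

variable (deg : X → Equiv.Perm Λ) (σ : X → X → X → X → Λ → R)

/-- The algebra `A_σ`. -/
def FRTAlg : Type _ := RingQuot (Rel K deg σ)

instance : Ring (FRTAlg K deg σ) := inferInstanceAs (Ring (RingQuot (Rel K deg σ)))

instance : Algebra K (FRTAlg K deg σ) := inferInstanceAs (Algebra K (RingQuot (Rel K deg σ)))

namespace FRTAlg

/-- The quotient map onto `A_σ`. -/
def mk : FreeAlgebra K (Gen K R Λ X) →ₐ[K] FRTAlg K deg σ := RingQuot.mkAlgHom K (Rel K deg σ)

theorem mk_rel {x y : FreeAlgebra K (Gen K R Λ X)} (h : Rel K deg σ x y) :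
    mk K deg σ x = mk K deg σ y := RingQuot.mkAlgHom_rel K h

/-- The class of `L_{ab}`. -/
def L (a b : X) : FRTAlg K deg σ := mk K deg σ (FreeAlgebra.ι K (.L a b))

/-- The class of `(L⁻¹)_{ab}`. -/
def Linv (a b : X) : FRTAlg K deg σ := mk K deg σ (FreeAlgebra.ι K (.Linv a b))

/-- The algebra homomorphism `M_Λ(R) ⊗ M_Λ(R)^op → A_σ`. -/
def base : (Λ → R) ⊗[K] (Λ → R)ᵐᵒᵖ →ₐ[K] FRTAlg K deg σ :=
  AlgHom.ofLinearMap
    { toFun := fun ξ => mk K deg σ (FreeAlgebra.ι K (.base ξ))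
      map_add' := fun ξ η => by rw [← map_add]; exact (mk_rel K deg σ (.add ξ η)).symm
      map_smul' := fun c ξ => by
        rw [RingHom.id_apply, ← map_smul]; exact (mk_rel K deg σ (.smul c ξ)).symm }
    ((mk_rel K deg σ .one).symm.trans (map_one _))
    (fun ξ η => ((map_mul _ _ _).symm.trans (mk_rel K deg σ (.mul ξ η))).symm)

/-- The source map `s(f) = f ⊗ 1`. -/
def src : (Λ → R) →ₐ[K] FRTAlg K deg σ :=
  (base K deg σ).comp Algebra.TensorProduct.includeLeft

/-- The target map `t(f) = 1 ⊗ f`. -/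
def tgt : (Λ → R)ᵐᵒᵖ →ₐ[K] FRTAlg K deg σ :=
  (base K deg σ).comp Algebra.TensorProduct.includeRight

theorem src_tgt_comm (f : Λ → R) (g : (Λ → R)ᵐᵒᵖ) :
    Commute (src K deg σ f) (tgt K deg σ g) := by
  simp [src, tgt, Commute, SemiconjBy, ← map_mul]

theorem L_src (f : Λ → R) (a b : X) :
    L K deg σ a b * src K deg σ f = src K deg σ (f ∘ deg a) * L K deg σ a b := by
  have := mk_rel K deg σ (.L_left f a b)
  simp only [map_mul] at this
  exact this.symm

theorem L_tgt (f : Λ → R) (a b : X) :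
    L K deg σ a b * tgt K deg σ (.op f) = tgt K deg σ (.op (f ∘ deg b)) * L K deg σ a b := by
  have := mk_rel K deg σ (.L_right f a b)
  simp only [map_mul] at this
  exact this.symm

theorem src_Linv (f : Λ → R) (a b : X) :
    src K deg σ f * Linv K deg σ a b = Linv K deg σ a b * src K deg σ (f ∘ deg b) := by
  have := mk_rel K deg σ (.Linv_left f a b)
  simp only [map_mul] at this
  exact this

theorem tgt_Linv (f : Λ → R) (a b : X) :
    tgt K deg σ (.op f) * Linv K deg σ a b = Linv K deg σ a b * tgt K deg σ (.op (f ∘ deg a)) := by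
  have := mk_rel K deg σ (.Linv_right f a b)
  simp only [map_mul] at this
  exact this

theorem sum_L_Linv (a b : X) :
    ∑ c, L K deg σ a c * Linv K deg σ c b = if a = b then 1 else 0 := by
  have := mk_rel K deg σ (.L_Linv a b)
  simp only [map_sum, map_mul] at this
  refine this.trans ?_
  split_ifs <;> simp

theorem sum_Linv_L (a b : X) :
    ∑ c, Linv K deg σ a c * L K deg σ c b = if a = b then 1 else 0 := by
  have := mk_rel K deg σ (.Linv_L a b)
  simp only [map_sum, map_mul] at this
  refine this.trans ?_
  split_ifs <;> simp

theorem yangBaxter (a b c d : X) :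
    ∑ x, ∑ y, src K deg σ (σ x y a c) * L K deg σ y d * L K deg σ x b =
      ∑ x, ∑ y, tgt K deg σ (.op (σ b d x y)) * L K deg σ c y * L K deg σ a x := by
  have := mk_rel K deg σ (.yangBaxter a b c d)
  simp only [map_sum, map_mul] at this
  exact this

/-- The universal property of `A_σ`. -/
def lift {B : Type*} [Ring B] [Algebra K B] (β : (Λ → R) ⊗[K] (Λ → R)ᵐᵒᵖ →ₐ[K] B)
    (l li : X → X → B)
    (h1 : ∀ a b, ∑ c, l a c * li c b = if a = b then 1 else 0)
    (h2 : ∀ a b, ∑ c, li a c * l c b = if a = b then 1 else 0)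
    (h3 : ∀ f a b, β ((f ∘ deg a) ⊗ₜ 1) * l a b = l a b * β (f ⊗ₜ 1))
    (h4 : ∀ f a b, β (1 ⊗ₜ .op (f ∘ deg b)) * l a b = l a b * β (1 ⊗ₜ .op f))
    (h5 : ∀ f a b, β (f ⊗ₜ 1) * li a b = li a b * β ((f ∘ deg b) ⊗ₜ 1))
    (h6 : ∀ f a b, β (1 ⊗ₜ .op f) * li a b = li a b * β (1 ⊗ₜ .op (f ∘ deg a)))
    (h7 : ∀ a b c d, ∑ x, ∑ y, β (σ x y a c ⊗ₜ 1) * l y d * l x b =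
      ∑ x, ∑ y, β (1 ⊗ₜ .op (σ b d x y)) * l c y * l a x) :
    FRTAlg K deg σ →ₐ[K] B :=
  RingQuot.liftAlgHom K ⟨FreeAlgebra.lift K (fun g => match g with
    | .base ξ => β ξ
    | .L a b => l a b
    | .Linv a b => li a b), by
      intro x y h
      induction h with
      | add ξ η => simp
      | smul c ξ => simp
      | mul ξ η => simp
      | L_Linv a b => simp only [map_sum, map_mul, FreeAlgebra.lift_ι_apply, h1]; split_ifs <;> simp
      | Linv_L a b => simp only [map_sum, map_mul, FreeAlgebra.lift_ι_apply, h2]; split_ifs <;> simp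
      | L_left f a b => simpa using h3 f a b
      | L_right f a b => simpa using h4 f a b
      | Linv_left f a b => simpa using h5 f a b
      | Linv_right f a b => simpa using h6 f a b
      | yangBaxter a b c d => simpa using h7 a b c d
      | one => simp [← Algebra.TensorProduct.one_def]⟩

section lift

variable {B : Type*} [Ring B] [Algebra K B] {β : (Λ → R) ⊗[K] (Λ → R)ᵐᵒᵖ →ₐ[K] B}
    {l li : X → X → B}
    {h1 : ∀ a b, ∑ c, l a c * li c b = if a = b then 1 else 0}
    {h2 : ∀ a b, ∑ c, li a c * l c b = if a = b then 1 else 0}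
    {h3 : ∀ f a b, β ((f ∘ deg a) ⊗ₜ 1) * l a b = l a b * β (f ⊗ₜ 1)}
    {h4 : ∀ f a b, β (1 ⊗ₜ .op (f ∘ deg b)) * l a b = l a b * β (1 ⊗ₜ .op f)}
    {h5 : ∀ f a b, β (f ⊗ₜ 1) * li a b = li a b * β ((f ∘ deg b) ⊗ₜ 1)}
    {h6 : ∀ f a b, β (1 ⊗ₜ .op f) * li a b = li a b * β (1 ⊗ₜ .op (f ∘ deg a))}
    {h7 : ∀ a b c d, ∑ x, ∑ y, β (σ x y a c ⊗ₜ 1) * l y d * l x b =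
      ∑ x, ∑ y, β (1 ⊗ₜ .op (σ b d x y)) * l c y * l a x}

theorem lift_mk (g : Gen K R Λ X) :
    lift K deg σ β l li h1 h2 h3 h4 h5 h6 h7 (mk K deg σ (FreeAlgebra.ι K g)) = (match g with
      | .base ξ => β ξ
      | .L a b => l a b
      | .Linv a b => li a b) := by
  rw [lift, mk]
  erw [RingQuot.liftAlgHom_mkAlgHom_apply]
  rw [FreeAlgebra.lift_ι_apply]

end lift

/-- The homomorphism `Δbar` from the free algebra to `A_σ ⊗ A_σ`:
`ξ ↦ (s ⊗ t)(ξ)`, `L_{ab} ↦ ∑ L_{ac} ⊗ L_{cb}`, `(L⁻¹)_{ab} ↦ ∑ (L⁻¹)_{cb} ⊗ (L⁻¹)_{ac}`. -/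
def deltaBar : FreeAlgebra K (Gen K R Λ X) →ₐ[K] FRTAlg K deg σ ⊗[K] FRTAlg K deg σ :=
  FreeAlgebra.lift K (fun g => match g with
    | .base ξ => Algebra.TensorProduct.map (src K deg σ) (tgt K deg σ) ξ
    | .L a b => ∑ c, L K deg σ a c ⊗ₜ L K deg σ c b
    | .Linv a b => ∑ c, Linv K deg σ c b ⊗ₜ Linv K deg σ a c)

theorem base_mem (ξ : (Λ → R) ⊗[K] (Λ → R)ᵐᵒᵖ) :
    Algebra.TensorProduct.map (src K deg σ) (tgt K deg σ) ξ ∈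
      takeuchi (src K deg σ) (tgt K deg σ) := by
  induction ξ with
  | zero => rw [map_zero]; exact zero_mem _
  | add x y hx hy => rw [map_add]; exact add_mem hx hy
  | tmul f g =>
    apply mem_takeuchi
    intro l
    have h1 := (src_tgt_comm K deg σ f (.op l)).eq
    have h2 := (src_tgt_comm K deg σ l g).eq
    refine Submodule.subset_span ⟨l, src K deg σ f ⊗ₜ tgt K deg σ g, ?_⟩
    simp [mul_sub, sub_mul, h1, h2]

theorem L_mem (a b : X) : ∑ c, L K deg σ a c ⊗ₜ[K] L K deg σ c b ∈
    takeuchi (src K deg σ) (tgt K deg σ) := by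
  apply mem_takeuchi
  intro l
  rw [Finset.sum_mul]
  refine Submodule.sum_mem _ fun c _ => ?_
  refine Submodule.subset_span ⟨l ∘ deg c, L K deg σ a c ⊗ₜ L K deg σ c b, ?_⟩
  simp [mul_sub, sub_mul, L_src, L_tgt]

theorem Linv_mem (a b : X) : ∑ c, Linv K deg σ c b ⊗ₜ[K] Linv K deg σ a c ∈
    takeuchi (src K deg σ) (tgt K deg σ) := by
  apply mem_takeuchi
  intro l
  rw [Finset.sum_mul]
  refine Submodule.sum_mem _ fun c _ => ?_
  refine Submodule.subset_span ⟨l ∘ (deg c).symm, Linv K deg σ c b ⊗ₜ Linv K deg σ a c, ?_⟩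
  have : (l ∘ (deg c).symm) ∘ deg c = l := by ext; simp
  simp [mul_sub, sub_mul, src_Linv, tgt_Linv, this]

theorem delta_L_Linv (a b : X) :
    ∑ c, (∑ d, L K deg σ a d ⊗ₜ[K] L K deg σ d c) * (∑ e, Linv K deg σ e b ⊗ₜ[K] Linv K deg σ c e) =
      if a = b then 1 else 0 := by
  have h : ∀ c, (∑ d, L K deg σ a d ⊗ₜ[K] L K deg σ d c) *
      (∑ e, Linv K deg σ e b ⊗ₜ[K] Linv K deg σ c e) =
      ∑ d, ∑ e, (L K deg σ a d * Linv K deg σ e b) ⊗ₜ[K] (L K deg σ d c * Linv K deg σ c e) := by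
    intro c
    simp only [Finset.sum_mul, Finset.mul_sum, Algebra.TensorProduct.tmul_mul_tmul]
    exact Finset.sum_comm
  simp only [h]
  rw [Finset.sum_comm]
  simp_rw [Finset.sum_comm (s := Finset.univ) (t := Finset.univ) (f := fun c e =>
    (L K deg σ a _ * Linv K deg σ e b) ⊗ₜ[K] (L K deg σ _ c * Linv K deg σ c e)),
    ← TensorProduct.tmul_sum, sum_L_Linv]
  simp only [TensorProduct.tmul_ite, Finset.sum_ite_eq, Finset.mem_univ, if_true,
    ← TensorProduct.sum_tmul, sum_L_Linv]
  split_ifs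
  · rfl
  · simp

theorem delta_Linv_L (a b : X) :
    ∑ c, (∑ e, Linv K deg σ e c ⊗ₜ[K] Linv K deg σ a e) * (∑ d, L K deg σ c d ⊗ₜ[K] L K deg σ d b) =
      if a = b then 1 else 0 := by
  have h : ∀ c, (∑ e, Linv K deg σ e c ⊗ₜ[K] Linv K deg σ a e) *
      (∑ d, L K deg σ c d ⊗ₜ[K] L K deg σ d b) =
      ∑ e, ∑ d, (Linv K deg σ e c * L K deg σ c d) ⊗ₜ[K] (Linv K deg σ a e * L K deg σ d b) := by
    intro c
    simp only [Finset.sum_mul, Finset.mul_sum, Algebra.TensorProduct.tmul_mul_tmul]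
    exact Finset.sum_comm
  simp only [h]
  rw [Finset.sum_comm]
  simp_rw [Finset.sum_comm (s := Finset.univ) (t := Finset.univ) (f := fun c d =>
    (Linv K deg σ _ c * L K deg σ c d) ⊗ₜ[K] (Linv K deg σ a _ * L K deg σ d b)),
    ← TensorProduct.sum_tmul, sum_Linv_L]
  simp only [TensorProduct.ite_tmul, Finset.sum_ite_eq, Finset.mem_univ, if_true,
    ← TensorProduct.tmul_sum, sum_Linv_L]
  split_ifs
  · rfl
  · simp

theorem delta_yangBaxter (a b c d : X) :
    (∑ x, ∑ y, Algebra.TensorProduct.map (src K deg σ) (tgt K deg σ) (σ x y a c ⊗ₜ 1) *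
        (∑ e, L K deg σ y e ⊗ₜ[K] L K deg σ e d) * (∑ f, L K deg σ x f ⊗ₜ[K] L K deg σ f b)) -
      (∑ x, ∑ y, Algebra.TensorProduct.map (src K deg σ) (tgt K deg σ) (1 ⊗ₜ .op (σ b d x y)) *
        (∑ e, L K deg σ c e ⊗ₜ[K] L K deg σ e y) * (∑ f, L K deg σ a f ⊗ₜ[K] L K deg σ f x)) ∈
      balancedIdeal (src K deg σ) (tgt K deg σ) := by
  have h1 : (∑ x, ∑ y, Algebra.TensorProduct.map (src K deg σ) (tgt K deg σ) (σ x y a c ⊗ₜ 1) *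
        (∑ e, L K deg σ y e ⊗ₜ[K] L K deg σ e d) * (∑ f, L K deg σ x f ⊗ₜ[K] L K deg σ f b)) =
      ∑ e, ∑ f, ∑ x, ∑ y, (tgt K deg σ (.op (σ f e x y)) * L K deg σ c y * L K deg σ a x) ⊗ₜ[K]
        (L K deg σ e d * L K deg σ f b) := by
    simp_rw [← TensorProduct.sum_tmul, ← yangBaxter, TensorProduct.sum_tmul]
    calc _ = ∑ x, ∑ y, ∑ e, ∑ f, (src K deg σ (σ x y a c) * L K deg σ y e * L K deg σ x f) ⊗ₜ[K]
          (L K deg σ e d * L K deg σ f b) := by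
          refine Finset.sum_congr rfl fun x _ => Finset.sum_congr rfl fun y _ => ?_
          simp only [Finset.sum_mul, Finset.mul_sum, Algebra.TensorProduct.tmul_mul_tmul,
            Algebra.TensorProduct.map_tmul, map_one, one_mul]
          exact Finset.sum_comm
      _ = ∑ p : X × X, ∑ q : X × X,
          (src K deg σ (σ p.1 p.2 a c) * L K deg σ p.2 q.1 * L K deg σ p.1 q.2) ⊗ₜ[K]
            (L K deg σ q.1 d * L K deg σ q.2 b) := by simp only [Fintype.sum_prod_type]
      _ = _ := by rw [Finset.sum_comm]; simp only [Fintype.sum_prod_type]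
  have h2 : (∑ x, ∑ y, Algebra.TensorProduct.map (src K deg σ) (tgt K deg σ)
        (1 ⊗ₜ .op (σ b d x y)) *
        (∑ e, L K deg σ c e ⊗ₜ[K] L K deg σ e y) * (∑ f, L K deg σ a f ⊗ₜ[K] L K deg σ f x)) =
      ∑ e, ∑ f, ∑ x, ∑ y, (L K deg σ c y * L K deg σ a x) ⊗ₜ[K]
        (src K deg σ (σ f e x y) * L K deg σ e d * L K deg σ f b) := by
    calc _ = ∑ x, ∑ y, ∑ e, ∑ f, (L K deg σ c e * L K deg σ a f) ⊗ₜ[K]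
          (tgt K deg σ (.op (σ b d x y)) * L K deg σ e y * L K deg σ f x) := by
          refine Finset.sum_congr rfl fun x _ => Finset.sum_congr rfl fun y _ => ?_
          simp only [Finset.sum_mul, Finset.mul_sum, Algebra.TensorProduct.tmul_mul_tmul,
            Algebra.TensorProduct.map_tmul, map_one, one_mul]
          exact Finset.sum_comm
      _ = ∑ p : X × X, ∑ q : X × X, (L K deg σ c q.1 * L K deg σ a q.2) ⊗ₜ[K]
          (tgt K deg σ (.op (σ b d p.1 p.2)) * L K deg σ q.1 p.2 * L K deg σ q.2 p.1) := by
          simp only [Fintype.sum_prod_type]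
      _ = ∑ q : X × X, (L K deg σ c q.1 * L K deg σ a q.2) ⊗ₜ[K]
          (∑ x, ∑ y, src K deg σ (σ x y q.2 q.1) * L K deg σ y d * L K deg σ x b) := by
          rw [Finset.sum_comm]
          simp only [yangBaxter, ← TensorProduct.tmul_sum, Fintype.sum_prod_type]
      _ = ∑ q : X × X, ∑ p : X × X, (L K deg σ c q.2 * L K deg σ a q.1) ⊗ₜ[K]
          (src K deg σ (σ p.2 p.1 q.1 q.2) * L K deg σ p.1 d * L K deg σ p.2 b) := by
          rw [← Equiv.sum_comp (Equiv.prodComm X X)]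
          refine Finset.sum_congr rfl fun q _ => ?_
          rw [← TensorProduct.tmul_sum, ← Equiv.sum_comp (Equiv.prodComm X X)]
          simp only [Fintype.sum_prod_type]
          rfl
      _ = _ := by rw [Finset.sum_comm]; simp only [Fintype.sum_prod_type]
  rw [h1, h2]
  simp only [← Finset.sum_sub_distrib]
  refine Submodule.sum_mem _ fun e _ => Submodule.sum_mem _ fun f _ => Submodule.sum_mem _
    fun x _ => Submodule.sum_mem _ fun y _ => ?_
  refine Submodule.subset_span ⟨σ f e x y, (L K deg σ c y * L K deg σ a x) ⊗ₜ
    (L K deg σ e d * L K deg σ f b), ?_⟩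
  simp [sub_mul, mul_assoc]

/-- The action of `A_σ` on `A_σ ⊗_{M_Λ(R)} A_σ` by left multiplication with `Δ(a)`. -/
def deltaAct :
    FRTAlg K deg σ →ₐ[K] Module.End K (BalancedTensor (src K deg σ) (tgt K deg σ)) :=
  lift K deg σ
    ((takeuchiAct _ _).comp ((Algebra.TensorProduct.map (src K deg σ) (tgt K deg σ)).codRestrict
      (takeuchi (src K deg σ) (tgt K deg σ)) (base_mem K deg σ)))
    (fun a b => takeuchiAct _ _ ⟨_, L_mem K deg σ a b⟩)
    (fun a b => takeuchiAct _ _ ⟨_, Linv_mem K deg σ a b⟩)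
    (by
      intro a b
      simp only [← map_mul, ← map_sum]
      have : (∑ c, (⟨_, L_mem K deg σ a c⟩ : takeuchi (src K deg σ) (tgt K deg σ)) *
          ⟨_, Linv_mem K deg σ c b⟩) = if a = b then 1 else 0 := by
        apply Subtype.ext
        simpa [apply_ite] using delta_L_Linv K deg σ a b
      rw [this]; split_ifs <;> simp)
    (by
      intro a b
      simp only [← map_mul, ← map_sum]
      have : (∑ c, (⟨_, Linv_mem K deg σ a c⟩ : takeuchi (src K deg σ) (tgt K deg σ)) *
          ⟨_, L_mem K deg σ c b⟩) = if a = b then 1 else 0 := by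
        apply Subtype.ext
        simpa [apply_ite] using delta_Linv_L K deg σ a b
      rw [this]; split_ifs <;> simp)
    (by
      intro f a b
      simp only [AlgHom.comp_apply, ← map_mul]
      congr 1
      apply Subtype.ext
      simp [Finset.mul_sum, Finset.sum_mul, L_src])
    (by
      intro f a b
      simp only [AlgHom.comp_apply, ← map_mul]
      congr 1
      apply Subtype.ext
      simp [Finset.mul_sum, Finset.sum_mul, L_tgt])
    (by
      intro f a b
      simp only [AlgHom.comp_apply, ← map_mul]
      congr 1
      apply Subtype.ext
      simp [Finset.mul_sum, Finset.sum_mul, src_Linv])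
    (by
      intro f a b
      simp only [AlgHom.comp_apply, ← map_mul]
      congr 1
      apply Subtype.ext
      simp [Finset.mul_sum, Finset.sum_mul, tgt_Linv])
    (by
      intro a b c d
      simp only [AlgHom.comp_apply, ← map_mul, ← map_sum]
      apply takeuchiAct_congr
      simpa using delta_yangBaxter K deg σ a b c d)

/-- The comultiplication `Δ_{M_Λ(R)} : A_σ → A_σ ⊗_{M_Λ(R)} A_σ`; see `comulBase_mk`. -/
def comulBase : FRTAlg K deg σ →ₗ[K] BalancedTensor (src K deg σ) (tgt K deg σ) :=
  LinearMap.applyₗ (Submodule.Quotient.mk 1) ∘ₗ (deltaAct K deg σ).toLinearMap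

theorem comulBase_mk (x : FreeAlgebra K (Gen K R Λ X)) :
    comulBase K deg σ (mk K deg σ x) = Submodule.Quotient.mk (deltaBar K deg σ x) := by
  have h : ∀ y, deltaAct K deg σ (mk K deg σ x) (Submodule.Quotient.mk y) =
      Submodule.Quotient.mk (deltaBar K deg σ x * y) := by
    induction x using FreeAlgebra.induction with
    | grade0 r =>
      intro y
      rw [AlgHom.commutes, AlgHom.commutes, AlgHom.commutes, ← Algebra.smul_def]
      rfl
    | grade1 g =>
      intro y
      rw [deltaAct, lift_mk, deltaBar, FreeAlgebra.lift_ι_apply]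
      cases g <;> rfl
    | mul a b ha hb =>
      intro y
      rw [map_mul, map_mul, Module.End.mul_apply, hb, ha, map_mul, mul_assoc]
    | add a b ha hb =>
      intro y
      rw [map_add, map_add, LinearMap.add_apply, ha, hb, map_add, add_mul]
      rfl
  exact (h 1).trans (by rw [mul_one])

variable {deg σ}

theorem biMul_comm (K R Λ : Type*) [Field K] [Ring R] [Algebra K R] (f : Λ → R)
    (g : (Λ → R)ᵐᵒᵖ) : Commute (Algebra.lmul K (Λ → R) f)
      ((Algebra.lsmul K K (Λ → R) : (Λ → R)ᵐᵒᵖ →ₐ[K] Module.End K (Λ → R)) g) := by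
  apply LinearMap.ext
  intro h
  simp [mul_assoc]

/-- The action of `M_Λ(R) ⊗ M_Λ(R)^op` on `M_Λ(R)`, `(f ⊗ g) · h = f h g`. -/
def biMul (K R Λ : Type*) [Field K] [Ring R] [Algebra K R] :
    (Λ → R) ⊗[K] (Λ → R)ᵐᵒᵖ →ₐ[K] Module.End K (Λ → R) :=
  Algebra.TensorProduct.lift (Algebra.lmul K (Λ → R))
    (Algebra.lsmul K K (Λ → R) : (Λ → R)ᵐᵒᵖ →ₐ[K] Module.End K (Λ → R))
    (biMul_comm K R Λ)

theorem biMul_tmul (f : Λ → R) (g : (Λ → R)ᵐᵒᵖ) (h : Λ → R) :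
    biMul K R Λ (f ⊗ₜ g) h = f * h * g.unop := by
  rw [biMul, Algebra.TensorProduct.lift_tmul]
  simp [mul_assoc]

/-- The homomorphism `χ : A_σ → End(M_Λ(R))`: `f ⊗ g` acts by `h ↦ f h g`, `L_{ab}` by
`δ_{ab} T_{deg(a)}` and `(L⁻¹)_{ab}` by `δ_{ab} T_{deg(a)⁻¹}`, where `T_α(h)(v) = h(v α)`. -/
def chi (hσ : IsFRTFamily deg σ) : FRTAlg K deg σ →ₐ[K] Module.End K (Λ → R) :=
  lift K deg σ
    (biMul K R Λ)
    (fun a b => if a = b then LinearMap.funLeft K R (deg a) else 0)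
    (fun a b => if a = b then LinearMap.funLeft K R (deg a).symm else 0)
    (by
      intro a b
      rw [Finset.sum_eq_single a (by intro c _ hc; simp [Ne.symm hc]) (by simp), if_pos rfl]
      split_ifs with h
      · ext f v; simp [LinearMap.funLeft]
      · simp)
    (by
      intro a b
      rw [Finset.sum_eq_single a (by intro c _ hc; simp [Ne.symm hc]) (by simp), if_pos rfl]
      split_ifs with h
      · ext f v; simp [LinearMap.funLeft]
      · simp)
    (by
      intro f a b
      split_ifs with h
      · ext g v; simp [LinearMap.funLeft, biMul_tmul]
      · simp)
    (by
      intro f a b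
      split_ifs with h
      · subst h; ext g v; simp [LinearMap.funLeft, biMul_tmul]
      · simp)
    (by
      intro f a b
      split_ifs with h
      · subst h; ext g v; simp [LinearMap.funLeft, biMul_tmul]
      · simp)
    (by
      intro f a b
      split_ifs with h
      · ext g v; simp [LinearMap.funLeft, biMul_tmul]
      · simp)
    (by
      intro a b c d
      rw [Finset.sum_eq_single b (by intro x _ hx; simp [hx]) (by simp),
        Finset.sum_eq_single d (by intro x _ hx; simp [hx]) (by simp),
        Finset.sum_eq_single a (by intro x _ hx; simp [Ne.symm hx]) (by simp),
        Finset.sum_eq_single c (by intro x _ hx; simp [Ne.symm hx]) (by simp)]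
      ext g v
      have hc := Subring.mem_center_iff.1 (hσ.central b d a c v)
      by_cases hv : deg b (deg d v) = deg a (deg c v)
      · simp [LinearMap.funLeft, biMul_tmul, hv, hc]
      · simp [LinearMap.funLeft, biMul_tmul, hσ.invariant a b c d v hv])

/-- The counit `π_{M_Λ(R)}(a) = χ(a)(1)`. -/
def counitBase (hσ : IsFRTFamily deg σ) : FRTAlg K deg σ →ₗ[K] (Λ → R) :=
  LinearMap.applyₗ (1 : Λ → R) ∘ₗ (chi K hσ).toLinearMap

end FRTAlg

end Asigma

/-! ### The algebra `𝔊(Q)` of a finite quiver -/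

section Quiver

variable {Λ Q : Type*}

/-- `IsPathFrom s t v l`: the list of arrows `l` is composable and starts at the vertex `v`. -/
def IsPathFrom (s t : Q → Λ) : Λ → List Q → Prop
  | _, [] => True
  | v, a :: l => s a = v ∧ IsPathFrom s t (t a) l

/-- The end point of a list of arrows starting at the vertex `v`. -/
def endPoint (t : Q → Λ) : Λ → List Q → Λ
  | v, [] => v
  | _, a :: l => endPoint t (t a) l

theorem isPathFrom_append {s t : Q → Λ} {v : Λ} {l l' : List Q} :
    IsPathFrom s t v (l ++ l') ↔ IsPathFrom s t v l ∧ IsPathFrom s t (endPoint t v l) l' := by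
  induction l generalizing v with
  | nil => simp [IsPathFrom, endPoint]
  | cons a l ih => simp [IsPathFrom, endPoint, ih, and_assoc]

theorem endPoint_append {t : Q → Λ} {v : Λ} {l l' : List Q} :
    endPoint t v (l ++ l') = endPoint t (endPoint t v l) l' := by
  induction l generalizing v with
  | nil => rfl
  | cons a l ih => simp [endPoint, ih]

/-- A path of the quiver `Q` over `Λ` with source map `s` and target map `t`: an element of the
disjoint union of the fiber products `Q^(m)`, `m ≥ 0`, where `Q^(0) = Λ` (the empty lists, with
their base vertex). For a nonempty list of arrows the vertex `src` is the source of the first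
arrow. -/
@[ext]
structure QPath (s t : Q → Λ) where
  src : Λ
  arrows : List Q
  isPath : IsPathFrom s t src arrows

namespace QPath

variable {s t : Q → Λ}

/-- The target of a path. -/
def tgt (p : QPath s t) : Λ := endPoint t p.src p.arrows

/-- The length of a path. -/
def length (p : QPath s t) : ℕ := p.arrows.length

/-- The path of length `0` at a vertex. -/
def nil (v : Λ) : QPath s t := ⟨v, [], trivial⟩

/-- The path of length `1` given by an arrow. -/
def single (a : Q) : QPath s t := ⟨s a, [a], rfl, trivial⟩

/-- The concatenation of composable paths. -/
def comp (p q : QPath s t) (h : p.tgt = q.src) : QPath s t :=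
  ⟨p.src, p.arrows ++ q.arrows, isPathFrom_append.2 ⟨p.isPath, by
    have := q.isPath; rw [← h] at this; exact this⟩⟩

theorem comp_tgt (p q : QPath s t) (h : p.tgt = q.src) : (p.comp q h).tgt = q.tgt := by
  simp only [tgt, comp, endPoint_append]
  rw [← h]; rfl

theorem comp_length (p q : QPath s t) (h : p.tgt = q.src) :
    (p.comp q h).length = p.length + q.length := by
  simp [length, comp]

/-- The set `Q^(m)` of paths of length `m`. -/
abbrev OfLength (s t : Q → Λ) (m : ℕ) : Type _ := {p : QPath s t // p.length = m}

instance [Finite Λ] [Finite Q] (m : ℕ) : Finite (OfLength s t m) :=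
  Finite.of_injective (β := Λ × List.Vector Q m) (fun p => (p.1.src, ⟨p.1.arrows, p.2⟩)) (by
    intro p q h
    exact Subtype.ext (QPath.ext (congrArg Prod.fst h)
      (congrArg (fun z => z.2.toList) h)))

instance [Finite Λ] [Finite Q] (m : ℕ) : Fintype (OfLength s t m) := Fintype.ofFinite _

end QPath

/-- The basis symbols `e[p; q]` of `𝔊(Q)`: pairs of paths of the same length. -/
@[ext]
structure Sym (s t : Q → Λ) where
  top : QPath s t
  bot : QPath s t
  length_eq : top.length = bot.length

namespace Sym

variable {s t : Q → Λ}

/-- The symbols `e[v; w]` for vertices `v`, `w`. -/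
def vertex (v w : Λ) : Sym s t := ⟨.nil v, .nil w, rfl⟩

/-- The symbols `e[a; b]` for arrows `a`, `b`. -/
def arrow (a b : Q) : Sym s t := ⟨.single a, .single b, rfl⟩

/-- The product of `e[p; q]` and `e[p'; q']` is nonzero. -/
def Composable (x y : Sym s t) : Prop := x.top.tgt = y.top.src ∧ x.bot.tgt = y.bot.src

/-- The symbol `e[pp'; qq']`. -/
def comp (x y : Sym s t) (h : x.Composable y) : Sym s t :=
  ⟨x.top.comp y.top h.1, x.bot.comp y.bot h.2, by
    rw [QPath.comp_length, QPath.comp_length, x.length_eq, y.length_eq]⟩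

theorem composable_comp_left {x y z : Sym s t} (h : x.Composable y) :
    (x.comp y h).Composable z ↔ y.Composable z := by
  simp only [Composable, comp, QPath.comp_tgt]

theorem composable_comp_right {x y z : Sym s t} (h : y.Composable z) :
    x.Composable (y.comp z h) ↔ x.Composable y := Iff.rfl

theorem comp_assoc {x y z : Sym s t} (h : x.Composable y) (h' : y.Composable z) :
    (x.comp y h).comp z ((composable_comp_left h).2 h') =
      x.comp (y.comp z h') ((composable_comp_right h').2 h) := by
  ext1 <;> exact QPath.ext rfl (List.append_assoc _ _ _)

end Sym

/-- The underlying vector space of `𝔊(Q)`, with basis the symbols `e[p; q]`. -/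
def GAlg (K : Type*) [Field K] (s t : Q → Λ) : Type _ := Sym s t →₀ K

namespace GAlg

variable (K : Type*) [Field K] (s t : Q → Λ)

instance : AddCommGroup (GAlg K s t) := inferInstanceAs (AddCommGroup (Sym s t →₀ K))

instance : Module K (GAlg K s t) := inferInstanceAs (Module K (Sym s t →₀ K))

variable {s t}

/-- The basis vector `e[p; q]`. -/
def e (x : Sym s t) : GAlg K s t := Finsupp.single x 1

/-- The basis of `𝔊(Q)`. -/
def basis : Module.Basis (Sym s t) K (GAlg K s t) := Module.Basis.ofRepr (LinearEquiv.refl K _)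

theorem basis_apply (x : Sym s t) : basis K x = e K x := rfl

open Classical in
/-- The multiplication of basis vectors. -/
def symMul (x y : Sym s t) : GAlg K s t :=
  if h : x.Composable y then e K (x.comp y h) else 0

/-- The multiplication of `𝔊(Q)` as a bilinear map. -/
def mulMap : GAlg K s t →ₗ[K] GAlg K s t →ₗ[K] GAlg K s t :=
  (basis K).constr K fun x => (basis K).constr K fun y => symMul K x y

instance : Mul (GAlg K s t) := ⟨fun a b => mulMap K a b⟩

theorem mul_def (a b : GAlg K s t) : a * b = mulMap K a b := rfl

theorem e_mul_e' (x y : Sym s t) : e K x * e K y = symMul K x y := by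
  rw [mul_def, ← basis_apply, ← basis_apply, mulMap, Module.Basis.constr_basis,
    Module.Basis.constr_basis]

theorem e_mul_e {x y : Sym s t} (h : x.Composable y) : e K x * e K y = e K (x.comp y h) := by
  rw [e_mul_e', symMul, dif_pos h]

theorem e_mul_e_of_not {x y : Sym s t} (h : ¬ x.Composable y) : e K x * e K y = 0 := by
  rw [e_mul_e', symMul, dif_neg h]

theorem vertex_mul (v w : Λ) (x : Sym s t) [Decidable (v = x.top.src ∧ w = x.bot.src)] :
    e K (Sym.vertex v w) * e K x = if v = x.top.src ∧ w = x.bot.src then e K x else 0 := by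
  split_ifs with h
  · rw [e_mul_e K (show (Sym.vertex v w).Composable x from h)]
    congr 1
    obtain ⟨rfl, rfl⟩ := h
    rfl
  · exact e_mul_e_of_not K h

theorem mul_vertex (v w : Λ) (x : Sym s t) [Decidable (x.top.tgt = v ∧ x.bot.tgt = w)] :
    e K x * e K (Sym.vertex v w) = if x.top.tgt = v ∧ x.bot.tgt = w then e K x else 0 := by
  split_ifs with h
  · rw [e_mul_e K (show x.Composable (Sym.vertex v w) from h)]
    congr 1
    ext1 <;> exact QPath.ext rfl (List.append_nil _)
  · exact e_mul_e_of_not K h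

theorem add_mul' (a b c : GAlg K s t) : (a + b) * c = a * c + b * c := by simp [mul_def]

theorem mul_add' (a b c : GAlg K s t) : a * (b + c) = a * b + a * c := by simp [mul_def]

theorem smul_mul' (r : K) (a b : GAlg K s t) : (r • a) * b = r • (a * b) := by simp [mul_def]

theorem mul_smul' (r : K) (a b : GAlg K s t) : a * (r • b) = r • (a * b) := by simp [mul_def]

variable {K} in
theorem induction_e {P : GAlg K s t → Prop} (a : GAlg K s t) (zero : P 0)
    (add : ∀ a b, P a → P b → P (a + b)) (smul : ∀ (r : K) x, P (r • e K x)) : P a := by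
  induction a using Finsupp.induction_linear with
  | zero => exact zero
  | add f g hf hg => exact add _ _ hf hg
  | single x r =>
    have : (Finsupp.single x r : Sym s t →₀ K) = r • Finsupp.single x 1 := by simp
    rw [this]
    exact smul r x

theorem zero_mul' (a : GAlg K s t) : 0 * a = 0 := by simp [mul_def]

theorem mul_zero' (a : GAlg K s t) : a * 0 = 0 := by simp [mul_def]

theorem mul_assoc' (a b c : GAlg K s t) : a * b * c = a * (b * c) := by
  induction a using induction_e with
  | zero => simp only [zero_mul']
  | add a a' ha ha' => simp only [add_mul', ha, ha']
  | smul r x =>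
    simp only [smul_mul']
    congr 1
    induction b using induction_e with
    | zero => simp only [zero_mul', mul_zero']
    | add a a' ha ha' => simp only [add_mul', mul_add', ha, ha']
    | smul r y =>
      simp only [smul_mul', mul_smul']
      congr 1
      induction c using induction_e with
      | zero => simp only [mul_zero']
      | add a a' ha ha' => simp only [mul_add', ha, ha']
      | smul r z =>
        simp only [mul_smul']
        congr 1
        by_cases h : x.Composable y
        · by_cases h' : y.Composable z
          · rw [e_mul_e K h, e_mul_e K h', e_mul_e K ((Sym.composable_comp_left h).2 h'),
              e_mul_e K ((Sym.composable_comp_right h').2 h), Sym.comp_assoc h h']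
          · rw [e_mul_e K h, e_mul_e_of_not K h', mul_zero',
              e_mul_e_of_not K (fun hh => h' ((Sym.composable_comp_left h).1 hh))]
        · by_cases h' : y.Composable z
          · rw [e_mul_e_of_not K h, e_mul_e K h', zero_mul',
              e_mul_e_of_not K (fun hh => h ((Sym.composable_comp_right h').1 hh))]
          · rw [e_mul_e_of_not K h, e_mul_e_of_not K h', zero_mul', mul_zero']

theorem sum_mul' {ι : Type*} (u : Finset ι) (f : ι → GAlg K s t) (a : GAlg K s t) :
    (∑ i ∈ u, f i) * a = ∑ i ∈ u, f i * a := by simp [mul_def]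

theorem mul_sum' {ι : Type*} (u : Finset ι) (f : ι → GAlg K s t) (a : GAlg K s t) :
    a * (∑ i ∈ u, f i) = ∑ i ∈ u, a * f i := by simp [mul_def]

variable [Fintype Λ]

instance : One (GAlg K s t) := ⟨∑ v : Λ, ∑ w : Λ, e K (Sym.vertex v w)⟩

theorem one_def : (1 : GAlg K s t) = ∑ v : Λ, ∑ w : Λ, e K (Sym.vertex v w) := rfl

theorem one_mul' (a : GAlg K s t) : 1 * a = a := by
  classical
  induction a using induction_e with
  | zero => simp only [mul_zero']
  | add a a' ha ha' => simp only [mul_add', ha, ha']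
  | smul r x =>
    simp only [mul_smul']
    congr 1
    simp only [one_def, sum_mul', vertex_mul, ite_and, Finset.sum_ite_irrel, Finset.sum_const_zero,
      Finset.sum_ite_eq', Finset.mem_univ, if_true]

theorem mul_one' (a : GAlg K s t) : a * 1 = a := by
  classical
  induction a using induction_e with
  | zero => simp only [zero_mul']
  | add a a' ha ha' => simp only [add_mul', ha, ha']
  | smul r x =>
    simp only [smul_mul']
    congr 1
    simp only [one_def, mul_sum', mul_vertex, ite_and, Finset.sum_ite_irrel, Finset.sum_const_zero,
      Finset.sum_ite_eq, Finset.mem_univ, if_true]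

instance : Ring (GAlg K s t) :=
  { (inferInstance : AddCommGroup (GAlg K s t)), (inferInstance : Mul (GAlg K s t)),
    (inferInstance : One (GAlg K s t)) with
    left_distrib := mul_add' K
    right_distrib := add_mul' K
    zero_mul := zero_mul' K
    mul_zero := mul_zero' K
    mul_assoc := mul_assoc' K
    one_mul := one_mul' K
    mul_one := mul_one' K }

instance : Algebra K (GAlg K s t) :=
  Algebra.ofModule (fun r a b => smul_mul' K r a b) (fun r a b => mul_smul' K r a b)

/-- Algebra homomorphisms out of `𝔊(Q)`. -/
def lift {B : Type*} [Ring B] [Algebra K B] (φ : Sym s t → B)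
    (hmul : ∀ x y (h : x.Composable y), φ x * φ y = φ (x.comp y h))
    (hzero : ∀ x y, ¬ x.Composable y → φ x * φ y = 0)
    (hone : ∑ v : Λ, ∑ w : Λ, φ (Sym.vertex v w) = 1) : GAlg K s t →ₐ[K] B :=
  have he : ∀ x, (basis K).constr K φ (e K x) = φ x := fun x => (basis K).constr_basis K φ x
  AlgHom.ofLinearMap ((basis K).constr K φ)
    (by simp only [one_def, map_sum, he, hone])
    (by
      intro a b
      induction a using induction_e with
      | zero => simp
      | add a a' ha ha' => simp only [add_mul, map_add, ha, ha']
      | smul r x =>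
        simp only [smul_mul_assoc, map_smul]
        congr 1
        induction b using induction_e with
        | zero => simp
        | add a a' ha ha' => simp only [mul_add, map_add, ha, ha']
        | smul r y =>
          simp only [mul_smul_comm, map_smul]
          congr 1
          by_cases h : x.Composable y
          · rw [e_mul_e K h, he, he, he, hmul]
          · rw [e_mul_e_of_not K h, he, he, hzero x y h, map_zero])

theorem lift_e {B : Type*} [Ring B] [Algebra K B] {φ : Sym s t → B}
    {hmul : ∀ x y (h : x.Composable y), φ x * φ y = φ (x.comp y h)}
    {hzero : ∀ x y, ¬ x.Composable y → φ x * φ y = 0}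
    {hone : ∑ v : Λ, ∑ w : Λ, φ (Sym.vertex v w) = 1} (x : Sym s t) :
    lift K φ hmul hzero hone (e K x) = φ x := (basis K).constr_basis K φ x

end GAlg
end Quiver

/-! ### The algebra `𝔄(w)` -/

section Face

/-- The conditions on the weights `w`, where `w a b c d` (for composable `(a, b)` and `(c, d)`) is
the weight of the face with top arrow `a`, right arrow `b`, left arrow `c`, bottom arrow `d`. -/
structure IsFaceWeight {R Λ Q : Type*} [Ring R] (s t : Q → Λ) (w : Q → Q → Q → Q → R) : Prop where
  central : ∀ a b c d, t a = s b → t c = s d → w a b c d ∈ Subring.center R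
  face : ∀ a b c d, t a = s b → t c = s d → (s a ≠ s c ∨ t b ≠ t d) → w a b c d = 0

variable (K : Type*) {R Λ Q : Type*} [Field K] [Ring R] [Algebra K R] [Fintype Λ]

/-- The algebra `ℌ(Q) = R ⊗ R^op ⊗ 𝔊(Q)`. -/
def HAlg (R : Type*) [Ring R] [Algebra K R] (s t : Q → Λ) : Type _ :=
  (R ⊗[K] Rᵐᵒᵖ) ⊗[K] GAlg K s t

namespace HAlg

variable (s t : Q → Λ)

instance : Ring (HAlg K R s t) := inferInstanceAs (Ring ((R ⊗[K] Rᵐᵒᵖ) ⊗[K] GAlg K s t))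

instance : Algebra K (HAlg K R s t) :=
  inferInstanceAs (Algebra K ((R ⊗[K] Rᵐᵒᵖ) ⊗[K] GAlg K s t))

variable {s t}

/-- The element `r ⊗ r' ⊗ g`. -/
def tmul (r : R) (r' : Rᵐᵒᵖ) (g : GAlg K s t) : HAlg K R s t :=
  ((r ⊗ₜ[K] r') ⊗ₜ[K] g : (R ⊗[K] Rᵐᵒᵖ) ⊗[K] GAlg K s t)

theorem tmul_mul_tmul (a b : R) (a' b' : Rᵐᵒᵖ) (g h : GAlg K s t) :
    tmul K a a' g * tmul K b b' h = tmul K (a * b) (a' * b') (g * h) := by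
  have := Algebra.TensorProduct.tmul_mul_tmul (R := K) (a ⊗ₜ[K] a') (b ⊗ₜ[K] b') g h
  have h' := Algebra.TensorProduct.tmul_mul_tmul (R := K) a b a' b'
  rw [h'] at this
  exact this

variable (s t)

/-- The map `r ↦ r ⊗ 1 ⊗ 1`. -/
def left : R →ₐ[K] HAlg K R s t :=
  (Algebra.TensorProduct.includeLeft.comp Algebra.TensorProduct.includeLeft :
    R →ₐ[K] (R ⊗[K] Rᵐᵒᵖ) ⊗[K] GAlg K s t)

/-- The map `r ↦ 1 ⊗ r ⊗ 1`. -/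
def right : Rᵐᵒᵖ →ₐ[K] HAlg K R s t :=
  (Algebra.TensorProduct.includeLeft.comp Algebra.TensorProduct.includeRight :
    Rᵐᵒᵖ →ₐ[K] (R ⊗[K] Rᵐᵒᵖ) ⊗[K] GAlg K s t)

/-- The map `g ↦ 1 ⊗ 1 ⊗ g`. -/
def ofG : GAlg K s t →ₐ[K] HAlg K R s t :=
  (Algebra.TensorProduct.includeRight : GAlg K s t →ₐ[K] (R ⊗[K] Rᵐᵒᵖ) ⊗[K] GAlg K s t)

theorem left_apply (r : R) : left K s t r = tmul K r 1 1 := rfl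

theorem right_apply (r : Rᵐᵒᵖ) : right K s t r = tmul K (1 : R) r 1 := rfl

theorem ofG_apply (g : GAlg K s t) : ofG K s t g = tmul K (1 : R) 1 g := rfl

variable {s t}

/-- Algebra homomorphisms out of `ℌ(Q)`. -/
def lift {B : Type*} [Ring B] [Algebra K B] (α : R →ₐ[K] B) (β : Rᵐᵒᵖ →ₐ[K] B)
    (γ : GAlg K s t →ₐ[K] B) (h1 : ∀ r r', Commute (α r) (β r'))
    (h2 : ∀ r x, Commute (α r) (γ (GAlg.e K x))) (h3 : ∀ r x, Commute (β r) (γ (GAlg.e K x))) :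
    HAlg K R s t →ₐ[K] B :=
  (Algebra.TensorProduct.lift (Algebra.TensorProduct.lift α β h1) γ (by
      have h2' : ∀ r g, Commute (α r) (γ g) := by
        intro r g
        induction g using GAlg.induction_e with
        | zero => simp
        | add a b ha hb => rw [map_add]; exact ha.add_right hb
        | smul c x => rw [map_smul]; exact (h2 r x).smul_right c
      have h3' : ∀ r g, Commute (β r) (γ g) := by
        intro r g
        induction g using GAlg.induction_e with
        | zero => simp
        | add a b ha hb => rw [map_add]; exact ha.add_right hb
        | smul c x => rw [map_smul]; exact (h3 r x).smul_right c
      intro z g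
      induction z with
      | zero => simp
      | add a b ha hb => rw [map_add]; exact ha.add_left hb
      | tmul r r' =>
        rw [Algebra.TensorProduct.lift_tmul]
        exact (h2' r g).mul_left (h3' r' g)) : (R ⊗[K] Rᵐᵒᵖ) ⊗[K] GAlg K s t →ₐ[K] B)

theorem lift_tmul {B : Type*} [Ring B] [Algebra K B] {α : R →ₐ[K] B} {β : Rᵐᵒᵖ →ₐ[K] B}
    {γ : GAlg K s t →ₐ[K] B} {h1 : ∀ r r', Commute (α r) (β r')}
    {h2 : ∀ r x, Commute (α r) (γ (GAlg.e K x))} {h3 : ∀ r x, Commute (β r) (γ (GAlg.e K x))}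
    (r : R) (r' : Rᵐᵒᵖ) (g : GAlg K s t) :
    lift K α β γ h1 h2 h3 (tmul K r r' g) = α r * β r' * γ g := rfl

end HAlg

variable [DecidableEq Λ] [Fintype Q]

/-- The set `Q^(2)` of composable pairs of arrows. -/
def composablePairs (s t : Q → Λ) : Finset (Q × Q) :=
  Finset.univ.filter fun xy => t xy.1 = s xy.2

/-- The defining relations of `𝔄(w)`. -/
inductive FaceRel (s t : Q → Λ) (w : Q → Q → Q → Q → R) : HAlg K R s t → HAlg K R s t → Prop
  | face (a b c d : Q) (hab : t a = s b) (hcd : t c = s d) : FaceRel s t w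
      (∑ xy ∈ composablePairs s t, HAlg.tmul K (w xy.1 xy.2 a b) 1
        (GAlg.e K (Sym.arrow xy.1 c) * GAlg.e K (Sym.arrow xy.2 d)))
      (∑ xy ∈ composablePairs s t, HAlg.tmul K 1 (.op (w c d xy.1 xy.2))
        (GAlg.e K (Sym.arrow a xy.1) * GAlg.e K (Sym.arrow b xy.2)))

variable (s t : Q → Λ) (w : Q → Q → Q → Q → R)

/-- The algebra `𝔄(w)`. -/
def FaceAlg : Type _ := RingQuot (FaceRel K s t w)

instance : Ring (FaceAlg K s t w) := inferInstanceAs (Ring (RingQuot (FaceRel K s t w)))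

instance : Algebra K (FaceAlg K s t w) :=
  inferInstanceAs (Algebra K (RingQuot (FaceRel K s t w)))

namespace FaceAlg

/-- The quotient map `ℌ(Q) → 𝔄(w)`. -/
def mk : HAlg K R s t →ₐ[K] FaceAlg K s t w := RingQuot.mkAlgHom K (FaceRel K s t w)

/-- The class of `r ⊗ 1 ⊗ 1`. -/
def left : R →ₐ[K] FaceAlg K s t w :=
  (mk K s t w).comp (HAlg.left K s t)

/-- The class of `1 ⊗ r ⊗ 1`. -/
def right : Rᵐᵒᵖ →ₐ[K] FaceAlg K s t w :=
  (mk K s t w).comp (HAlg.right K s t)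

/-- The class of `1 ⊗ 1 ⊗ g`. -/
def ofG : GAlg K s t →ₐ[K] FaceAlg K s t w :=
  (mk K s t w).comp (HAlg.ofG K s t)

/-- The class of `1 ⊗ 1 ⊗ e[p; q]`. -/
def E (x : Sym s t) : FaceAlg K s t w := ofG K s t w (GAlg.e K x)

theorem mk_tmul (r : R) (r' : Rᵐᵒᵖ) (g : GAlg K s t) :
    mk K s t w (HAlg.tmul K r r' g) = left K s t w r * right K s t w r' * ofG K s t w g := by
  simp [left, right, ofG, ← map_mul, HAlg.left_apply, HAlg.right_apply, HAlg.ofG_apply,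
    HAlg.tmul_mul_tmul]

theorem left_right (r : R) (r' : Rᵐᵒᵖ) : Commute (left K s t w r) (right K s t w r') := by
  simp [left, right, Commute, SemiconjBy, ← map_mul, HAlg.left_apply, HAlg.right_apply,
    HAlg.tmul_mul_tmul]

theorem left_ofG (r : R) (g : GAlg K s t) : Commute (left K s t w r) (ofG K s t w g) := by
  simp [left, ofG, Commute, SemiconjBy, ← map_mul, HAlg.left_apply,
    HAlg.ofG_apply, HAlg.tmul_mul_tmul]

theorem right_ofG (r : Rᵐᵒᵖ) (g : GAlg K s t) : Commute (right K s t w r) (ofG K s t w g) := by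
  simp [right, ofG, Commute, SemiconjBy, ← map_mul, HAlg.right_apply,
    HAlg.ofG_apply, HAlg.tmul_mul_tmul]

theorem left_E (r : R) (x : Sym s t) : Commute (left K s t w r) (E K s t w x) :=
  left_ofG K s t w r _

theorem right_E (r : Rᵐᵒᵖ) (x : Sym s t) : Commute (right K s t w r) (E K s t w x) :=
  right_ofG K s t w r _

theorem E_mul_E {x y : Sym s t} (h : x.Composable y) :
    E K s t w x * E K s t w y = E K s t w (x.comp y h) := by
  rw [E, E, ← map_mul, GAlg.e_mul_e K h, E]

theorem E_mul_E_of_not {x y : Sym s t} (h : ¬ x.Composable y) :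
    E K s t w x * E K s t w y = 0 := by
  rw [E, E, ← map_mul, GAlg.e_mul_e_of_not K h, map_zero]

theorem sum_E_vertex : ∑ u : Λ, ∑ v : Λ, E K s t w (Sym.vertex u v) = 1 := by
  simp only [E, ← map_sum, ← GAlg.one_def, map_one]

theorem face_rel (a b c d : Q) (hab : t a = s b) (hcd : t c = s d) :
    ∑ xy ∈ composablePairs s t, left K s t w (w xy.1 xy.2 a b) *
        (E K s t w (Sym.arrow xy.1 c) * E K s t w (Sym.arrow xy.2 d)) =
      ∑ xy ∈ composablePairs s t, right K s t w (.op (w c d xy.1 xy.2)) *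
        (E K s t w (Sym.arrow a xy.1) * E K s t w (Sym.arrow b xy.2)) := by
  have h : mk K s t w _ = mk K s t w _ := RingQuot.mkAlgHom_rel K (FaceRel.face a b c d hab hcd)
  simpa only [map_sum, mk_tmul, map_one, mul_one, one_mul, map_mul, E] using h

/-- The universal property of `𝔄(w)`. -/
def lift {B : Type*} [Ring B] [Algebra K B] (α : R →ₐ[K] B) (β : Rᵐᵒᵖ →ₐ[K] B)
    (γ : GAlg K s t →ₐ[K] B) (h1 : ∀ r r', Commute (α r) (β r'))
    (h2 : ∀ r x, Commute (α r) (γ (GAlg.e K x))) (h3 : ∀ r x, Commute (β r) (γ (GAlg.e K x)))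
    (h4 : ∀ a b c d, t a = s b → t c = s d →
      ∑ xy ∈ composablePairs s t, α (w xy.1 xy.2 a b) *
          (γ (GAlg.e K (Sym.arrow xy.1 c)) * γ (GAlg.e K (Sym.arrow xy.2 d))) =
        ∑ xy ∈ composablePairs s t, β (.op (w c d xy.1 xy.2)) *
          (γ (GAlg.e K (Sym.arrow a xy.1)) * γ (GAlg.e K (Sym.arrow b xy.2)))) :
    FaceAlg K s t w →ₐ[K] B :=
  RingQuot.liftAlgHom K ⟨HAlg.lift K α β γ h1 h2 h3, by
      intro x y h
      induction h with
      | face a b c d hab hcd => simpa [HAlg.lift_tmul] using h4 a b c d hab hcd⟩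

theorem lift_mk {B : Type*} [Ring B] [Algebra K B] {α : R →ₐ[K] B} {β : Rᵐᵒᵖ →ₐ[K] B}
    {γ : GAlg K s t →ₐ[K] B} {h1 : ∀ r r', Commute (α r) (β r')}
    {h2 : ∀ r x, Commute (α r) (γ (GAlg.e K x))} {h3 : ∀ r x, Commute (β r) (γ (GAlg.e K x))}
    {h4 : ∀ a b c d, t a = s b → t c = s d →
      ∑ xy ∈ composablePairs s t, α (w xy.1 xy.2 a b) *
          (γ (GAlg.e K (Sym.arrow xy.1 c)) * γ (GAlg.e K (Sym.arrow xy.2 d))) =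
        ∑ xy ∈ composablePairs s t, β (.op (w c d xy.1 xy.2)) *
          (γ (GAlg.e K (Sym.arrow a xy.1)) * γ (GAlg.e K (Sym.arrow b xy.2)))}
    (r : R) (r' : Rᵐᵒᵖ) (g : GAlg K s t) :
    lift K s t w α β γ h1 h2 h3 h4 (mk K s t w (HAlg.tmul K r r' g)) = α r * β r' * γ g := by
  rw [lift, mk]
  erw [RingQuot.liftAlgHom_mkAlgHom_apply]
  rw [HAlg.lift_tmul]

theorem vertex_mul_vertex (u v u' v' : Λ) :
    E K s t w (Sym.vertex u v) * E K s t w (Sym.vertex u' v') =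
      if u = u' ∧ v = v' then E K s t w (Sym.vertex u v) else 0 := by
  rw [E, E, ← map_mul, GAlg.mul_vertex K u' v' (Sym.vertex u v)]
  change ofG K s t w (if u = u' ∧ v = v' then _ else _) = _
  split_ifs <;> simp

/-- The source map `s(f) = ∑ f(u) ⊗ 1 ⊗ e[u; v]`. -/
def src : (Λ → R) →ₐ[K] FaceAlg K s t w :=
  AlgHom.ofLinearMap
    (∑ u : Λ, ∑ v : Λ, (LinearMap.mulRight K (E K s t w (Sym.vertex u v)) ∘ₗ
      (left K s t w).toLinearMap ∘ₗ LinearMap.proj u))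
    (by simp [sum_E_vertex])
    (by
      intro f g
      have h : ∀ u v u' v', left K s t w (f u) * E K s t w (Sym.vertex u v) *
          (left K s t w (g u') * E K s t w (Sym.vertex u' v')) =
          if u = u' then if v = v' then
            left K s t w (f u * g u) * E K s t w (Sym.vertex u v) else 0 else 0 := by
        intro u v u' v'
        rw [mul_assoc, ← mul_assoc (E K s t w _), ← (left_E K s t w (g u') _).eq,
          mul_assoc, vertex_mul_vertex, ← ite_and]
        split_ifs with hh
        · rw [← hh.1, map_mul, mul_assoc]
        · simp
      simp only [LinearMap.sum_apply, LinearMap.comp_apply, LinearMap.proj_apply,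
        AlgHom.toLinearMap_apply, LinearMap.mulRight_apply, Finset.sum_mul, Finset.mul_sum, h]
      simp [Finset.sum_ite_irrel])

/-- The target map `t(f) = ∑ 1 ⊗ f(u) ⊗ e[v; u]`. -/
def tgt : (Λ → R)ᵐᵒᵖ →ₐ[K] FaceAlg K s t w :=
  AlgHom.ofLinearMap
    (∑ u : Λ, ∑ v : Λ, (LinearMap.mulRight K (E K s t w (Sym.vertex v u)) ∘ₗ
      (right K s t w).toLinearMap ∘ₗ (MulOpposite.opLinearEquiv K).toLinearMap ∘ₗ
      LinearMap.proj u ∘ₗ (MulOpposite.opLinearEquiv K).symm.toLinearMap))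
    (by
      rw [← sum_E_vertex K s t w, Finset.sum_comm]
      simp)
    (by
      intro f g
      have h : ∀ u v u' v', right K s t w (.op (f.unop u)) * E K s t w (Sym.vertex v u) *
          (right K s t w (.op (g.unop u')) * E K s t w (Sym.vertex v' u')) =
          if v = v' then if u = u' then
            right K s t w (.op (g.unop u * f.unop u)) * E K s t w (Sym.vertex v u)
            else 0 else 0 := by
        intro u v u' v'
        rw [mul_assoc, ← mul_assoc (E K s t w _), ← (right_E K s t w _ _).eq,
          mul_assoc, vertex_mul_vertex, ← ite_and]
        split_ifs with hh
        · rw [← hh.2, MulOpposite.op_mul, map_mul, mul_assoc]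
        · simp
      simp only [LinearMap.sum_apply, LinearMap.comp_apply, LinearMap.proj_apply,
        AlgHom.toLinearMap_apply, LinearMap.mulRight_apply, Finset.sum_mul, Finset.mul_sum,
        LinearEquiv.coe_coe, MulOpposite.coe_opLinearEquiv, MulOpposite.coe_opLinearEquiv_symm, h]
      simp)

theorem src_apply (f : Λ → R) : src K s t w f =
    ∑ u : Λ, ∑ v : Λ, left K s t w (f u) * E K s t w (Sym.vertex u v) := by
  simp [src]

theorem tgt_apply (f : Λ → R) : tgt K s t w (.op f) =
    ∑ u : Λ, ∑ v : Λ, right K s t w (.op (f u)) * E K s t w (Sym.vertex v u) := by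
  simp [tgt]

end FaceAlg
end Face

section Face

namespace FaceAlg

variable (K : Type*) {R Λ Q : Type*} [Field K] [Ring R] [Algebra K R] [Fintype Λ]
  [DecidableEq Λ] [Fintype Q] (s t : Q → Λ) (w : Q → Q → Q → Q → R)

theorem E_mul_vertex (x : Sym s t) (u v : Λ) : E K s t w x * E K s t w (Sym.vertex u v) =
    if x.top.tgt = u then if x.bot.tgt = v then E K s t w x else 0 else 0 := by
  rw [E, E, ← map_mul, GAlg.mul_vertex K u v x, ← ite_and]
  split_ifs <;> simp

theorem E_tgt (x : Sym s t) (f : Λ → R) : E K s t w x * tgt K s t w (.op f) =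
    right K s t w (.op (f x.bot.tgt)) * E K s t w x := by
  have h : ∀ u v, E K s t w x * (right K s t w (.op (f u)) * E K s t w (Sym.vertex v u)) =
      if x.top.tgt = v then if x.bot.tgt = u then
        right K s t w (.op (f x.bot.tgt)) * E K s t w x else 0 else 0 := by
    intro u v
    rw [← mul_assoc, ← (right_E K s t w _ x).eq, mul_assoc, E_mul_vertex]
    split_ifs with h1 h2
    · rw [h2]
    · simp
    · simp
  simp only [tgt_apply, Finset.mul_sum, h]
  simp

theorem E_src (x : Sym s t) (f : Λ → R) : E K s t w x * src K s t w f =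
    left K s t w (f x.top.tgt) * E K s t w x := by
  have h : ∀ u v, E K s t w x * (left K s t w (f u) * E K s t w (Sym.vertex u v)) =
      if x.top.tgt = u then if x.bot.tgt = v then
        left K s t w (f x.top.tgt) * E K s t w x else 0 else 0 := by
    intro u v
    rw [← mul_assoc, ← (left_E K s t w _ x).eq, mul_assoc, E_mul_vertex]
    split_ifs with h1 h2
    · rw [h1]
    · simp
    · simp
  simp only [src_apply, Finset.mul_sum, h]
  simp [Finset.sum_ite_irrel]

theorem src_const (r : R) : src K s t w (fun _ => r) = left K s t w r := by
  simp only [src_apply, ← Finset.mul_sum, sum_E_vertex, mul_one]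

theorem tgt_const (r : R) : tgt K s t w (.op fun _ => r) = right K s t w (.op r) := by
  rw [tgt_apply]
  simp only [← Finset.mul_sum]
  rw [Finset.sum_comm, sum_E_vertex, mul_one]

theorem src_single (v : Λ) : src K s t w (Pi.single v 1) = ∑ u, E K s t w (Sym.vertex v u) := by
  rw [src_apply, Finset.sum_eq_single v]
  · simp
  · intro b _ hb
    simp [Pi.single_eq_of_ne hb]
  · simp

theorem tgt_single (v : Λ) :
    tgt K s t w (.op (Pi.single v 1)) = ∑ u, E K s t w (Sym.vertex u v) := by
  rw [tgt_apply, Finset.sum_eq_single v]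
  · simp
  · intro b _ hb
    simp [Pi.single_eq_of_ne hb]
  · simp

/-- The element `∑ e[p; u] ⊗ e[u; q]` of `𝔄(w) ⊗ 𝔄(w)`, the sum being over all paths `u` of the
same length as `p` and `q`. -/
def nabla (x : Sym s t) : FaceAlg K s t w ⊗[K] FaceAlg K s t w :=
  ∑ u : QPath.OfLength s t x.top.length,
    E K s t w ⟨x.top, u.1, u.2.symm⟩ ⊗ₜ[K] E K s t w ⟨u.1, x.bot, u.2.trans x.length_eq⟩

theorem nabla_mem (x : Sym s t) : nabla K s t w x ∈ takeuchi (src K s t w) (tgt K s t w) := by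
  apply mem_takeuchi
  intro f
  rw [nabla, Finset.sum_mul]
  refine Submodule.sum_mem _ fun u _ => ?_
  refine Submodule.subset_span ⟨fun _ => f u.1.tgt, E K s t w ⟨x.top, u.1, u.2.symm⟩ ⊗ₜ[K]
    E K s t w ⟨u.1, x.bot, u.2.trans x.length_eq⟩, ?_⟩
  simp [mul_sub, sub_mul, E_tgt, E_src, src_const, tgt_const]

theorem nabla_mul_of_not (x y : Sym s t) (h : ¬ x.Composable y) :
    nabla K s t w x * nabla K s t w y = 0 := by
  rw [nabla, nabla, Finset.sum_mul]
  refine Finset.sum_eq_zero fun u _ => ?_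
  rw [Finset.mul_sum]
  refine Finset.sum_eq_zero fun v _ => ?_
  rw [Algebra.TensorProduct.tmul_mul_tmul]
  by_cases h1 : x.top.tgt = y.top.src
  · rw [E_mul_E_of_not K s t w
      (x := ⟨u.1, x.bot, u.2.trans x.length_eq⟩) (y := ⟨v.1, y.bot, v.2.trans y.length_eq⟩)
      (fun hh => h ⟨h1, hh.2⟩), tmul_zero]
  · rw [E_mul_E_of_not K s t w (x := ⟨x.top, u.1, u.2.symm⟩) (y := ⟨y.top, v.1, v.2.symm⟩)
      (fun hh => h1 hh.1), zero_tmul]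

theorem nabla_mul (x y : Sym s t) (h : x.Composable y) :
    nabla K s t w x * nabla K s t w y = nabla K s t w (x.comp y h) := by
  have hl : (x.comp y h).top.length = x.top.length + y.top.length := QPath.comp_length x.top y.top h.1
  rw [nabla, nabla, Finset.sum_mul]
  simp only [Finset.mul_sum, Algebra.TensorProduct.tmul_mul_tmul]
  rw [← Fintype.sum_prod_type' (fun (u : QPath.OfLength s t x.top.length)
      (v : QPath.OfLength s t y.top.length) =>
    (E K s t w ⟨x.top, u.1, u.2.symm⟩ * E K s t w ⟨y.top, v.1, v.2.symm⟩) ⊗ₜ[K]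
    (E K s t w ⟨u.1, x.bot, u.2.trans x.length_eq⟩ *
      E K s t w ⟨v.1, y.bot, v.2.trans y.length_eq⟩))]
  symm
  -- split a path of length `m + n` into its first `m` and its last `n` arrows
  have hsplit : ∀ z : QPath.OfLength s t (x.comp y h).top.length,
      IsPathFrom s t z.1.src (z.1.arrows.take x.top.length) ∧
      IsPathFrom s t (endPoint t z.1.src (z.1.arrows.take x.top.length))
        (z.1.arrows.drop x.top.length) := by
    intro z
    apply isPathFrom_append.1
    rw [List.take_append_drop]
    exact z.1.isPath
  have hlen : ∀ z : QPath.OfLength s t (x.comp y h).top.length,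
      z.1.arrows.length = x.top.length + y.top.length := fun z => z.2.trans hl
  refine Fintype.sum_of_injective
    (fun z => (⟨⟨z.1.src, z.1.arrows.take x.top.length, (hsplit z).1⟩,
        by simp [QPath.length, hlen z]⟩,
      ⟨⟨endPoint t z.1.src (z.1.arrows.take x.top.length),
        z.1.arrows.drop x.top.length, (hsplit z).2⟩,
        by simp [QPath.length, hlen z]⟩)) ?_ _ _ ?_ ?_
  · intro z z' hz
    have h1 : z.1.src = z'.1.src := congrArg (fun p => p.1.1.src) hz
    have h2 : z.1.arrows.take x.top.length = z'.1.arrows.take x.top.length :=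
      congrArg (fun p => p.1.1.arrows) hz
    have h3 : z.1.arrows.drop x.top.length = z'.1.arrows.drop x.top.length :=
      congrArg (fun p => p.2.1.arrows) hz
    apply Subtype.ext
    apply QPath.ext h1
    rw [← List.take_append_drop x.top.length z.1.arrows,
      ← List.take_append_drop x.top.length z'.1.arrows, h2, h3]
  · rintro ⟨u, v⟩ huv
    by_cases hc : u.1.tgt = v.1.src
    · refine absurd ⟨⟨u.1.comp v.1 hc, ?_⟩, ?_⟩ huv
      · rw [QPath.comp_length, u.2, v.2, hl]
      · have ht : (u.1.comp v.1 hc).arrows.take x.top.length = u.1.arrows :=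
          List.take_left' u.2
        have hd : (u.1.comp v.1 hc).arrows.drop x.top.length = v.1.arrows :=
          List.drop_left' u.2
        refine Prod.ext (Subtype.ext (QPath.ext rfl ht)) (Subtype.ext (QPath.ext ?_ hd))
        simp only [ht]
        exact hc
    · dsimp only
      rw [E_mul_E_of_not K s t w (x := ⟨x.top, u.1, u.2.symm⟩) (fun hh => hc hh.2), zero_tmul]
  · intro z
    have key : ∀ (p q z : QPath s t) (hp : p.length = x.top.length)
        (hq : q.length = y.top.length) (hz : z.length = (x.comp y h).top.length)
        (hpq : p.tgt = q.src), p.comp q hpq = z →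
        E K s t w ⟨(x.comp y h).top, z, hz.symm⟩ ⊗ₜ[K]
          E K s t w ⟨z, (x.comp y h).bot, hz.trans (x.comp y h).length_eq⟩ =
        (E K s t w ⟨x.top, p, hp.symm⟩ * E K s t w ⟨y.top, q, hq.symm⟩) ⊗ₜ[K]
          (E K s t w ⟨p, x.bot, hp.trans x.length_eq⟩ *
            E K s t w ⟨q, y.bot, hq.trans y.length_eq⟩) := by
      rintro p q _ hp hq hz hpq rfl
      rw [E_mul_E K s t w (x := ⟨x.top, p, hp.symm⟩) (y := ⟨y.top, q, hq.symm⟩) ⟨h.1, hpq⟩,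
        E_mul_E K s t w (x := ⟨p, x.bot, hp.trans x.length_eq⟩)
          (y := ⟨q, y.bot, hq.trans y.length_eq⟩) ⟨hpq, h.2⟩]
      rfl
    refine key _ _ z.1 ?_ ?_ z.2 rfl (QPath.ext rfl (List.take_append_drop _ _))
    · simp [QPath.length, hlen z]
    · simp [QPath.length, hlen z]

theorem sum_nabla_vertex :
    (∑ u : Λ, ∑ v : Λ, nabla K s t w (Sym.vertex u v)) - 1 ∈
      balancedIdeal (src K s t w) (tgt K s t w) := by
  have e0 : ∀ u v : Λ, nabla K s t w (Sym.vertex u v) =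
      ∑ z : Λ, E K s t w (Sym.vertex u z) ⊗ₜ[K] E K s t w (Sym.vertex z v) := by
    intro u v
    rw [nabla]
    symm
    refine Fintype.sum_bijective (fun z : Λ => (⟨QPath.nil z, rfl⟩ :
      QPath.OfLength s t (Sym.vertex (s := s) (t := t) u v).top.length)) ⟨?_, ?_⟩ _ _ ?_
    · intro z z' hz
      exact congrArg (fun q => q.1.src) hz
    · rintro ⟨⟨z, l, hl⟩, h⟩
      refine ⟨z, ?_⟩
      obtain rfl : l = [] := List.length_eq_zero_iff.1 h
      rfl
    · intro z; rfl
  have e1 : (∑ u : Λ, ∑ v : Λ, nabla K s t w (Sym.vertex u v)) =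
      ∑ z : Λ, tgt K s t w (.op (Pi.single z 1)) ⊗ₜ[K] src K s t w (Pi.single z 1) := by
    simp only [e0, src_single, tgt_single, TensorProduct.sum_tmul, TensorProduct.tmul_sum]
    calc _ = ∑ u : Λ, ∑ z : Λ, ∑ v : Λ,
          E K s t w (Sym.vertex u z) ⊗ₜ[K] E K s t w (Sym.vertex z v) :=
          Finset.sum_congr rfl fun u _ => Finset.sum_comm
      _ = _ := Finset.sum_comm.trans (Finset.sum_congr rfl fun z _ => Finset.sum_comm)
  have e2 : (1 : FaceAlg K s t w ⊗[K] FaceAlg K s t w) =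
      ∑ z : Λ, tgt K s t w (.op (Pi.single z 1)) ⊗ₜ[K] 1 := by
    simp only [tgt_single]
    rw [← TensorProduct.sum_tmul, Finset.sum_comm, sum_E_vertex]
    rfl
  rw [e1, e2, ← Finset.sum_sub_distrib]
  refine Submodule.sum_mem _ fun z _ => ?_
  rw [← Submodule.neg_mem_iff]
  refine Submodule.subset_span ⟨Pi.single z 1, tgt K s t w (.op (Pi.single z 1)) ⊗ₜ[K] 1, ?_⟩
  simp [sub_mul, ← map_mul, ← MulOpposite.op_mul, ← Pi.single_mul]

/-- The action of `𝔊(Q)` on `𝔄(w) ⊗_{M_Λ(R)} 𝔄(w)` by left multiplication with `nabla`. -/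
def nablaG : GAlg K s t →ₐ[K] Module.End K (BalancedTensor (src K s t w) (tgt K s t w)) :=
  GAlg.lift K (fun x => takeuchiAct _ _ ⟨_, nabla_mem K s t w x⟩)
    (by
      intro x y h
      rw [← map_mul]
      congr 1
      exact Subtype.ext (nabla_mul K s t w x y h))
    (by
      intro x y h
      rw [← map_mul, ← map_zero (takeuchiAct (src K s t w) (tgt K s t w))]
      congr 1
      exact Subtype.ext (nabla_mul_of_not K s t w x y h))
    (by
      simp only [← map_sum]
      rw [← map_one (takeuchiAct (src K s t w) (tgt K s t w))]
      apply takeuchiAct_congr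
      simpa using sum_nabla_vertex K s t w)

theorem left_mem (r : R) : left K s t w r ⊗ₜ[K] 1 ∈ takeuchi (src K s t w) (tgt K s t w) := by
  apply mem_takeuchi
  intro f
  refine Submodule.subset_span ⟨f, left K s t w r ⊗ₜ[K] 1, ?_⟩
  have : Commute (left K s t w r) (tgt K s t w (.op f)) := by
    rw [tgt_apply]
    exact Commute.sum_right _ _ _ fun u _ => Commute.sum_right _ _ _ fun v _ =>
      (left_right K s t w _ _).mul_right (left_E K s t w _ _)
  simp [mul_sub, sub_mul, this.eq]

theorem right_mem (r : Rᵐᵒᵖ) :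
    1 ⊗ₜ[K] right K s t w r ∈ takeuchi (src K s t w) (tgt K s t w) := by
  apply mem_takeuchi
  intro f
  refine Submodule.subset_span ⟨f, 1 ⊗ₜ[K] right K s t w r, ?_⟩
  have : Commute (right K s t w r) (src K s t w f) := by
    rw [src_apply]
    exact Commute.sum_right _ _ _ fun u _ => Commute.sum_right _ _ _ fun v _ =>
      (left_right K s t w _ _).symm.mul_right (right_E K s t w _ _)
  simp [mul_sub, sub_mul, this.eq]

theorem nabla_arrow (a b : Q) : nabla K s t w (Sym.arrow a b) =
    ∑ u : Q, E K s t w (Sym.arrow a u) ⊗ₜ[K] E K s t w (Sym.arrow u b) := by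
  rw [nabla]
  symm
  refine Fintype.sum_bijective (fun z : Q => (⟨QPath.single z, rfl⟩ :
    QPath.OfLength s t (Sym.arrow (s := s) (t := t) a b).top.length)) ⟨?_, ?_⟩ _ _ ?_
  · intro z z' hz
    have : [z] = [z'] := congrArg (fun q => q.1.arrows) hz
    simpa using this
  · rintro ⟨⟨z, l, hl⟩, h⟩
    obtain ⟨q, rfl⟩ := List.length_eq_one_iff.1 (show l.length = 1 from h)
    obtain ⟨rfl, -⟩ := hl
    exact ⟨q, rfl⟩
  · intro z; rfl

theorem arrow_mul_arrow_top {a b : Q} (h : t a ≠ s b) (c d : Q) :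
    E K s t w (Sym.arrow a c) * E K s t w (Sym.arrow b d) = 0 :=
  E_mul_E_of_not K s t w fun hh => h hh.1

theorem arrow_mul_arrow_bot {c d : Q} (h : t c ≠ s d) (a b : Q) :
    E K s t w (Sym.arrow a c) * E K s t w (Sym.arrow b d) = 0 :=
  E_mul_E_of_not K s t w fun hh => h hh.2

theorem nabla_arrow_mul (a b c d : Q) :
    nabla K s t w (Sym.arrow a c) * nabla K s t w (Sym.arrow b d) =
      ∑ uv ∈ composablePairs s t,
        (E K s t w (Sym.arrow a uv.1) * E K s t w (Sym.arrow b uv.2)) ⊗ₜ[K]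
          (E K s t w (Sym.arrow uv.1 c) * E K s t w (Sym.arrow uv.2 d)) := by
  rw [composablePairs, Finset.sum_filter, nabla_arrow, nabla_arrow, Fintype.sum_prod_type,
    Finset.sum_mul]
  refine Finset.sum_congr rfl fun u _ => ?_
  rw [Finset.mul_sum]
  refine Finset.sum_congr rfl fun v _ => ?_
  split_ifs with h
  · rw [Algebra.TensorProduct.tmul_mul_tmul]
  · rw [Algebra.TensorProduct.tmul_mul_tmul, arrow_mul_arrow_bot K s t w h, zero_tmul]

theorem nabla_face (a b c d : Q) (hab : t a = s b) (hcd : t c = s d) :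
    (∑ xy ∈ composablePairs s t, (left K s t w (w xy.1 xy.2 a b) ⊗ₜ[K] 1) *
        (nabla K s t w (Sym.arrow xy.1 c) * nabla K s t w (Sym.arrow xy.2 d))) -
      (∑ xy ∈ composablePairs s t, (1 ⊗ₜ[K] right K s t w (.op (w c d xy.1 xy.2))) *
        (nabla K s t w (Sym.arrow a xy.1) * nabla K s t w (Sym.arrow b xy.2))) ∈
      balancedIdeal (src K s t w) (tgt K s t w) := by
  have h1 : (∑ xy ∈ composablePairs s t, (left K s t w (w xy.1 xy.2 a b) ⊗ₜ[K] 1) *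
        (nabla K s t w (Sym.arrow xy.1 c) * nabla K s t w (Sym.arrow xy.2 d))) =
      ∑ uv ∈ composablePairs s t, ∑ xy ∈ composablePairs s t,
        (right K s t w (.op (w uv.1 uv.2 xy.1 xy.2)) *
          (E K s t w (Sym.arrow a xy.1) * E K s t w (Sym.arrow b xy.2))) ⊗ₜ[K]
          (E K s t w (Sym.arrow uv.1 c) * E K s t w (Sym.arrow uv.2 d)) := by
    simp only [nabla_arrow_mul, Finset.mul_sum, Algebra.TensorProduct.tmul_mul_tmul, one_mul]
    rw [Finset.sum_comm]
    refine Finset.sum_congr rfl fun uv huv => ?_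
    rw [← TensorProduct.sum_tmul, ← TensorProduct.sum_tmul]
    rw [face_rel K s t w a b uv.1 uv.2 hab (Finset.mem_filter.1 huv).2]
  have h2 : (∑ xy ∈ composablePairs s t, (1 ⊗ₜ[K] right K s t w (.op (w c d xy.1 xy.2))) *
        (nabla K s t w (Sym.arrow a xy.1) * nabla K s t w (Sym.arrow b xy.2))) =
      ∑ uv ∈ composablePairs s t, ∑ xy ∈ composablePairs s t,
        (E K s t w (Sym.arrow a xy.1) * E K s t w (Sym.arrow b xy.2)) ⊗ₜ[K]
          (left K s t w (w uv.1 uv.2 xy.1 xy.2) *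
            (E K s t w (Sym.arrow uv.1 c) * E K s t w (Sym.arrow uv.2 d))) := by
    simp only [nabla_arrow_mul, Finset.mul_sum, Algebra.TensorProduct.tmul_mul_tmul, one_mul]
    rw [Finset.sum_comm]
    rw [Finset.sum_comm (s := composablePairs s t) (t := composablePairs s t) (f := fun uv xy =>
        (E K s t w (Sym.arrow a xy.1) * E K s t w (Sym.arrow b xy.2)) ⊗ₜ[K]
          (left K s t w (w uv.1 uv.2 xy.1 xy.2) *
            (E K s t w (Sym.arrow uv.1 c) * E K s t w (Sym.arrow uv.2 d))))]
    refine Finset.sum_congr rfl fun xy hxy => ?_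
    rw [← TensorProduct.tmul_sum, ← TensorProduct.tmul_sum]
    rw [face_rel K s t w xy.1 xy.2 c d (Finset.mem_filter.1 hxy).2 hcd]
  rw [h1, h2, ← Finset.sum_sub_distrib]
  refine Submodule.sum_mem _ fun uv _ => ?_
  rw [← Finset.sum_sub_distrib]
  refine Submodule.sum_mem _ fun xy _ => ?_
  refine Submodule.subset_span ⟨fun _ => w uv.1 uv.2 xy.1 xy.2,
    (E K s t w (Sym.arrow a xy.1) * E K s t w (Sym.arrow b xy.2)) ⊗ₜ[K]
      (E K s t w (Sym.arrow uv.1 c) * E K s t w (Sym.arrow uv.2 d)), ?_⟩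
  simp [sub_mul, src_const, tgt_const]

/-- The map `r ↦ (r ⊗ 1 ⊗ 1) ⊗ 1`. -/
def leftT : R →ₐ[K] takeuchi (src K s t w) (tgt K s t w) :=
  AlgHom.codRestrict (Algebra.TensorProduct.includeLeft.comp (left K s t w)) _ (left_mem K s t w)

/-- The map `r ↦ 1 ⊗ (1 ⊗ r ⊗ 1)`. -/
def rightT : Rᵐᵒᵖ →ₐ[K] takeuchi (src K s t w) (tgt K s t w) :=
  AlgHom.codRestrict (Algebra.TensorProduct.includeRight.comp (right K s t w)) _
    (right_mem K s t w)

theorem coe_leftT (r : R) : (leftT K s t w r).1 = left K s t w r ⊗ₜ[K] 1 := rfl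

theorem coe_rightT (r : Rᵐᵒᵖ) : (rightT K s t w r).1 = 1 ⊗ₜ[K] right K s t w r := rfl

/-- The action of `𝔄(w)` on `𝔄(w) ⊗_{M_Λ(R)} 𝔄(w)` by left multiplication with the coproduct. -/
def deltaAct : FaceAlg K s t w →ₐ[K] Module.End K (BalancedTensor (src K s t w) (tgt K s t w)) :=
  lift K s t w
    ((takeuchiAct (src K s t w) (tgt K s t w)).comp (leftT K s t w))
    ((takeuchiAct (src K s t w) (tgt K s t w)).comp (rightT K s t w))
    (nablaG K s t w)
    (by
      intro r r'
      refine Commute.map (f := takeuchiAct (src K s t w) (tgt K s t w)) (Subtype.ext ?_)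
      simp [coe_leftT, coe_rightT])
    (by
      intro r x
      rw [nablaG, GAlg.lift_e]
      refine Commute.map (f := takeuchiAct (src K s t w) (tgt K s t w)) (Subtype.ext ?_)
      simp [coe_leftT, nabla, Finset.mul_sum, Finset.sum_mul, (left_E K s t w r _).eq])
    (by
      intro r x
      rw [nablaG, GAlg.lift_e]
      refine Commute.map (f := takeuchiAct (src K s t w) (tgt K s t w)) (Subtype.ext ?_)
      simp [coe_rightT, nabla, Finset.mul_sum, Finset.sum_mul, (right_E K s t w r _).eq])
    (by
      intro a b c d hab hcd
      simp only [nablaG, GAlg.lift_e, AlgHom.comp_apply, ← map_mul, ← map_sum]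
      apply takeuchiAct_congr
      simpa [coe_leftT, coe_rightT] using nabla_face K s t w a b c d hab hcd)

/-- The coproduct `Δ_{M_Λ(R)}` of `𝔄(w)`. -/
def comulBase : FaceAlg K s t w →ₗ[K] BalancedTensor (src K s t w) (tgt K s t w) :=
  LinearMap.applyₗ (Submodule.Quotient.mk 1) ∘ₗ (deltaAct K s t w).toLinearMap

/-- The coproduct is given by
`r ⊗ r' ⊗ e[p; q] ↦ ∑ (r ⊗ 1 ⊗ e[p; u]) ⊗ (1 ⊗ r' ⊗ e[u; q])`. -/
theorem comulBase_mk (r : R) (r' : Rᵐᵒᵖ) (x : Sym s t) :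
    comulBase K s t w (mk K s t w (HAlg.tmul K r r' (GAlg.e K x))) =
      Submodule.Quotient.mk (∑ u : QPath.OfLength s t x.top.length,
        (left K s t w r * E K s t w ⟨x.top, u.1, u.2.symm⟩) ⊗ₜ[K]
          (right K s t w r' * E K s t w ⟨u.1, x.bot, u.2.trans x.length_eq⟩)) := by
  have h : deltaAct K s t w (mk K s t w (HAlg.tmul K r r' (GAlg.e K x))) =
      takeuchiAct _ _ (leftT K s t w r) * takeuchiAct _ _ (rightT K s t w r') *
        nablaG K s t w (GAlg.e K x) := lift_mk K s t w r r' _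
  rw [nablaG, GAlg.lift_e, ← map_mul, ← map_mul] at h
  change deltaAct K s t w (mk K s t w (HAlg.tmul K r r' (GAlg.e K x)))
    (Submodule.Quotient.mk 1) = _
  rw [h, takeuchiAct_mk]
  simp [coe_leftT, coe_rightT, nabla, Finset.mul_sum]

end FaceAlg
end Face

section Face

namespace FaceAlg

variable (K : Type*) {R Λ Q : Type*} [Field K] [Ring R] [Algebra K R] [Fintype Λ]
  [DecidableEq Λ] [Fintype Q] {s t : Q → Λ} {w : Q → Q → Q → Q → R}

open Classical in
/-- The endomorphism `f ↦ δ_{p,q} f(t(q)) δ_{s(q)}` of `M_Λ(R)` attached to `e[p; q]`. -/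
def zetaE (R : Type*) [Ring R] [Algebra K R] (x : Sym s t) : Module.End K (Λ → R) :=
  if x.top = x.bot then
    LinearMap.single K (fun _ : Λ => R) x.bot.src ∘ₗ LinearMap.proj x.bot.tgt
  else 0

theorem zetaE_of_eq {x : Sym s t} (h : x.top = x.bot) (f : Λ → R) :
    zetaE K R x f = Pi.single x.bot.src (f x.bot.tgt) := by
  rw [zetaE, if_pos h]; rfl

theorem zetaE_of_ne {x : Sym s t} (h : x.top ≠ x.bot) : zetaE K R x = 0 := by
  rw [zetaE, if_neg h]

theorem comp_top_eq_iff {x y : Sym s t} (h : x.Composable y) :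
    (x.comp y h).top = (x.comp y h).bot ↔ x.top = x.bot ∧ y.top = y.bot := by
  constructor
  · intro hh
    have h1 : (x.comp y h).top.src = (x.comp y h).bot.src := by rw [hh]
    have h2 : x.top.arrows ++ y.top.arrows = x.bot.arrows ++ y.bot.arrows :=
      congrArg QPath.arrows hh
    obtain ⟨h3, h4⟩ := List.append_inj h2 x.length_eq
    have h5 : x.top = x.bot := QPath.ext h1 h3
    refine ⟨h5, QPath.ext ?_ h4⟩
    rw [← h.1, ← h.2, h5]
  · rintro ⟨h1, h2⟩
    refine QPath.ext (show x.top.src = x.bot.src by rw [h1]) ?_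
    change x.top.arrows ++ y.top.arrows = x.bot.arrows ++ y.bot.arrows
    rw [h1, h2]

theorem zetaE_mul (x y : Sym s t) (h : x.Composable y) :
    zetaE K R x * zetaE K R y = zetaE K R (x.comp y h) := by
  by_cases h1 : x.top = x.bot
  · by_cases h2 : y.top = y.bot
    · apply LinearMap.ext
      intro f
      rw [Module.End.mul_apply, zetaE_of_eq K h1, zetaE_of_eq K h2,
        zetaE_of_eq K ((comp_top_eq_iff h).2 ⟨h1, h2⟩), h.2, Pi.single_eq_same]
      have h3 : (x.comp y h).bot.tgt = y.bot.tgt := QPath.comp_tgt x.bot y.bot h.2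
      rw [h3]
      rfl
    · rw [zetaE_of_ne K h2, zetaE_of_ne K (fun hh => h2 ((comp_top_eq_iff h).1 hh).2), mul_zero]
  · rw [zetaE_of_ne K h1, zetaE_of_ne K (fun hh => h1 ((comp_top_eq_iff h).1 hh).1), zero_mul]

theorem zetaE_mul_of_not (x y : Sym s t) (h : ¬ x.Composable y) :
    zetaE K R x * zetaE K R y = 0 := by
  by_cases h1 : x.top = x.bot
  · by_cases h2 : y.top = y.bot
    · apply LinearMap.ext
      intro f
      have h3 : x.bot.tgt ≠ y.bot.src := fun hh => h ⟨by rw [h1, h2]; exact hh, hh⟩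
      rw [Module.End.mul_apply, zetaE_of_eq K h1, zetaE_of_eq K h2, Pi.single_eq_of_ne h3]
      simp
    · rw [zetaE_of_ne K h2, mul_zero]
  · rw [zetaE_of_ne K h1, zero_mul]

theorem sum_zetaE : ∑ u : Λ, ∑ v : Λ, zetaE K R (Sym.vertex (s := s) (t := t) u v) = 1 := by
  have h : ∀ u v : Λ, zetaE K R (Sym.vertex (s := s) (t := t) u v) =
      if u = v then LinearMap.single K (fun _ : Λ => R) v ∘ₗ LinearMap.proj v else 0 := by
    intro u v
    split_ifs with huv
    · subst huv
      apply LinearMap.ext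
      intro f
      rw [zetaE_of_eq K rfl]
      rfl
    · exact zetaE_of_ne K (fun hh => huv (congrArg QPath.src hh))
  simp only [h, Finset.sum_ite_eq, Finset.mem_univ, if_true]
  apply LinearMap.ext
  intro f
  simpa [LinearMap.sum_apply] using Finset.univ_sum_single f

theorem arrow_top_eq_iff (a b : Q) :
    (Sym.arrow (s := s) (t := t) a b).top = (Sym.arrow (s := s) (t := t) a b).bot ↔ a = b := by
  constructor
  · intro h
    have : [a] = [b] := congrArg QPath.arrows h
    simpa using this
  · rintro rfl; rfl

theorem zetaE_arrow_mul (a b c d : Q) (hcd : t c = s d) (f : Λ → R) [Decidable (a = c ∧ b = d)] :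
    zetaE K R (Sym.arrow (s := s) (t := t) a c)
      (zetaE K R (Sym.arrow (s := s) (t := t) b d) f) =
      if a = c ∧ b = d then Pi.single (s c) (f (t d)) else 0 := by
  split_ifs with h
  · obtain ⟨rfl, rfl⟩ := h
    rw [zetaE_of_eq K rfl, zetaE_of_eq K rfl]
    change (Pi.single (s a) ((Pi.single (s b) (f (t b)) : Λ → R) (t a)) : Λ → R) = _
    rw [hcd, Pi.single_eq_same]
  · by_cases h1 : a = c
    · rw [zetaE_of_ne K (x := Sym.arrow b d)
        (fun hh => h ⟨h1, (arrow_top_eq_iff b d).1 hh⟩), LinearMap.zero_apply, map_zero]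
    · rw [zetaE_of_ne K (x := Sym.arrow a c)
        (fun hh => h1 ((arrow_top_eq_iff a c).1 hh)), LinearMap.zero_apply]

/-- The homomorphism `ζ : 𝔄(w) → End(M_Λ(R))`,
`ζ(r ⊗ r' ⊗ e[p; q])(f) = δ_{p,q} r f(t(q)) r' δ_{s(q)}`. -/
def zeta (hw : IsFaceWeight s t w) : FaceAlg K s t w →ₐ[K] Module.End K (Λ → R) :=
  lift K s t w
    (Algebra.lsmul K K (Λ → R) : R →ₐ[K] Module.End K (Λ → R))
    (Algebra.lsmul K K (Λ → R) : Rᵐᵒᵖ →ₐ[K] Module.End K (Λ → R))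
    (GAlg.lift K (zetaE K R) (zetaE_mul K) (zetaE_mul_of_not K) (sum_zetaE K))
    (by
      intro r r'
      apply LinearMap.ext
      intro f
      ext v
      simp [mul_assoc])
    (by
      intro r x
      rw [GAlg.lift_e]
      apply LinearMap.ext
      intro f
      by_cases h : x.top = x.bot
      · ext v
        by_cases hv : v = x.bot.src
        · subst hv
          simp [Module.End.mul_apply, zetaE_of_eq K h]
        · simp [Module.End.mul_apply, zetaE_of_eq K h, Pi.single_eq_of_ne hv]
      · simp [zetaE_of_ne K h])
    (by
      intro r x
      rw [GAlg.lift_e]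
      apply LinearMap.ext
      intro f
      by_cases h : x.top = x.bot
      · ext v
        by_cases hv : v = x.bot.src
        · subst hv
          simp [Module.End.mul_apply, zetaE_of_eq K h]
        · simp [Module.End.mul_apply, zetaE_of_eq K h, Pi.single_eq_of_ne hv]
      · simp [zetaE_of_ne K h])
    (by
      classical
      intro a b c d hab hcd
      simp only [GAlg.lift_e]
      apply LinearMap.ext
      intro f
      rw [LinearMap.sum_apply, LinearMap.sum_apply]
      rw [Finset.sum_eq_single_of_mem (c, d) (by simp [composablePairs, hcd]),
        Finset.sum_eq_single_of_mem (a, b) (by simp [composablePairs, hab])]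
      · simp only [Module.End.mul_apply]
        rw [zetaE_arrow_mul K _ _ _ _ hcd,
          zetaE_arrow_mul K _ _ _ _ hab, if_pos ⟨rfl, rfl⟩, if_pos ⟨rfl, rfl⟩]
        have hc := Subring.mem_center_iff.1 (hw.central c d a b hcd hab)
        by_cases hf : s c = s a ∧ t d = t b
        · ext v
          simp [hf.1, hf.2, Pi.single_apply, hc]
        · rw [hw.face c d a b hcd hab (by tauto)]
          simp
      · intro xy hxy hne
        rw [Module.End.mul_apply, Module.End.mul_apply, zetaE_arrow_mul K _ _ _ _ (Finset.mem_filter.1 hxy).2, if_neg,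
          map_zero]
        rintro ⟨rfl, rfl⟩
        exact hne rfl
      · intro xy hxy hne
        rw [Module.End.mul_apply, Module.End.mul_apply, zetaE_arrow_mul K _ _ _ _ hcd, if_neg, map_zero]
        rintro ⟨rfl, rfl⟩
        exact hne rfl)

/-- The counit `π_{M_Λ(R)}(a) = ζ(a)(1)` of `𝔄(w)`. -/
def counitBase (hw : IsFaceWeight s t w) : FaceAlg K s t w →ₗ[K] (Λ → R) :=
  LinearMap.applyₗ (1 : Λ → R) ∘ₗ (zeta K hw).toLinearMap

/-- `ζ(r ⊗ r' ⊗ e[p; q])(f) = δ_{p,q} r f(t(q)) r' δ_{s(q)}`. -/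
theorem zeta_mk (hw : IsFaceWeight s t w) (r r' : R) (x : Sym s t) (f : Λ → R)
    [Decidable (x.top = x.bot)] :
    zeta K hw (mk K s t w (HAlg.tmul K r (.op r') (GAlg.e K x))) f =
      if x.top = x.bot then Pi.single x.bot.src (r * f x.bot.tgt * r') else 0 := by
  have h : zeta K hw (mk K s t w (HAlg.tmul K r (.op r') (GAlg.e K x))) =
      (Algebra.lsmul K K (Λ → R) : R →ₐ[K] Module.End K (Λ → R)) r *
        (Algebra.lsmul K K (Λ → R) : Rᵐᵒᵖ →ₐ[K] Module.End K (Λ → R)) (.op r') *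
        GAlg.lift K (zetaE K R) (zetaE_mul K) (zetaE_mul_of_not K) (sum_zetaE K) (GAlg.e K x) :=
    lift_mk K s t w r (.op r') _
  rw [h, GAlg.lift_e]
  split_ifs with hx
  · ext v
    by_cases hv : v = x.bot.src
    · subst hv
      simp [Module.End.mul_apply, zetaE_of_eq K hx, mul_assoc]
    · simp [Module.End.mul_apply, zetaE_of_eq K hx, Pi.single_eq_of_ne hv]
  · simp [zetaE_of_ne K hx]

end FaceAlg
end Face

/-! ### The weights `w_σ`, the homomorphism `Φ` and rigidity -/

section Phi

/-- The source map `(v, x) ↦ v` of the quiver `Q = Λ × X`. -/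
abbrev qs (Λ X : Type*) : Λ × X → Λ := Prod.fst

/-- The target map `(v, x) ↦ v deg(x)` of the quiver `Q = Λ × X`. -/
abbrev qt {Λ X : Type*} (deg : X → Equiv.Perm Λ) : Λ × X → Λ := fun q => deg q.2 q.1

/-- The weight `w_σ`: with top `(v, a)`, right `(v', b)`, left `(u, c)`, bottom `(u', d)` it is
`δ_{v,u} σ^{ba}_{dc}(v)`. -/
def wSigma {R Λ X : Type*} [Ring R] [DecidableEq Λ] (σ : X → X → X → X → Λ → R)
    (a b c d : Λ × X) : R :=
  if a.1 = c.1 then σ b.2 a.2 d.2 c.2 a.1 else 0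

variable (K : Type*) {R Λ X : Type*} [Field K] [Ring R] [Algebra K R] [Fintype Λ]
  [DecidableEq Λ] [Fintype X] [DecidableEq X] {deg : X → Equiv.Perm Λ}
  {σ : X → X → X → X → Λ → R}

theorem isFaceWeight_wSigma {R Λ X : Type*} [Ring R] [DecidableEq Λ] {deg : X → Equiv.Perm Λ}
    {σ : X → X → X → X → Λ → R} (hσ : IsFRTFamily deg σ) :
    IsFaceWeight (qs Λ X) (qt deg) (wSigma σ) where
  central a b c d _ _ := by
    rw [wSigma]
    split_ifs
    · exact hσ.central _ _ _ _ _
    · exact zero_mem _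
  face a b c d hab hcd h := by
    rw [wSigma]
    split_ifs with hac
    · apply hσ.invariant
      rcases h with h | h
      · exact absurd hac h
      · have h1 : deg a.2 a.1 = b.1 := hab
        have h2 : deg c.2 c.1 = d.1 := hcd
        rw [h1, hac, h2]
        exact h
    · rfl

variable (deg σ)

/-- The algebra `𝔄(w_σ)`. -/
abbrev FaceSigma : Type _ := FaceAlg K (qs Λ X) (qt deg) (wSigma σ)

/-- The family `σ` is rigid. -/
def IsRigid {Λ : Type*} (deg : X → Equiv.Perm Λ) (σ : X → X → X → X → Λ → R) : Prop :=
  ∃ x y : X → X → FRTAlg K deg σ, ∀ a b : X,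
    (∑ c, FRTAlg.Linv K deg σ c b * x a c = if a = b then 1 else 0) ∧
    (∑ c, x c b * FRTAlg.Linv K deg σ a c = if a = b then 1 else 0) ∧
    (∑ c, FRTAlg.L K deg σ c b * y a c = if a = b then 1 else 0) ∧
    (∑ c, y c b * FRTAlg.L K deg σ a c = if a = b then 1 else 0)

namespace Phi

/-- The product `L_{x₁y₁} ⋯ L_{xₘyₘ}`. -/
def word (l l' : List (Λ × X)) : FRTAlg K deg σ :=
  (List.zipWith (fun x y => FRTAlg.L K deg σ x.2 y.2) l l').prod

theorem word_cons (a b : Λ × X) (l l' : List (Λ × X)) :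
    word K deg σ (a :: l) (b :: l') = FRTAlg.L K deg σ a.2 b.2 * word K deg σ l l' := by
  simp [word]

theorem word_append {l l' : List (Λ × X)} (h : l.length = l'.length) (m m' : List (Λ × X)) :
    word K deg σ (l ++ m) (l' ++ m') = word K deg σ l l' * word K deg σ m m' := by
  rw [word, List.zipWith_append h, List.prod_append, word, word]

theorem single_comp (x : X) (v : Λ) :
    (Pi.single (deg x v) 1 : Λ → R) ∘ deg x = Pi.single v 1 := by
  ext u
  simp [Pi.single_apply]

theorem word_src {v : Λ} {l l' : List (Λ × X)} (hl : IsPathFrom (qs Λ X) (qt deg) v l)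
    (h : l.length = l'.length) :
    word K deg σ l l' * FRTAlg.src K deg σ (Pi.single (endPoint (qt deg) v l) 1) =
      FRTAlg.src K deg σ (Pi.single v 1) * word K deg σ l l' := by
  induction l generalizing v l' with
  | nil => simp [word, endPoint]
  | cons a l ih =>
    cases l' with
    | nil => simp at h
    | cons b l' =>
      obtain ⟨rfl, hl⟩ := hl
      rw [word_cons, endPoint, mul_assoc, ih hl (by simpa using h), ← mul_assoc, FRTAlg.L_src,
        single_comp, mul_assoc]

theorem word_tgt {v : Λ} {l l' : List (Λ × X)} (hl : IsPathFrom (qs Λ X) (qt deg) v l')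
    (h : l.length = l'.length) :
    word K deg σ l l' * FRTAlg.tgt K deg σ (.op (Pi.single (endPoint (qt deg) v l') 1)) =
      FRTAlg.tgt K deg σ (.op (Pi.single v 1)) * word K deg σ l l' := by
  induction l' generalizing v l with
  | nil => simp [word, endPoint]
  | cons a l' ih =>
    cases l with
    | nil => simp at h
    | cons b l =>
      obtain ⟨rfl, hl⟩ := hl
      rw [word_cons, endPoint, mul_assoc, ih hl (by simpa using h), ← mul_assoc, FRTAlg.L_tgt,
        single_comp, mul_assoc]

theorem src_const_word (r : R) (l l' : List (Λ × X)) :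
    Commute (FRTAlg.src K deg σ (fun _ => r)) (word K deg σ l l') := by
  refine Commute.list_prod_right _ _ fun z hz => ?_
  obtain ⟨i, hi, rfl⟩ := List.mem_iff_getElem.1 hz
  rw [List.getElem_zipWith]
  exact (FRTAlg.L_src K deg σ (fun _ => r) _ _).symm

theorem tgt_const_word (r : R) (l l' : List (Λ × X)) :
    Commute (FRTAlg.tgt K deg σ (.op fun _ => r)) (word K deg σ l l') := by
  refine Commute.list_prod_right _ _ fun z hz => ?_
  obtain ⟨i, hi, rfl⟩ := List.mem_iff_getElem.1 hz
  rw [List.getElem_zipWith]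
  exact (FRTAlg.L_tgt K deg σ (fun _ => r) _ _).symm

/-- The element `(δ_{s(p)} ⊗ δ_{s(q)}) L_{x₁y₁} ⋯ L_{xₘyₘ}`. -/
def onSym (x : Sym (qs Λ X) (qt deg)) : FRTAlg K deg σ :=
  FRTAlg.src K deg σ (Pi.single x.top.src 1) * FRTAlg.tgt K deg σ (.op (Pi.single x.bot.src 1)) *
    word K deg σ x.top.arrows x.bot.arrows

theorem const_mul_single (r : R) (v : Λ) :
    (fun _ => r) * (Pi.single v 1 : Λ → R) = Pi.single v r := by
  ext u
  by_cases h : u = v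
  · subst h; simp
  · simp [Pi.single_eq_of_ne h]

theorem single_mul_const (r : R) (v : Λ) :
    (Pi.single v 1 : Λ → R) * (fun _ => r) = Pi.single v r := by
  ext u
  by_cases h : u = v
  · subst h; simp
  · simp [Pi.single_eq_of_ne h]

theorem single_mul (f : Λ → R) (v : Λ) :
    (Pi.single v 1 : Λ → R) * f = Pi.single v (f v) := by
  ext u
  by_cases h : u = v
  · subst h; simp
  · simp [Pi.single_eq_of_ne h]

theorem mul_single (f : Λ → R) (v : Λ) :
    f * (Pi.single v 1 : Λ → R) = Pi.single v (f v) := by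
  ext u
  by_cases h : u = v
  · subst h; simp
  · simp [Pi.single_eq_of_ne h]

theorem src_single_mul (u v : Λ) :
    FRTAlg.src K deg σ (Pi.single u 1) * FRTAlg.src K deg σ (Pi.single v 1) =
      if u = v then FRTAlg.src K deg σ (Pi.single u 1) else 0 := by
  rw [← map_mul]
  split_ifs with h
  · rw [h, ← Pi.single_mul, one_mul]
  · rw [single_mul, Pi.single_eq_of_ne h, Pi.single_zero, map_zero]

theorem tgt_single_mul (u v : Λ) :
    FRTAlg.tgt K deg σ (.op (Pi.single u 1)) * FRTAlg.tgt K deg σ (.op (Pi.single v 1)) =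
      if u = v then FRTAlg.tgt K deg σ (.op (Pi.single u 1)) else 0 := by
  rw [← map_mul, ← MulOpposite.op_mul]
  split_ifs with h
  · rw [h, ← Pi.single_mul, one_mul]
  · rw [single_mul, Pi.single_eq_of_ne (Ne.symm h), Pi.single_zero, MulOpposite.op_zero, map_zero]

theorem onSym_mul_onSym (x y : Sym (qs Λ X) (qt deg)) :
    onSym K deg σ x * onSym K deg σ y =
      word K deg σ x.top.arrows x.bot.arrows *
        (FRTAlg.src K deg σ (Pi.single x.top.tgt 1) * FRTAlg.src K deg σ (Pi.single y.top.src 1)) *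
        (FRTAlg.tgt K deg σ (.op (Pi.single x.bot.tgt 1)) *
          FRTAlg.tgt K deg σ (.op (Pi.single y.bot.src 1))) *
        word K deg σ y.top.arrows y.bot.arrows := by
  have h1 := word_src K deg σ x.top.isPath x.length_eq
  have h2 := word_tgt K deg σ x.bot.isPath x.length_eq
  have h3 : onSym K deg σ x = word K deg σ x.top.arrows x.bot.arrows *
      FRTAlg.src K deg σ (Pi.single x.top.tgt 1) *
      FRTAlg.tgt K deg σ (.op (Pi.single x.bot.tgt 1)) := by
    rw [QPath.tgt, QPath.tgt, h1, mul_assoc, h2, onSym, mul_assoc]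
  rw [h3, onSym]
  simp only [mul_assoc]
  rw [← mul_assoc (FRTAlg.tgt K deg σ (.op (Pi.single x.bot.tgt 1)))
      (FRTAlg.src K deg σ (Pi.single y.top.src 1)), ← (FRTAlg.src_tgt_comm K deg σ _ _).eq]
  simp only [mul_assoc]

theorem onSym_mul (x y : Sym (qs Λ X) (qt deg)) (h : x.Composable y) :
    onSym K deg σ x * onSym K deg σ y = onSym K deg σ (x.comp y h) := by
  have h1 := word_src K deg σ x.top.isPath x.length_eq
  have h2 := word_tgt K deg σ x.bot.isPath x.length_eq
  rw [onSym_mul_onSym, h.1, h.2, src_single_mul, tgt_single_mul, if_pos rfl, if_pos rfl,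
    ← h.1, ← h.2, QPath.tgt, QPath.tgt, h1, mul_assoc _ (word K deg σ _ _), h2, onSym]
  change _ = _ * word K deg σ (x.top.arrows ++ y.top.arrows) (x.bot.arrows ++ y.bot.arrows)
  rw [word_append K deg σ x.length_eq]
  simp only [mul_assoc]
  rfl

theorem onSym_mul_of_not (x y : Sym (qs Λ X) (qt deg)) (h : ¬ x.Composable y) :
    onSym K deg σ x * onSym K deg σ y = 0 := by
  rw [onSym_mul_onSym, src_single_mul, tgt_single_mul]
  by_cases h1 : x.top.tgt = y.top.src
  · rw [if_neg (fun h2 => h ⟨h1, h2⟩)]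
    simp
  · rw [if_neg h1]
    simp

theorem sum_src_single : ∑ u : Λ, FRTAlg.src K deg σ (Pi.single u 1) = 1 := by
  rw [← map_sum]
  exact (congrArg _ (Finset.univ_sum_single (1 : Λ → R))).trans (map_one _)

theorem sum_tgt_single : ∑ u : Λ, FRTAlg.tgt K deg σ (.op (Pi.single u 1)) = 1 := by
  have h : ∀ u : Λ, FRTAlg.tgt K deg σ (.op (Pi.single u 1)) =
      ((FRTAlg.tgt K deg σ).toLinearMap ∘ₗ (MulOpposite.opLinearEquiv K).toLinearMap)
        (Pi.single u 1) := fun _ => rfl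
  simp only [h]
  rw [← map_sum]
  exact (congrArg _ (Finset.univ_sum_single (1 : Λ → R))).trans (map_one (FRTAlg.tgt K deg σ))

/-- The map `e[p; q] ↦ (δ_{s(p)} ⊗ δ_{s(q)}) L_{x₁y₁} ⋯ L_{xₘyₘ}` on `𝔊(Q)`. -/
def onG : GAlg K (qs Λ X) (qt deg) →ₐ[K] FRTAlg K deg σ :=
  GAlg.lift K (onSym K deg σ) (onSym_mul K deg σ) (onSym_mul_of_not K deg σ)
    (by
      have : ∀ u v : Λ, onSym K deg σ (Sym.vertex u v) =
          FRTAlg.src K deg σ (Pi.single u 1) * FRTAlg.tgt K deg σ (.op (Pi.single v 1)) :=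
        fun u v => mul_one _
      simp only [this, ← Finset.mul_sum, sum_tgt_single, mul_one, sum_src_single])

/-- The map `r ↦ r_M ⊗ 1`. -/
def leftR : R →ₐ[K] FRTAlg K deg σ := (FRTAlg.src K deg σ).comp (Pi.constAlgHom K Λ R)

/-- The map `r ↦ 1 ⊗ r_M`. -/
def rightR : Rᵐᵒᵖ →ₐ[K] FRTAlg K deg σ :=
  (FRTAlg.tgt K deg σ).comp (AlgHom.op (Pi.constAlgHom K Λ R))

theorem leftR_apply (r : R) : leftR K deg σ r = FRTAlg.src K deg σ (fun _ => r) := rfl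

theorem rightR_apply (r : R) : rightR K deg σ (.op r) = FRTAlg.tgt K deg σ (.op fun _ => r) := rfl

theorem sum_composablePairs {M : Type*} [AddCommMonoid M] (g : (Λ × X) × (Λ × X) → M) :
    ∑ xy ∈ composablePairs (qs Λ X) (qt deg), g xy =
      ∑ v : Λ, ∑ x : X, ∑ y : X, g ((v, x), (deg x v, y)) := by
  rw [composablePairs, Finset.sum_filter]
  simp only [Fintype.sum_prod_type]
  refine Finset.sum_congr rfl fun v _ => Finset.sum_congr rfl fun x _ => ?_
  rw [Finset.sum_eq_single (deg x v)]
  · simp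
  · intro u _ hu
    exact Finset.sum_eq_zero fun y _ => if_neg (Ne.symm hu)
  · simp

theorem onSym_arrow_mul (a b c d : Λ × X) (hab : qt deg a = b.1) (hcd : qt deg c = d.1) :
    onSym K deg σ (Sym.arrow a c) * onSym K deg σ (Sym.arrow b d) =
      FRTAlg.src K deg σ (Pi.single a.1 1) * FRTAlg.tgt K deg σ (.op (Pi.single c.1 1)) *
        (FRTAlg.L K deg σ a.2 c.2 * FRTAlg.L K deg σ b.2 d.2) := by
  rw [onSym_mul K deg σ _ _ (show (Sym.arrow a c).Composable (Sym.arrow b d) from ⟨hab, hcd⟩)]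
  change _ * word K deg σ [a, b] [c, d] = _
  rw [word_cons, word_cons]
  simp [word]
  rfl

theorem leftR_sum (a b c d : Λ × X) (hcd : qt deg c = d.1) :
    ∑ xy ∈ composablePairs (qs Λ X) (qt deg), leftR K deg σ (wSigma σ xy.1 xy.2 a b) *
        (onSym K deg σ (Sym.arrow xy.1 c) * onSym K deg σ (Sym.arrow xy.2 d)) =
      FRTAlg.src K deg σ (Pi.single a.1 1) * FRTAlg.tgt K deg σ (.op (Pi.single c.1 1)) *
        ∑ y, ∑ x, FRTAlg.src K deg σ (σ y x b.2 a.2) * FRTAlg.L K deg σ x c.2 *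
          FRTAlg.L K deg σ y d.2 := by
  rw [sum_composablePairs]
  rw [Finset.sum_eq_single a.1]
  · rw [Finset.sum_comm, Finset.mul_sum]
    refine Finset.sum_congr rfl fun y _ => ?_
    rw [Finset.mul_sum]
    refine Finset.sum_congr rfl fun x _ => ?_
    rw [onSym_arrow_mul K deg σ _ _ _ _ rfl hcd, leftR_apply, wSigma, if_pos rfl]
    simp only [← mul_assoc]
    rw [← map_mul, const_mul_single,
      mul_assoc (FRTAlg.src K deg σ (Pi.single a.1 1)) (FRTAlg.tgt K deg σ _),
      ← (FRTAlg.src_tgt_comm K deg σ _ _).eq, ← mul_assoc, ← map_mul, single_mul]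
  · intro v _ hv
    refine Finset.sum_eq_zero fun x _ => Finset.sum_eq_zero fun y _ => ?_
    rw [wSigma, if_neg hv, map_zero, zero_mul]
  · simp

theorem rightR_sum (a b c d : Λ × X) (hab : qt deg a = b.1) :
    ∑ xy ∈ composablePairs (qs Λ X) (qt deg), rightR K deg σ (.op (wSigma σ c d xy.1 xy.2)) *
        (onSym K deg σ (Sym.arrow a xy.1) * onSym K deg σ (Sym.arrow b xy.2)) =
      FRTAlg.src K deg σ (Pi.single a.1 1) * FRTAlg.tgt K deg σ (.op (Pi.single c.1 1)) *
        ∑ y, ∑ x, FRTAlg.tgt K deg σ (.op (σ d.2 c.2 y x)) * FRTAlg.L K deg σ a.2 x *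
          FRTAlg.L K deg σ b.2 y := by
  rw [sum_composablePairs]
  rw [Finset.sum_eq_single c.1]
  · rw [Finset.sum_comm, Finset.mul_sum]
    refine Finset.sum_congr rfl fun y _ => ?_
    rw [Finset.mul_sum]
    refine Finset.sum_congr rfl fun x _ => ?_
    rw [onSym_arrow_mul K deg σ _ _ _ _ hab rfl, rightR_apply, wSigma, if_pos rfl]
    simp only [← mul_assoc]
    rw [← (FRTAlg.src_tgt_comm K deg σ _ _).eq,
      mul_assoc (FRTAlg.src K deg σ (Pi.single a.1 1)) (FRTAlg.tgt K deg σ _)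
        (FRTAlg.tgt K deg σ _), ← map_mul,
      mul_assoc (FRTAlg.src K deg σ (Pi.single a.1 1)) (FRTAlg.tgt K deg σ _)
        (FRTAlg.tgt K deg σ _), ← map_mul, ← MulOpposite.op_mul, ← MulOpposite.op_mul,
      single_mul_const, mul_single]
  · intro v _ hv
    refine Finset.sum_eq_zero fun x _ => Finset.sum_eq_zero fun y _ => ?_
    rw [wSigma, if_neg (Ne.symm hv), MulOpposite.op_zero, map_zero, zero_mul]
  · simp

end Phi

/-- The homomorphism `Φ : 𝔄(w_σ) → A_σ`, `Φ(r ⊗ r' ⊗ e[p; q]) =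
(r_M ⊗ r'_M)(δ_{s(p)} ⊗ δ_{s(q)}) L_{x₁y₁} ⋯ L_{xₘyₘ}` for
`p = ((v₁, x₁), …, (vₘ, xₘ))`, `q = ((u₁, y₁), …, (uₘ, yₘ))`. -/
def Phi : FaceSigma K deg σ →ₐ[K] FRTAlg K deg σ :=
  FaceAlg.lift K (qs Λ X) (qt deg) (wSigma σ) (Phi.leftR K deg σ) (Phi.rightR K deg σ)
    (Phi.onG K deg σ)
    (fun r r' => FRTAlg.src_tgt_comm K deg σ _ _)
    (by
      intro r x
      rw [Phi.onG, GAlg.lift_e, Phi.onSym, Phi.leftR_apply]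
      refine Commute.mul_right (Commute.mul_right ?_ (FRTAlg.src_tgt_comm K deg σ _ _))
        (Phi.src_const_word K deg σ r _ _)
      rw [Commute, SemiconjBy, ← map_mul, ← map_mul, Phi.const_mul_single, Phi.single_mul_const])
    (by
      intro r x
      induction r using MulOpposite.rec' with
      | h r =>
      rw [Phi.onG, GAlg.lift_e, Phi.onSym, Phi.rightR_apply]
      refine Commute.mul_right (Commute.mul_right (FRTAlg.src_tgt_comm K deg σ _ _).symm ?_)
        (Phi.tgt_const_word K deg σ r _ _)
      rw [Commute, SemiconjBy, ← map_mul, ← map_mul, ← MulOpposite.op_mul, ← MulOpposite.op_mul,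
        Phi.const_mul_single, Phi.single_mul_const])
    (by
      intro a b c d hab hcd
      simp only [Phi.onG, GAlg.lift_e]
      rw [Phi.leftR_sum K deg σ a b c d hcd, Phi.rightR_sum K deg σ a b c d hab,
        FRTAlg.yangBaxter])

theorem Phi_mk (r r' : R) (x : Sym (qs Λ X) (qt deg)) :
    Phi K deg σ (FaceAlg.mk K _ _ _ (HAlg.tmul K r (.op r') (GAlg.e K x))) =
      FRTAlg.base K deg σ ((fun _ => r) ⊗ₜ .op fun _ => r') *
        FRTAlg.base K deg σ (Pi.single x.top.src 1 ⊗ₜ .op (Pi.single x.bot.src 1)) *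
        (List.zipWith (fun p q => FRTAlg.L K deg σ p.2 q.2) x.top.arrows x.bot.arrows).prod := by
  have h : Phi K deg σ (FaceAlg.mk K _ _ _ (HAlg.tmul K r (.op r') (GAlg.e K x))) =
      Phi.leftR K deg σ r * Phi.rightR K deg σ (.op r') * Phi.onG K deg σ (GAlg.e K x) :=
    FaceAlg.lift_mk K _ _ _ r (.op r') _
  have hb : ∀ f g : Λ → R, FRTAlg.base K deg σ (f ⊗ₜ .op g) =
      FRTAlg.src K deg σ f * FRTAlg.tgt K deg σ (.op g) := by
    intro f g
    simp [FRTAlg.src, FRTAlg.tgt, ← map_mul]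
  rw [h, Phi.onG, GAlg.lift_e, hb, hb, Phi.onSym, ← mul_assoc]
  rfl

end Phi

/-! ### The weak bialgebra structures on `𝔄(w_σ)` and `A_σ` -/

section Structure

variable {K R Λ X : Type*} [Field K] [Ring R] [Algebra K R] [Fintype Λ] [DecidableEq Λ]
  [Fintype X] [DecidableEq X]

/-- The coproduct `Δ(a) = t(e⁽¹⁾) a₍₁₎ ⊗ s(e⁽²⁾) a₍₂₎` of `𝔄(w_σ)`. -/
def faceComul (F : FrobeniusSystem K R) (deg : X → Equiv.Perm Λ) (σ : X → X → X → X → Λ → R) :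
    FaceSigma K deg σ →ₗ[K] FaceSigma K deg σ ⊗[K] FaceSigma K deg σ :=
  weakComul (FaceAlg.src K (qs Λ X) (qt deg) (wSigma σ))
    (FaceAlg.tgt K (qs Λ X) (qt deg) (wSigma σ)) (F.pi Λ)
    (FaceAlg.comulBase K (qs Λ X) (qt deg) (wSigma σ))

/-- The counit `ε = ψ ∘ π` of `𝔄(w_σ)`. -/
def faceCounit (F : FrobeniusSystem K R) {deg : X → Equiv.Perm Λ} {σ : X → X → X → X → Λ → R}
    (hσ : IsFRTFamily deg σ) : FaceSigma K deg σ →ₗ[K] K :=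
  weakCounit (F.pi Λ) (FaceAlg.counitBase K (isFaceWeight_wSigma hσ))

/-- The coproduct `Δ(a) = t(e⁽¹⁾) a₍₁₎ ⊗ s(e⁽²⁾) a₍₂₎` of `A_σ`. -/
def frtComul (F : FrobeniusSystem K R) (deg : X → Equiv.Perm Λ) (σ : X → X → X → X → Λ → R) :
    FRTAlg K deg σ →ₗ[K] FRTAlg K deg σ ⊗[K] FRTAlg K deg σ :=
  weakComul (FRTAlg.src K deg σ) (FRTAlg.tgt K deg σ) (F.pi Λ) (FRTAlg.comulBase K deg σ)

/-- The counit `ε = ψ ∘ π` of `A_σ`. -/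
def frtCounit (F : FrobeniusSystem K R) {deg : X → Equiv.Perm Λ} {σ : X → X → X → X → Λ → R}
    (hσ : IsFRTFamily deg σ) : FRTAlg K deg σ →ₗ[K] K :=
  weakCounit (F.pi Λ) (FRTAlg.counitBase K hσ)

end Structure

end FRT

end

universe w

/-! Write M for M_Λ(R) and e⁽¹⁾ ⊗ e⁽²⁾ for its Casimir element. Since e⁽¹⁾e⁽²⁾ = 1, left
multiplication by the idempotent E = t(e⁽¹⁾) ⊗ s(e⁽²⁾) splits the projection of A ⊗ A onto its
quotient A ⊗_M A. Hence a coproduct over M lifts to an ordinary multiplicative one with Δ(1) = E.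
The duality between ψ and e turns the counit χ(a)(1) over M into a scalar counit satisfying the weak
axioms (`IsBialgebroid.weakBialgebra`). The bialgebroid axioms are stable under products, so they
need checking only on generators (`IsPreBialgebroid.isBialgebroid`).

The two algebras are compared through the matrix `ell` in 𝔄(w_σ), which `Phi` carries to L. Together
with the s(f) and t(f) its entries generate 𝔄(w_σ) (`FaceSigma.induction`), and they satisfy every
defining relation of A_σ that does not mention L⁻¹ (`ell_src`, `ell_tgt`, `FaceSigma.yangBaxter`).
The relations between L⁻¹ and the base follow from those of L (`exists_lift`). So A_σ is 𝔄(w_σ) with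
a two-sided inverse of one matrix adjoined.

Now let f be a homomorphism with antipode g. Evaluating the two convolution identities on `ell`
shows that the matrix g(ell) is inverse to f(ell). The copy of E inside the coproduct is removed by
the rules by which g converts factors s(l) and t(l) (`sum_antipode_mul_map`,
`sum_map_mul_antipode`); the Nakayama automorphism θ of ψ enters there because ψ need not be a
trace. Therefore f factors through `Phi`, uniquely since inverse matrices are unique. The
factorization respects Δ and ε because both are forced on L⁻¹ by their values on s(f), t(f) and L
(`FRTAlg.linearMap_ext`, `FRTAlg.counit_ext`).

Finally, rigidity supplies x_{ab} which invert L⁻¹ in the opposite algebra. This yields an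
antimultiplicative S with L ↦ L⁻¹, L⁻¹ ↦ x, t(f) ↦ s(f) and s(f) ↦ t(θ(f)). Its antipode axioms are
strengthened by a parameter between the two legs of the coproduct, which makes them stable under
products, and are then checked on generators (`isWeakHopfAntipode`). -/

noncomputable section

namespace FRT

/-! ### Frobenius systems in coordinates and the Nakayama automorphism -/

namespace FrobeniusSystem

variable {K L A : Type*} [Field K] [Ring L] [Algebra K L] [Ring A] [Algebra K A]
variable (F : FrobeniusSystem K L)

/-- The number of summands in a chosen presentation `e = ∑ fst i ⊗ snd i`. -/
def rank : ℕ := (TensorProduct.exists_sum_tmul_eq F.e).choose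

/-- The first components of the Casimir element. -/
def fst : Fin F.rank → L := (TensorProduct.exists_sum_tmul_eq F.e).choose_spec.choose

/-- The second components of the Casimir element. -/
def snd : Fin F.rank → L := (TensorProduct.exists_sum_tmul_eq F.e).choose_spec.choose_spec.choose

theorem e_eq : F.e = ∑ i, F.fst i ⊗ₜ[K] F.snd i :=
  (TensorProduct.exists_sum_tmul_eq F.e).choose_spec.choose_spec.choose_spec

theorem sum_fst_mul_snd : ∑ i, F.fst i * F.snd i = 1 := by
  have h := F.mul_eq_one
  rw [e_eq] at h
  simpa using h

theorem sum_psi_fst (l : L) : ∑ i, F.ψ (l * F.fst i) • F.snd i = l := by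
  have h := F.left_dual l
  rw [e_eq] at h
  simpa using h

theorem sum_psi_snd (l : L) : ∑ i, F.ψ (F.snd i * l) • F.fst i = l := by
  have h := F.right_dual l
  rw [e_eq] at h
  simpa using h

/-- The dual basis formula recovers x from the scalars ψ(e⁽²⁾x), so the form (m, x) ↦ ψ(mx) is
nondegenerate. Identities in L involving θ or `kappa` are proved by pairing both sides with an
arbitrary m. -/
theorem ext_psi_left {x y : L} (h : ∀ m, F.ψ (m * x) = F.ψ (m * y)) : x = y := by
  rw [← F.sum_psi_snd x, ← F.sum_psi_snd y]
  simp only [h]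

/-- Representability of functionals by the form: φ = ψ(· c) with an explicit c. The definitions of θ
and `kappa` are instances. -/
theorem psi_eq_sum (φ : L →ₗ[K] K) (m : L) :
    F.ψ (m * ∑ i, φ (F.snd i) • F.fst i) = φ m := by
  conv_rhs => rw [← F.sum_psi_fst m]
  simp only [Finset.mul_sum, map_sum, mul_smul_comm, map_smul, smul_eq_mul]
  exact Finset.sum_congr rfl fun i _ => mul_comm _ _

theorem psi_sum_eq (φ : L →ₗ[K] K) (m : L) :
    F.ψ ((∑ i, φ (F.fst i) • F.snd i) * m) = φ m := by
  conv_rhs => rw [← F.sum_psi_snd m]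
  simp only [Finset.sum_mul, map_sum, smul_mul_assoc, map_smul, smul_eq_mul]
  exact Finset.sum_congr rfl fun i _ => mul_comm _ _

/-- The Nakayama automorphism `θ(l) = ψ(l e⁽²⁾) e⁽¹⁾`. -/
def nakayamaLin : L →ₗ[K] L :=
  ∑ i, (LinearMap.toSpanSingleton K L (F.fst i)) ∘ₗ F.ψ ∘ₗ LinearMap.mulRight K (F.snd i)

theorem psi_mul_nakayamaLin (m l : L) : F.ψ (m * F.nakayamaLin l) = F.ψ (l * m) := by
  have h := F.psi_eq_sum (F.ψ ∘ₗ LinearMap.mulLeft K l) m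
  simpa [nakayamaLin] using h

/-- The Nakayama automorphism as an algebra homomorphism. -/
def nakayama : L →ₐ[K] L :=
  AlgHom.ofLinearMap F.nakayamaLin
    (F.ext_psi_left fun m => by rw [psi_mul_nakayamaLin, one_mul, mul_one])
    (fun l l' => F.ext_psi_left fun m => by
      rw [psi_mul_nakayamaLin, ← mul_assoc, psi_mul_nakayamaLin, ← mul_assoc, psi_mul_nakayamaLin,
        mul_assoc])

theorem nakayama_apply (l : L) : F.nakayama l = ∑ i, F.ψ (l * F.snd i) • F.fst i := by
  change F.nakayamaLin l = _
  simp [nakayamaLin]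

theorem psi_mul_nakayama (m l : L) : F.ψ (m * F.nakayama l) = F.ψ (l * m) :=
  F.psi_mul_nakayamaLin m l

theorem nakayama_surjective : Function.Surjective F.nakayama := by
  intro l
  -- The witness represents the functional m ↦ ψ(ml) from the other side, as m ↦ ψ(cm); the defining
  -- property of θ then says θ(c) = l.
  refine ⟨∑ i, F.ψ (F.fst i * l) • F.snd i, F.ext_psi_left fun m => ?_⟩
  rw [psi_mul_nakayama]
  exact F.psi_sum_eq (F.ψ ∘ₗ LinearMap.mulRight K l) m

theorem nakayama_central {z : L} (hz : z ∈ Subring.center L) : F.nakayama z = z :=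
  F.ext_psi_left fun m => by rw [psi_mul_nakayama, Subring.mem_center_iff.1 hz]

/-- Expanding θ(e⁽²⁾) in the dual basis and summing over the first copy of e collapses everything to
e⁽¹⁾e⁽²⁾ = 1. This twisted form of separability is what cancels E whenever an antipode has turned
s(e⁽²⁾) into t(θ(e⁽²⁾)). -/
theorem sum_nakayama_snd_mul_fst : ∑ i, F.nakayama (F.snd i) * F.fst i = 1 := by
  have h : ∀ i, F.nakayama (F.snd i) * F.fst i =
      ∑ j, F.fst j * (F.ψ (F.snd i * F.snd j) • F.fst i) := by
    intro i
    simp only [nakayama_apply, Finset.sum_mul, smul_mul_assoc, mul_smul_comm]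
  simp only [h]
  rw [Finset.sum_comm]
  simp only [← Finset.mul_sum, sum_psi_snd, sum_fst_mul_snd]

variable (s : L →ₐ[K] A) (t : Lᵐᵒᵖ →ₐ[K] A)

theorem idem_eq : F.idem s t = ∑ i, t (.op (F.fst i)) ⊗ₜ[K] s (F.snd i) := by
  rw [idem, e_eq]
  simp

theorem idem_mul_tgt (l : L) :
    F.idem s t * (t (.op l) ⊗ₜ[K] 1) = F.idem s t * (1 ⊗ₜ[K] s l) := by
  rw [← sub_eq_zero, ← mul_sub]
  exact F.idem_mul s t (Submodule.subset_span ⟨l, 1, (mul_one _).symm⟩)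

theorem idem_mul_tgt_mul (l : L) (x y : A) :
    F.idem s t * ((t (.op l) * x) ⊗ₜ[K] y) = F.idem s t * (x ⊗ₜ[K] (s l * y)) := by
  have h := congrArg (· * (x ⊗ₜ[K] y)) (F.idem_mul_tgt s t l)
  simpa [mul_assoc] using h

/-- Moving t(e⁽¹⁾) across the balanced tensor sign gives 1 ⊗ s(e⁽¹⁾e⁽²⁾) = 1 ⊗ 1. Together with
`idem_mul` this makes left multiplication by E a section of the quotient map. -/
theorem idem_sub_one_mem : F.idem s t - 1 ∈ balancedIdeal s t := by
  have h : (1 : A ⊗[K] A) = ∑ i, (1 : A) ⊗ₜ[K] (s (F.fst i) * s (F.snd i)) := by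
    rw [← TensorProduct.tmul_sum]
    simp only [← map_mul, ← map_sum, sum_fst_mul_snd, map_one]
    rfl
  rw [idem_eq, h, ← Finset.sum_sub_distrib]
  refine Submodule.sum_mem _ fun i _ => Submodule.subset_span
    ⟨F.fst i, 1 ⊗ₜ[K] s (F.snd i), ?_⟩
  simp [sub_mul]

theorem idem_mul_idem : F.idem s t * F.idem s t = F.idem s t := by
  have h := F.idem_mul s t (F.idem_sub_one_mem s t)
  rwa [mul_sub, mul_one, sub_eq_zero] at h

/-- An element x of `takeuchi` keeps the balancing ideal stable, so x(E - 1) lies in the ideal and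
is killed by E. This absorption of the inner E is the source of multiplicativity of the lifted
coproduct. -/
theorem idem_mul_mul_idem {x : A ⊗[K] A} (hx : x ∈ takeuchi s t) :
    F.idem s t * x * F.idem s t = F.idem s t * x := by
  have h := F.idem_mul s t (hx _ (F.idem_sub_one_mem s t))
  rwa [mul_sub, mul_one, mul_sub, sub_eq_zero, ← mul_assoc] at h

end FrobeniusSystem

/-! ### Multiplicativity of the coproduct lifted to A ⊗ A -/

section Comul

variable {K L A : Type*} [Field K] [Ring L] [Algebra K L] [Ring A] [Algebra K A]
variable (F : FrobeniusSystem K L) (s : L →ₐ[K] A) (t : Lᵐᵒᵖ →ₐ[K] A)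

/-- The coproduct over L is the action applied to the class of 1, so a representative x of the
action of a gives Δ(a) = Ex. The choice of x is immaterial because E kills the ideal. -/
theorem weakComul_of_act (act : A →ₐ[K] Module.End K (BalancedTensor s t)) {a : A}
    {x : takeuchi s t} (h : act a = takeuchiAct s t x) :
    weakComul s t F (LinearMap.applyₗ (Submodule.Quotient.mk 1) ∘ₗ act.toLinearMap) a =
      F.idem s t * x.1 := by
  have h1 : weakComul s t F (LinearMap.applyₗ (Submodule.Quotient.mk 1) ∘ₗ act.toLinearMap) a =
      (balancedIdeal s t).liftQ (LinearMap.mulLeft K (F.idem s t))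
        (fun _ hy => F.idem_mul s t hy) (act a (Submodule.Quotient.mk 1)) := rfl
  rw [h1, h, takeuchiAct_mk, mul_one]
  rfl

theorem weakComul_mul_of_act (act : A →ₐ[K] Module.End K (BalancedTensor s t))
    (hact : ∀ a, ∃ x, act a = takeuchiAct s t x) (a b : A) :
    weakComul s t F (LinearMap.applyₗ (Submodule.Quotient.mk 1) ∘ₗ act.toLinearMap) (a * b) =
      weakComul s t F (LinearMap.applyₗ (Submodule.Quotient.mk 1) ∘ₗ act.toLinearMap) a *
      weakComul s t F (LinearMap.applyₗ (Submodule.Quotient.mk 1) ∘ₗ act.toLinearMap) b := by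
  obtain ⟨x, hx⟩ := hact a
  obtain ⟨y, hy⟩ := hact b
  have hxy : act (a * b) = takeuchiAct s t (x * y) := by rw [map_mul, map_mul, hx, hy]
  rw [weakComul_of_act F s t act hx, weakComul_of_act F s t act hy,
    weakComul_of_act F s t act hxy, ← mul_assoc, F.idem_mul_mul_idem s t x.2, mul_assoc]
  rfl

end Comul

/-! ### Weak bialgebras from bialgebroids over a Frobenius-separable base -/

section Bialgebroid

variable {K L A : Type*} [Field K] [Ring L] [Algebra K L] [Ring A] [Algebra K A]

/-- The map `x ⊗ y ↦ s(π(x)) y`, where `π(x) = χ(x)(1)`. -/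
def contractLeft (s : L →ₐ[K] A) (χ : A →ₐ[K] Module.End K L) : A ⊗[K] A →ₗ[K] A :=
  LinearMap.mul' K A ∘ₗ
    TensorProduct.map (s.toLinearMap ∘ₗ LinearMap.applyₗ (1 : L) ∘ₗ χ.toLinearMap) LinearMap.id

/-- The map `x ⊗ y ↦ t(π(y)) x`, where `π(y) = χ(y)(1)`. -/
def contractRight (t : Lᵐᵒᵖ →ₐ[K] A) (χ : A →ₐ[K] Module.End K L) : A ⊗[K] A →ₗ[K] A :=
  LinearMap.mul' K A ∘ₗ
    TensorProduct.map (t.toLinearMap ∘ₗ (MulOpposite.opLinearEquiv K).toLinearMap ∘ₗ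
      LinearMap.applyₗ (1 : L) ∘ₗ χ.toLinearMap) LinearMap.id ∘ₗ
    (TensorProduct.comm K A A).toLinearMap

theorem contractLeft_tmul (s : L →ₐ[K] A) (χ : A →ₐ[K] Module.End K L) (x y : A) :
    contractLeft s χ (x ⊗ₜ y) = s (χ x 1) * y := rfl

theorem contractRight_tmul (t : Lᵐᵒᵖ →ₐ[K] A) (χ : A →ₐ[K] Module.End K L) (x y : A) :
    contractRight t χ (x ⊗ₜ y) = t (.op (χ y 1)) * x := rfl

/-- The multiplicative part of the structure of a bialgebroid over a Frobenius-separable algebra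
`L`, in terms of the coproduct `Δ` with values in `A ⊗ A`. -/
structure IsPreBialgebroid (F : FrobeniusSystem K L) (s : L →ₐ[K] A) (t : Lᵐᵒᵖ →ₐ[K] A)
    (Δ : A →ₗ[K] A ⊗[K] A) (χ : A →ₐ[K] Module.End K L) : Prop where
  commute : ∀ l m, Commute (s l) (t m)
  comul_one : Δ 1 = F.idem s t
  comul_mul : ∀ a b, Δ (a * b) = Δ a * Δ b
  act_src : ∀ l m, χ (s l) m = l * m
  act_tgt : ∀ l m, χ (t (.op l)) m = m * l

/-- A bialgebroid over a Frobenius-separable algebra `L`, in terms of the coproduct `Δ` with values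
in `A ⊗ A`. -/
structure IsBialgebroid (F : FrobeniusSystem K L) (s : L →ₐ[K] A) (t : Lᵐᵒᵖ →ₐ[K] A)
    (Δ : A →ₗ[K] A ⊗[K] A) (χ : A →ₐ[K] Module.End K L) : Prop
    extends IsPreBialgebroid F s t Δ χ where
  comul_src : ∀ l, Δ (s l) = F.idem s t * (s l ⊗ₜ 1)
  comul_tgt : ∀ l, Δ (t l) = F.idem s t * (1 ⊗ₜ t l)
  coassoc : ∀ a, TensorProduct.assoc K A A A (Δ.rTensor A (Δ a)) = Δ.lTensor A (Δ a)
  counit_left : ∀ a, contractLeft s χ (Δ a) = a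
  counit_right : ∀ a, contractRight t χ (Δ a) = a

theorem assoc_mul (x y : (A ⊗[K] A) ⊗[K] A) : TensorProduct.assoc K A A A (x * y) =
    TensorProduct.assoc K A A A x * TensorProduct.assoc K A A A y :=
  map_mul (Algebra.TensorProduct.assoc K K K A A A) x y

namespace IsPreBialgebroid

variable {F : FrobeniusSystem K L} {s : L →ₐ[K] A} {t : Lᵐᵒᵖ →ₐ[K] A}
  {Δ : A →ₗ[K] A ⊗[K] A} {χ : A →ₐ[K] Module.End K L} (h : IsPreBialgebroid F s t Δ χ)
include h

theorem idem_mul_comul (a : A) : F.idem s t * Δ a = Δ a := by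
  rw [← h.comul_one, ← h.comul_mul, one_mul]

theorem comul_mul_idem (a : A) : Δ a * F.idem s t = Δ a := by
  rw [← h.comul_one, ← h.comul_mul, mul_one]

/-- The trailing E in Δ(a) = Δ(a)E absorbs the balancing relation, so a base element may cross
between the legs on the right of Δ(a). -/
theorem comul_mul_tgt (a : A) (l : L) : Δ a * (t (.op l) ⊗ₜ[K] 1) = Δ a * (1 ⊗ₜ[K] s l) := by
  rw [← h.comul_mul_idem a, mul_assoc, F.idem_mul_tgt, mul_assoc]

theorem rTensor_mul (z w : A ⊗[K] A) :
    Δ.rTensor A (z * w) = Δ.rTensor A z * Δ.rTensor A w := by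
  induction z with
  | zero => simp
  | add x y hx hy => simp only [add_mul, map_add, hx, hy]
  | tmul a b =>
    induction w with
    | zero => simp
    | add x y hx hy => simp only [mul_add, map_add, hx, hy]
    | tmul c d => simp [h.comul_mul]

theorem lTensor_mul (z w : A ⊗[K] A) :
    Δ.lTensor A (z * w) = Δ.lTensor A z * Δ.lTensor A w := by
  induction z with
  | zero => simp
  | add x y hx hy => simp only [add_mul, map_add, hx, hy]
  | tmul a b =>
    induction w with
    | zero => simp
    | add x y hx hy => simp only [mul_add, map_add, hx, hy]
    | tmul c d => simp [h.comul_mul]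

theorem coassoc_mul {a b : A}
    (ha : TensorProduct.assoc K A A A (Δ.rTensor A (Δ a)) = Δ.lTensor A (Δ a))
    (hb : TensorProduct.assoc K A A A (Δ.rTensor A (Δ b)) = Δ.lTensor A (Δ b)) :
    TensorProduct.assoc K A A A (Δ.rTensor A (Δ (a * b))) = Δ.lTensor A (Δ (a * b)) := by
  rw [h.comul_mul, h.rTensor_mul, h.lTensor_mul, assoc_mul, ha, hb]

/-- The copies E₁₂ and E₂₃ meet only in the middle factor, where one contributes s and the other t,
and these commute. -/
theorem assoc_idem_mul_idem :
    TensorProduct.assoc K A A A (F.idem s t ⊗ₜ[K] (1 : A)) * ((1 : A) ⊗ₜ[K] F.idem s t) =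
      ((1 : A) ⊗ₜ[K] F.idem s t) * TensorProduct.assoc K A A A (F.idem s t ⊗ₜ[K] (1 : A)) := by
  simp only [F.idem_eq, TensorProduct.sum_tmul, TensorProduct.tmul_sum, map_sum,
    TensorProduct.assoc_tmul, Finset.sum_mul, Finset.mul_sum, Algebra.TensorProduct.tmul_mul_tmul,
    one_mul, mul_one, (h.commute _ _).eq]
  exact Finset.sum_comm

theorem assoc_rTensor_idem (hΔ : ∀ l, Δ (t l) = F.idem s t * (1 ⊗ₜ t l)) :
    TensorProduct.assoc K A A A (Δ.rTensor A (F.idem s t)) =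
    TensorProduct.assoc K A A A (F.idem s t ⊗ₜ[K] (1 : A)) * ((1 : A) ⊗ₜ[K] F.idem s t) := by
  have h1 : Δ.rTensor A (F.idem s t) = (F.idem s t ⊗ₜ[K] (1 : A)) *
      ∑ i, (1 ⊗ₜ[K] t (.op (F.fst i))) ⊗ₜ[K] s (F.snd i) := by
    conv_lhs => rw [F.idem_eq]
    simp [hΔ, Finset.mul_sum]
  rw [h1, assoc_mul]
  congr 1
  rw [F.idem_eq]
  simp [TensorProduct.tmul_sum]

theorem lTensor_idem (hΔ : ∀ l, Δ (s l) = F.idem s t * (s l ⊗ₜ 1)) :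
    Δ.lTensor A (F.idem s t) =
    ((1 : A) ⊗ₜ[K] F.idem s t) * TensorProduct.assoc K A A A (F.idem s t ⊗ₜ[K] (1 : A)) := by
  have h1 : Δ.lTensor A (F.idem s t) = ((1 : A) ⊗ₜ[K] F.idem s t) *
      ∑ i, t (.op (F.fst i)) ⊗ₜ[K] (s (F.snd i) ⊗ₜ[K] (1 : A)) := by
    conv_lhs => rw [F.idem_eq]
    simp [hΔ, Finset.mul_sum]
  rw [h1]
  congr 1
  rw [F.idem_eq]
  simp [TensorProduct.sum_tmul]

theorem assoc_idem_mul_self :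
    TensorProduct.assoc K A A A (F.idem s t ⊗ₜ[K] (1 : A)) *
      TensorProduct.assoc K A A A (F.idem s t ⊗ₜ[K] (1 : A)) =
      TensorProduct.assoc K A A A (F.idem s t ⊗ₜ[K] (1 : A)) := by
  rw [← assoc_mul, Algebra.TensorProduct.tmul_mul_tmul, F.idem_mul_idem, one_mul]

theorem one_tmul_idem_mul_self :
    ((1 : A) ⊗ₜ[K] F.idem s t) * ((1 : A) ⊗ₜ[K] F.idem s t) = (1 : A) ⊗ₜ[K] F.idem s t := by
  rw [Algebra.TensorProduct.tmul_mul_tmul, F.idem_mul_idem, one_mul]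

/-- Here w plays the role of the naive threefold coproduct without idempotents. Since E₁₂ and E₂₃
are commuting idempotents, both iterated coproducts reduce to E₁₂E₂₃w. -/
theorem coassoc_of_eq (hs : ∀ l, Δ (s l) = F.idem s t * (s l ⊗ₜ 1))
    (ht : ∀ l, Δ (t l) = F.idem s t * (1 ⊗ₜ t l)) {a : A} {z : A ⊗[K] A} {w : A ⊗[K] (A ⊗[K] A)}
    (ha : Δ a = F.idem s t * z)
    (h1 : TensorProduct.assoc K A A A (Δ.rTensor A z) =
      TensorProduct.assoc K A A A (F.idem s t ⊗ₜ[K] (1 : A)) * w)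
    (h2 : Δ.lTensor A z = ((1 : A) ⊗ₜ[K] F.idem s t) * w) :
    TensorProduct.assoc K A A A (Δ.rTensor A (Δ a)) = Δ.lTensor A (Δ a) := by
  have key : ∀ p q : A ⊗[K] (A ⊗[K] A), p * p = p → q * q = q → p * q = q * p →
      p * q * (p * w) = q * p * (q * w) := by
    intro p q hp hq hpq
    calc p * q * (p * w) = q * (p * p) * w := by rw [hpq]; simp only [mul_assoc]
      _ = p * (q * q) * w := by rw [hp, hq, hpq]
      _ = q * p * (q * w) := by rw [← hpq]; simp only [mul_assoc]
  rw [ha, h.rTensor_mul, h.lTensor_mul, assoc_mul, h.assoc_rTensor_idem ht, h.lTensor_idem hs, h1,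
    h2]
  exact key _ _ h.assoc_idem_mul_self h.one_tmul_idem_mul_self h.assoc_idem_mul_idem

theorem coassoc_matrix (hs : ∀ l, Δ (s l) = F.idem s t * (s l ⊗ₜ 1))
    (ht : ∀ l, Δ (t l) = F.idem s t * (1 ⊗ₜ t l)) {ι : Type*} [Fintype ι] (u : ι → ι → A)
    (hu : ∀ i j, Δ (u i j) = F.idem s t * ∑ k, u i k ⊗ₜ u k j) (i j : ι) :
    TensorProduct.assoc K A A A (Δ.rTensor A (Δ (u i j))) = Δ.lTensor A (Δ (u i j)) := by
  refine h.coassoc_of_eq hs ht (w := ∑ k, ∑ l, u i k ⊗ₜ[K] (u k l ⊗ₜ[K] u l j)) (hu i j) ?_ ?_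
  · have : ∀ k, (F.idem s t * ∑ l, u i l ⊗ₜ[K] u l k) ⊗ₜ[K] u k j =
        (F.idem s t ⊗ₜ[K] (1 : A)) * ∑ l, (u i l ⊗ₜ[K] u l k) ⊗ₜ[K] u k j := by
      intro k
      rw [← TensorProduct.sum_tmul, Algebra.TensorProduct.tmul_mul_tmul, one_mul]
    simp only [map_sum, LinearMap.rTensor_tmul, hu, this, assoc_mul, TensorProduct.assoc_tmul,
      ← Finset.mul_sum]
    rw [Finset.sum_comm]
  · have : ∀ k, u i k ⊗ₜ[K] (F.idem s t * ∑ l, u k l ⊗ₜ[K] u l j) =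
        ((1 : A) ⊗ₜ[K] F.idem s t) * ∑ l, u i k ⊗ₜ[K] (u k l ⊗ₜ[K] u l j) := by
      intro k
      rw [← TensorProduct.tmul_sum, Algebra.TensorProduct.tmul_mul_tmul, one_mul]
    simp only [map_sum, LinearMap.lTensor_tmul, hu, this, ← Finset.mul_sum]

theorem coassoc_src (hs : ∀ l, Δ (s l) = F.idem s t * (s l ⊗ₜ 1))
    (ht : ∀ l, Δ (t l) = F.idem s t * (1 ⊗ₜ t l)) (l : L) :
    TensorProduct.assoc K A A A (Δ.rTensor A (Δ (s l))) = Δ.lTensor A (Δ (s l)) := by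
  refine h.coassoc_of_eq hs ht (w := s l ⊗ₜ[K] (1 ⊗ₜ[K] 1)) (hs l) ?_ ?_
  · rw [LinearMap.rTensor_tmul, hs, ← TensorProduct.assoc_tmul, ← assoc_mul]
    simp
  · rw [LinearMap.lTensor_tmul, h.comul_one]
    simp [← Algebra.TensorProduct.one_def]

theorem coassoc_tgt (hs : ∀ l, Δ (s l) = F.idem s t * (s l ⊗ₜ 1))
    (ht : ∀ l, Δ (t l) = F.idem s t * (1 ⊗ₜ t l)) (l : Lᵐᵒᵖ) :
    TensorProduct.assoc K A A A (Δ.rTensor A (Δ (t l))) = Δ.lTensor A (Δ (t l)) := by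
  refine h.coassoc_of_eq hs ht (w := 1 ⊗ₜ[K] (1 ⊗ₜ[K] t l)) (ht l) ?_ ?_
  · rw [LinearMap.rTensor_tmul, h.comul_one, ← TensorProduct.assoc_tmul, ← assoc_mul]
    simp [← Algebra.TensorProduct.one_def]
  · rw [LinearMap.lTensor_tmul, ht]
    simp

/-- The factor t(e⁽¹⁾) multiplies χ(x)(1) on the right by e⁽¹⁾, which then meets s(e⁽²⁾) and gives
e⁽¹⁾e⁽²⁾ = 1. The contraction therefore does not see E. -/
theorem contractLeft_idem_mul (z : A ⊗[K] A) :
    contractLeft s χ (F.idem s t * z) = contractLeft s χ z := by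
  induction z with
  | zero => simp
  | add x y hx hy => simp only [mul_add, map_add, hx, hy]
  | tmul x y =>
    have : ∀ i, χ (t (.op (F.fst i)) * x) 1 = χ x 1 * F.fst i := by
      intro i
      rw [map_mul, Module.End.mul_apply, h.act_tgt]
    simp only [F.idem_eq, Finset.sum_mul, map_sum, Algebra.TensorProduct.tmul_mul_tmul,
      contractLeft_tmul, this, ← mul_assoc, ← map_mul]
    simp only [← Finset.sum_mul, ← map_sum, mul_assoc (χ x 1), ← Finset.mul_sum, F.sum_fst_mul_snd,
      mul_one]

theorem contractRight_idem_mul (z : A ⊗[K] A) :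
    contractRight t χ (F.idem s t * z) = contractRight t χ z := by
  induction z with
  | zero => simp
  | add x y hx hy => simp only [mul_add, map_add, hx, hy]
  | tmul x y =>
    have : ∀ i, χ (s (F.snd i) * y) 1 = F.snd i * χ y 1 := by
      intro i
      rw [map_mul, Module.End.mul_apply, h.act_src]
    simp only [F.idem_eq, Finset.sum_mul, map_sum, Algebra.TensorProduct.tmul_mul_tmul,
      contractRight_tmul, this, ← mul_assoc, ← map_mul, ← MulOpposite.op_mul]
    simp only [← Finset.sum_mul, ← map_sum, ← Finset.op_sum, F.sum_fst_mul_snd, one_mul]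

/-- Since χ(px)(1) = χ(p)(χ(x)(1)), only χ(x)(1) matters, and t(χ(x)(1)) sends 1 to the same
element. Replacing x by an element of the base makes `comul_mul_tgt` applicable. -/
theorem contractLeft_mul (z : A ⊗[K] A) (x y : A) :
    contractLeft s χ (z * (t (.op (χ x 1)) ⊗ₜ[K] y)) = contractLeft s χ (z * (x ⊗ₜ[K] y)) := by
  induction z with
  | zero => simp
  | add z w hz hw => simp only [add_mul, map_add, hz, hw]
  | tmul p q =>
    simp only [Algebra.TensorProduct.tmul_mul_tmul, contractLeft_tmul, map_mul,
      Module.End.mul_apply, h.act_tgt, one_mul]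

theorem contractRight_mul (z : A ⊗[K] A) (x y : A) :
    contractRight t χ (z * (x ⊗ₜ[K] s (χ y 1))) = contractRight t χ (z * (x ⊗ₜ[K] y)) := by
  induction z with
  | zero => simp
  | add z w hz hw => simp only [add_mul, map_add, hz, hw]
  | tmul p q =>
    simp only [Algebra.TensorProduct.tmul_mul_tmul, contractRight_tmul, map_mul,
      Module.End.mul_apply, h.act_src, mul_one]

theorem contractLeft_mul_one_tmul (z : A ⊗[K] A) (y : A) :
    contractLeft s χ (z * (1 ⊗ₜ[K] y)) = contractLeft s χ z * y := by
  induction z with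
  | zero => simp
  | add z w hz hw => simp only [add_mul, map_add, hz, hw]
  | tmul p q =>
    simp only [Algebra.TensorProduct.tmul_mul_tmul, contractLeft_tmul, mul_one, mul_assoc]

theorem contractRight_mul_tmul_one (z : A ⊗[K] A) (x : A) :
    contractRight t χ (z * (x ⊗ₜ[K] 1)) = contractRight t χ z * x := by
  induction z with
  | zero => simp
  | add z w hz hw => simp only [add_mul, map_add, hz, hw]
  | tmul p q =>
    simp only [Algebra.TensorProduct.tmul_mul_tmul, contractRight_tmul, mul_one, mul_assoc]

theorem counit_left_mul {a b : A} (ha : contractLeft s χ (Δ a) = a)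
    (hb : contractLeft s χ (Δ b) = b) : contractLeft s χ (Δ (a * b)) = a * b := by
  -- The first factor x of z is replaced by t(χ(x)(1)), which crosses to the second leg as
  -- s(χ(x)(1)). What remains to the right of Δ(a) lives in the second leg only and can be pulled
  -- out.
  have key : ∀ z, contractLeft s χ (Δ a * z) = a * contractLeft s χ z := by
    intro z
    induction z with
    | zero => simp
    | add z w hz hw => simp only [mul_add, map_add, hz, hw]
    | tmul x y =>
      have h1 : t (.op (χ x 1)) ⊗ₜ[K] y = (t (.op (χ x 1)) ⊗ₜ[K] 1) * ((1 : A) ⊗ₜ[K] y) := by simp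
      rw [← h.contractLeft_mul, h1, ← mul_assoc, h.comul_mul_tgt, mul_assoc,
        Algebra.TensorProduct.tmul_mul_tmul, one_mul, h.contractLeft_mul_one_tmul, ha,
        contractLeft_tmul]
  rw [h.comul_mul, key, hb]

theorem counit_right_mul {a b : A} (ha : contractRight t χ (Δ a) = a)
    (hb : contractRight t χ (Δ b) = b) : contractRight t χ (Δ (a * b)) = a * b := by
  have key : ∀ z, contractRight t χ (Δ a * z) = a * contractRight t χ z := by
    intro z
    induction z with
    | zero => simp
    | add z w hz hw => simp only [mul_add, map_add, hz, hw]
    | tmul x y =>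
      have h1 : x ⊗ₜ[K] s (χ y 1) = ((1 : A) ⊗ₜ[K] s (χ y 1)) * (x ⊗ₜ[K] 1) := by simp
      rw [← h.contractRight_mul, h1, ← mul_assoc, ← h.comul_mul_tgt, mul_assoc,
        Algebra.TensorProduct.tmul_mul_tmul, one_mul, h.contractRight_mul_tmul_one, ha,
        contractRight_tmul]
  rw [h.comul_mul, key, hb]

/-- If the bialgebroid axioms hold on elements that generate `A` under sums and products, then
they hold everywhere. -/
theorem isBialgebroid (hs : ∀ l, Δ (s l) = F.idem s t * (s l ⊗ₜ 1))
    (ht : ∀ l, Δ (t l) = F.idem s t * (1 ⊗ₜ t l)) (S : Set A)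
    (hS : ∀ P : A → Prop, (∀ l, P (s l)) → (∀ l, P (t l)) → (∀ a ∈ S, P a) →
      (∀ a b, P a → P b → P (a + b)) → (∀ a b, P a → P b → P (a * b)) → ∀ a, P a)
    (h1 : ∀ a ∈ S, TensorProduct.assoc K A A A (Δ.rTensor A (Δ a)) = Δ.lTensor A (Δ a))
    (h2 : ∀ a ∈ S, contractLeft s χ (Δ a) = a) (h3 : ∀ a ∈ S, contractRight t χ (Δ a) = a) :
    IsBialgebroid F s t Δ χ where
  toIsPreBialgebroid := h
  comul_src := hs
  comul_tgt := ht
  coassoc := by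
    refine hS _ (h.coassoc_src hs ht) (h.coassoc_tgt hs ht) h1 (fun a b ha hb => ?_)
      (fun a b ha hb => h.coassoc_mul ha hb)
    simp only [map_add, ha, hb]
  counit_left := by
    refine hS _ (fun l => ?_) (fun l => ?_) h2 (fun a b ha hb => ?_)
      (fun a b ha hb => h.counit_left_mul ha hb)
    · rw [hs, h.contractLeft_idem_mul, contractLeft_tmul, h.act_src, mul_one, mul_one]
    · rw [ht, h.contractLeft_idem_mul, contractLeft_tmul]
      simp
    · simp only [map_add, ha, hb]
  counit_right := by
    refine hS _ (fun l => ?_) (fun l => ?_) h3 (fun a b ha hb => ?_)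
      (fun a b ha hb => h.counit_right_mul ha hb)
    · rw [hs, h.contractRight_idem_mul, contractRight_tmul]
      simp
    · induction l using MulOpposite.rec' with
      | h l => rw [ht, h.contractRight_idem_mul, contractRight_tmul, h.act_tgt, mul_one, one_mul]
    · simp only [map_add, ha, hb]

end IsPreBialgebroid

end Bialgebroid

/-! ### The scalar counit, the weak axioms and the counital maps -/

section Bialgebroid

variable {K L A : Type*} [Field K] [Ring L] [Algebra K L] [Ring A] [Algebra K A]

/-- The counit `ε(a) = ψ(χ(a)(1))`. -/
def actCounit (F : FrobeniusSystem K L) (χ : A →ₐ[K] Module.End K L) : A →ₗ[K] K :=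
  weakCounit F (LinearMap.applyₗ (1 : L) ∘ₗ χ.toLinearMap)

theorem actCounit_apply (F : FrobeniusSystem K L) (χ : A →ₐ[K] Module.End K L) (a : A) :
    actCounit F χ a = F.ψ (χ a 1) := rfl

namespace IsBialgebroid

variable {F : FrobeniusSystem K L} {s : L →ₐ[K] A} {t : Lᵐᵒᵖ →ₐ[K] A}
  {Δ : A →ₗ[K] A ⊗[K] A} {χ : A →ₐ[K] Module.End K L} (h : IsBialgebroid F s t Δ χ)
include h

theorem act_src_mul (l : L) (a : A) (m : L) : χ (s l * a) m = l * χ a m := by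
  rw [map_mul, Module.End.mul_apply, h.act_src]

theorem act_tgt_mul (l : L) (a : A) (m : L) : χ (t (.op l) * a) m = χ a m * l := by
  rw [map_mul, Module.End.mul_apply, h.act_tgt]

theorem act_mul_src (l : L) (a : A) (m : L) : χ (a * s l) m = χ a (l * m) := by
  rw [map_mul, Module.End.mul_apply, h.act_src]

/-- The sum of ψ(χ(x)(1)e⁽¹⁾)e⁽²⁾ is χ(x)(1) by duality. Thus ε on the first leg, after E, is the
contraction over L, and the counit axiom over L becomes the one over K. -/
theorem rTensor_counit_idem_mul (z : A ⊗[K] A) :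
    (actCounit F χ).rTensor A (F.idem s t * z) = 1 ⊗ₜ contractLeft s χ z := by
  induction z with
  | zero => simp
  | add x y hx hy => simp only [mul_add, map_add, hx, hy, TensorProduct.tmul_add]
  | tmul x y =>
    have : ∀ i, F.ψ (χ x 1 * F.fst i) ⊗ₜ[K] (s (F.snd i) * y) =
        1 ⊗ₜ[K] (s (F.ψ (χ x 1 * F.fst i) • F.snd i) * y) := by
      intro i
      rw [map_smul, smul_mul_assoc, ← TensorProduct.smul_tmul, smul_eq_mul, mul_one]
    simp only [F.idem_eq, Finset.sum_mul, map_sum, Algebra.TensorProduct.tmul_mul_tmul,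
      LinearMap.rTensor_tmul, actCounit_apply, h.act_tgt_mul, this]
    rw [← TensorProduct.tmul_sum, ← Finset.sum_mul, ← map_sum, F.sum_psi_fst, contractLeft_tmul]

theorem lTensor_counit_idem_mul (z : A ⊗[K] A) :
    (actCounit F χ).lTensor A (F.idem s t * z) = contractRight t χ z ⊗ₜ 1 := by
  induction z with
  | zero => simp
  | add x y hx hy => simp only [mul_add, map_add, hx, hy, TensorProduct.add_tmul]
  | tmul x y =>
    have : ∀ i, (t (.op (F.fst i)) * x) ⊗ₜ[K] F.ψ (F.snd i * χ y 1) =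
        (t (.op (F.ψ (F.snd i * χ y 1) • F.fst i)) * x) ⊗ₜ[K] 1 := by
      intro i
      rw [MulOpposite.op_smul, map_smul, smul_mul_assoc, TensorProduct.smul_tmul, smul_eq_mul,
        mul_one]
    simp only [F.idem_eq, Finset.sum_mul, map_sum, Algebra.TensorProduct.tmul_mul_tmul,
      LinearMap.lTensor_tmul, actCounit_apply, h.act_src_mul, this]
    rw [← TensorProduct.sum_tmul, ← Finset.sum_mul, ← map_sum, ← Finset.op_sum, F.sum_psi_snd,
      contractRight_tmul]

/-- In the product ψ(χ(a)(χ(x)(1)e⁽¹⁾)) ψ(e⁽²⁾χ(yc)(1)) the dual basis formula reassembles χ(yc)(1)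
inside the first ψ. Taking z = Δ(b), whose contraction is b, gives one of the two weak
multiplicativity axioms for ε. -/
theorem counit_mul_left_idem (a c : A) (z : A ⊗[K] A) :
    LinearMap.mul' K K (TensorProduct.map (actCounit F χ ∘ₗ LinearMap.mulLeft K a)
      (actCounit F χ ∘ₗ LinearMap.mulRight K c) (F.idem s t * z)) =
      actCounit F χ (a * contractLeft s χ z * c) := by
  induction z with
  | zero => simp
  | add x y hx hy => simp only [mul_add, add_mul, map_add, hx, hy]
  | tmul x y =>
    have : ∀ i, F.ψ (χ a (χ x 1 * F.fst i)) * F.ψ (F.snd i * χ (y * c) 1) =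
        F.ψ (χ a (χ x 1 * (F.ψ (F.snd i * χ (y * c) 1) • F.fst i))) := by
      intro i
      rw [mul_smul_comm, map_smul, map_smul, smul_eq_mul, mul_comm]
    have h1 : ∀ i, χ (a * (t (.op (F.fst i)) * x)) 1 = χ a (χ x 1 * F.fst i) := by
      intro i
      rw [map_mul, Module.End.mul_apply, h.act_tgt_mul]
    have h2 : ∀ i, χ (s (F.snd i) * y * c) 1 = F.snd i * χ (y * c) 1 := by
      intro i
      rw [mul_assoc, h.act_src_mul]
    simp only [F.idem_eq, Finset.sum_mul, map_sum, Algebra.TensorProduct.tmul_mul_tmul,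
      TensorProduct.map_tmul, LinearMap.mul'_apply, LinearMap.comp_apply, LinearMap.mulLeft_apply,
      LinearMap.mulRight_apply, actCounit_apply, h1, h2, this]
    rw [← map_sum, ← map_sum, ← Finset.mul_sum, F.sum_psi_snd, contractLeft_tmul, mul_assoc,
      map_mul χ a, Module.End.mul_apply, mul_assoc, h.act_src_mul]

theorem counit_mul_right_idem (a c : A) (z : A ⊗[K] A) :
    LinearMap.mul' K K (TensorProduct.map (actCounit F χ ∘ₗ LinearMap.mulRight K c)
      (actCounit F χ ∘ₗ LinearMap.mulLeft K a) (F.idem s t * z)) =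
      actCounit F χ (a * contractRight t χ z * c) := by
  induction z with
  | zero => simp
  | add x y hx hy => simp only [mul_add, add_mul, map_add, hx, hy]
  | tmul x y =>
    have : ∀ i, F.ψ (χ (x * c) 1 * F.fst i) * F.ψ (χ a (F.snd i * χ y 1)) =
        F.ψ (χ a ((F.ψ (χ (x * c) 1 * F.fst i) • F.snd i) * χ y 1)) := by
      intro i
      rw [smul_mul_assoc, map_smul, map_smul, smul_eq_mul]
    have h1 : ∀ i, χ (a * (s (F.snd i) * y)) 1 = χ a (F.snd i * χ y 1) := by
      intro i
      rw [map_mul, Module.End.mul_apply, h.act_src_mul]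
    have h2 : ∀ i, χ (t (.op (F.fst i)) * x * c) 1 = χ (x * c) 1 * F.fst i := by
      intro i
      rw [mul_assoc, h.act_tgt_mul]
    simp only [F.idem_eq, Finset.sum_mul, map_sum, Algebra.TensorProduct.tmul_mul_tmul,
      TensorProduct.map_tmul, LinearMap.mul'_apply, LinearMap.comp_apply, LinearMap.mulLeft_apply,
      LinearMap.mulRight_apply, actCounit_apply, h1, h2, this]
    rw [← map_sum, ← map_sum, ← Finset.sum_mul, F.sum_psi_fst, contractRight_tmul, mul_assoc,
      map_mul χ a, Module.End.mul_apply, mul_assoc, h.act_tgt_mul]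

/-- The weak bialgebra associated with a bialgebroid over a Frobenius-separable algebra. -/
@[reducible]
def weakBialgebra : WeakBialgebra K A where
  comul := Δ
  counit := actCounit F χ
  coassoc := LinearMap.ext h.coassoc
  rTensor_counit_comp_comul := by
    refine LinearMap.ext fun a => ?_
    rw [LinearMap.comp_apply, ← h.idem_mul_comul, h.rTensor_counit_idem_mul, h.counit_left]
    rfl
  lTensor_counit_comp_comul := by
    refine LinearMap.ext fun a => ?_
    rw [LinearMap.comp_apply, ← h.idem_mul_comul, h.lTensor_counit_idem_mul, h.counit_right]
    rfl
  comul_mul := h.comul_mul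
  comul_one_left := by
    rw [h.comul_one, h.lTensor_idem h.comul_src, h.assoc_idem_mul_idem]
  comul_one_right := by
    rw [h.comul_one, h.lTensor_idem h.comul_src]
  counit_mul_left a b c := by
    rw [← h.idem_mul_comul b, h.counit_mul_left_idem, h.counit_left]
  counit_mul_right a b c := by
    rw [← h.idem_mul_comul b, h.counit_mul_right_idem, h.counit_right]

end IsBialgebroid

/-- The structure of the weak bialgebra `A` comes from a bialgebroid over a Frobenius-separable
algebra. -/
structure IsFrobeniusWeakBialgebra [WeakBialgebra K A] (F : FrobeniusSystem K L)
    (s : L →ₐ[K] A) (t : Lᵐᵒᵖ →ₐ[K] A) (χ : A →ₐ[K] Module.End K L) : Prop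
    extends IsBialgebroid F s t (Coalgebra.comul (R := K) (A := A)) χ where
  counit_eq : Coalgebra.counit (R := K) (A := A) = actCounit F χ

/-- The element `κ` of `L` with `ψ(m κ) = ψ(l χ(a)(m))` for all `m`. -/
def kappa (F : FrobeniusSystem K L) (χ : A →ₐ[K] Module.End K L) (l : L) (a : A) : L :=
  ∑ i, F.ψ (l * χ a (F.snd i)) • F.fst i

theorem psi_mul_kappa (F : FrobeniusSystem K L) (χ : A →ₐ[K] Module.End K L) (l : L) (a : A)
    (m : L) : F.ψ (m * kappa F χ l a) = F.ψ (l * χ a m) :=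
  F.psi_eq_sum (F.ψ ∘ₗ LinearMap.mulLeft K l ∘ₗ χ a) m

theorem conv_assoc {C : Type*} [AddCommGroup C] [Module K C] [Coalgebra K C]
    (f g k : C →ₗ[K] A) : conv (conv f g) k = conv f (conv g k) :=
  congrArg WithConv.ofConv
    (mul_assoc (WithConv.toConv f) (WithConv.toConv g) (WithConv.toConv k))

theorem conv_apply {C : Type*} [AddCommGroup C] [Module K C] [Coalgebra K C]
    (f g : C →ₗ[K] A) (c : C) :
    conv f g c = LinearMap.mul' K A (TensorProduct.map f g (Coalgebra.comul c)) := rfl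

namespace IsFrobeniusWeakBialgebra

variable [WeakBialgebra K A] {F : FrobeniusSystem K L} {s : L →ₐ[K] A} {t : Lᵐᵒᵖ →ₐ[K] A}
  {χ : A →ₐ[K] Module.End K L} (h : IsFrobeniusWeakBialgebra F s t χ)
include h

theorem targetCounital_apply (a : A) : targetCounital K A a = s (χ a 1) := by
  change TensorProduct.lid K A ((Coalgebra.counit (R := K) (A := A)).rTensor A
    (Coalgebra.comul (R := K) (1 : A) * (a ⊗ₜ[K] 1))) = _
  rw [h.counit_eq, h.comul_one, h.rTensor_counit_idem_mul]
  simp [contractLeft_tmul]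

/-- With Δ(1) = E, the scalar ε(a s(e⁽²⁾)) is ψ(χ(a)(e⁽²⁾)). So ε_s evaluates the transpose of χ(a)
with respect to ψ at 1, whereas ε_t evaluates χ(a) itself at 1. -/
theorem sourceCounital_apply (a : A) : sourceCounital K A a = t (.op (kappa F χ 1 a)) := by
  change TensorProduct.rid K A ((Coalgebra.counit (R := K) (A := A)).lTensor A
    ((1 ⊗ₜ[K] a) * Coalgebra.comul (R := K) (1 : A))) = _
  rw [h.counit_eq, h.comul_one, F.idem_eq]
  simp only [Finset.mul_sum, map_sum, Algebra.TensorProduct.tmul_mul_tmul, one_mul,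
    LinearMap.lTensor_tmul, TensorProduct.rid_tmul, actCounit_apply, h.act_mul_src, mul_one, kappa,
    Finset.op_sum, MulOpposite.op_smul, map_smul]

theorem comul_src_mul (l : L) (a : A) : Coalgebra.comul (R := K) (s l * a) =
    (s l ⊗ₜ[K] 1) * Coalgebra.comul (R := K) a := by
  have h1 : F.idem s t * (s l ⊗ₜ[K] 1) = (s l ⊗ₜ[K] 1) * F.idem s t := by
    simp [F.idem_eq, Finset.sum_mul, Finset.mul_sum, (h.commute _ _).eq]
  rw [h.comul_mul, h.comul_src, h1, mul_assoc, h.idem_mul_comul]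

theorem comul_tgt_mul (l : Lᵐᵒᵖ) (a : A) : Coalgebra.comul (R := K) (t l * a) =
    (1 ⊗ₜ[K] t l) * Coalgebra.comul (R := K) a := by
  have h1 : F.idem s t * (1 ⊗ₜ[K] t l) = (1 ⊗ₜ[K] t l) * F.idem s t := by
    simp [F.idem_eq, Finset.sum_mul, Finset.mul_sum, (h.commute _ _).eq]
  rw [h.comul_mul, h.comul_tgt, h1, mul_assoc, h.idem_mul_comul]

theorem comul_mul_src (l : L) (a : A) : Coalgebra.comul (R := K) (a * s l) =
    Coalgebra.comul (R := K) a * (s l ⊗ₜ[K] 1) := by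
  rw [h.comul_mul, h.comul_src, ← mul_assoc, h.comul_mul_idem]

theorem kappa_src_mul (l m : L) (a : A) : kappa F χ m (s l * a) = kappa F χ (m * l) a :=
  F.ext_psi_left fun p => by
    rw [psi_mul_kappa, psi_mul_kappa, h.act_src_mul, mul_assoc]

/-- Combined with `kappa_src_mul` this says that ε_s does not distinguish left multiplication by
s(l) from left multiplication by t(θ(l)), the exchange used in `antipode_src_mul`. -/
theorem kappa_tgt_nakayama_mul (l : L) (a : A) :
    kappa F χ 1 (t (.op (F.nakayama l)) * a) = kappa F χ l a :=
  F.ext_psi_left fun p => by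
    rw [psi_mul_kappa, psi_mul_kappa, h.act_tgt_mul, one_mul, F.psi_mul_nakayama]

theorem kappa_mul_src (l : L) (a : A) :
    kappa F χ 1 (a * s l) = kappa F χ 1 a * F.nakayama l :=
  F.ext_psi_left fun p => by
    rw [psi_mul_kappa, ← mul_assoc, F.psi_mul_nakayama, ← mul_assoc, psi_mul_kappa, h.act_mul_src]

end IsFrobeniusWeakBialgebra

end Bialgebroid

/-! ### Antipodes of homomorphisms -/

section Antipode

variable {K L H B : Type*} [Field K] [Ring L] [Algebra K L] [Ring H] [Algebra K H] [Ring B]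
  [Algebra K B]

section Conv

variable {C : Type*} [AddCommGroup C] [Module K C] [Coalgebra K C]

theorem mulLeft_comp_conv (b : B) (φ ξ : C →ₗ[K] B) :
    LinearMap.mulLeft K b ∘ₗ conv φ ξ = conv (LinearMap.mulLeft K b ∘ₗ φ) ξ := by
  refine LinearMap.ext fun a => ?_
  simp only [LinearMap.comp_apply, conv_apply, LinearMap.mulLeft_apply]
  induction (Coalgebra.comul (R := K) a) with
  | zero => simp
  | add x y hx hy => simp only [map_add, mul_add, hx, hy]
  | tmul x y => simp [mul_assoc]

theorem mulRight_comp_conv (b : B) (φ ξ : C →ₗ[K] B) :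
    LinearMap.mulRight K b ∘ₗ conv φ ξ = conv φ (LinearMap.mulRight K b ∘ₗ ξ) := by
  refine LinearMap.ext fun a => ?_
  simp only [LinearMap.comp_apply, conv_apply, LinearMap.mulRight_apply]
  induction (Coalgebra.comul (R := K) a) with
  | zero => simp
  | add x y hx hy => simp only [map_add, add_mul, hx, hy]
  | tmul x y => simp [mul_assoc]

end Conv

namespace IsFrobeniusWeakBialgebra

variable [WeakBialgebra K H] {F : FrobeniusSystem K L} {s : L →ₐ[K] H} {t : Lᵐᵒᵖ →ₐ[K] H}
  {χ : H →ₐ[K] Module.End K L} (h : IsFrobeniusWeakBialgebra F s t χ)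
include h

theorem conv_comp_src_mul (l : L) (φ ξ : H →ₗ[K] B) :
    conv φ ξ ∘ₗ LinearMap.mulLeft K (s l) = conv (φ ∘ₗ LinearMap.mulLeft K (s l)) ξ := by
  refine LinearMap.ext fun a => ?_
  simp only [LinearMap.comp_apply, conv_apply, LinearMap.mulLeft_apply, h.comul_src_mul]
  induction (Coalgebra.comul (R := K) a) with
  | zero => simp
  | add x y hx hy => simp only [map_add, mul_add, hx, hy]
  | tmul x y => simp

theorem conv_comp_tgt_mul (l : Lᵐᵒᵖ) (φ ξ : H →ₗ[K] B) :
    conv φ ξ ∘ₗ LinearMap.mulLeft K (t l) = conv φ (ξ ∘ₗ LinearMap.mulLeft K (t l)) := by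
  refine LinearMap.ext fun a => ?_
  simp only [LinearMap.comp_apply, conv_apply, LinearMap.mulLeft_apply, h.comul_tgt_mul]
  induction (Coalgebra.comul (R := K) a) with
  | zero => simp
  | add x y hx hy => simp only [map_add, mul_add, hx, hy]
  | tmul x y => simp

theorem conv_comp_mul_src (l : L) (φ ξ : H →ₗ[K] B) :
    conv φ ξ ∘ₗ LinearMap.mulRight K (s l) = conv (φ ∘ₗ LinearMap.mulRight K (s l)) ξ := by
  refine LinearMap.ext fun a => ?_
  simp only [LinearMap.comp_apply, conv_apply, LinearMap.mulRight_apply, h.comul_mul_src]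
  induction (Coalgebra.comul (R := K) a) with
  | zero => simp
  | add x y hx hy => simp only [map_add, add_mul, hx, hy]
  | tmul x y => simp

variable {f : H →ₐ[K] B} {g : H →ₗ[K] B} (hg : IsAntipodeOf f g)
include hg

/-- From g ⋆ f ⋆ g = g it follows that f ∘ ε_t is a right unit for g and, in the companion lemma,
that f ∘ ε_s is a left unit. Rules for g on the base are inherited through these units from the
rules for ε_t and ε_s. -/
theorem conv_antipode_target : conv g (f.toLinearMap ∘ₗ targetCounital K H) = g := by
  rw [← hg.right_inv, ← conv_assoc, hg.self_mul_mul]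

theorem conv_source_antipode : conv (f.toLinearMap ∘ₗ sourceCounital K H) g = g := by
  rw [← hg.left_inv, hg.self_mul_mul]

/-- In g = g ⋆ (f ∘ ε_t) a left factor t(l) of the argument enters only the second leg, where
ε_t(t(l)b) = ε_t(b)s(l). -/
theorem antipode_tgt_mul (l : L) (a : H) : g (t (.op l) * a) = g a * f (s l) := by
  have h1 : (f.toLinearMap ∘ₗ targetCounital K H) ∘ₗ LinearMap.mulLeft K (t (.op l)) =
      LinearMap.mulRight K (f (s l)) ∘ₗ f.toLinearMap ∘ₗ targetCounital K H := by
    refine LinearMap.ext fun b => ?_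
    simp [h.targetCounital_apply, h.act_tgt_mul, ← map_mul]
  have h2 : g ∘ₗ LinearMap.mulLeft K (t (.op l)) = LinearMap.mulRight K (f (s l)) ∘ₗ g := by
    conv_lhs => rw [← h.conv_antipode_target hg, h.conv_comp_tgt_mul, h1, ← mulRight_comp_conv,
      h.conv_antipode_target hg]
  exact LinearMap.congr_fun h2 a

theorem antipode_mul_src (l : L) (a : H) : g (a * s l) = f (t (.op (F.nakayama l))) * g a := by
  have h1 : (f.toLinearMap ∘ₗ sourceCounital K H) ∘ₗ LinearMap.mulRight K (s l) =
      LinearMap.mulLeft K (f (t (.op (F.nakayama l)))) ∘ₗ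
        f.toLinearMap ∘ₗ sourceCounital K H := by
    refine LinearMap.ext fun b => ?_
    simp [h.sourceCounital_apply, h.kappa_mul_src]
  have h2 : g ∘ₗ LinearMap.mulRight K (s l) =
      LinearMap.mulLeft K (f (t (.op (F.nakayama l)))) ∘ₗ g := by
    conv_lhs => rw [← h.conv_source_antipode hg, h.conv_comp_mul_src, h1, ← mulLeft_comp_conv,
      h.conv_source_antipode hg]
  exact LinearMap.congr_fun h2 a

/-- This rule needs both units. In g = (f ∘ ε_s) ⋆ g the factor s(l) of the first leg may be
exchanged for t(θ(l)). Writing f ∘ ε_s as g ⋆ f moves that factor onto f, hence to the left of f ∘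
ε_t; it commutes with the values of the latter, which lie in f(s(L)), and comes out on the right. -/
theorem antipode_src_mul (l : L) (a : H) : g (s l * a) = g a * f (t (.op (F.nakayama l))) := by
  set b : B := f (t (.op (F.nakayama l))) with hb
  have h1 : (f.toLinearMap ∘ₗ sourceCounital K H) ∘ₗ LinearMap.mulLeft K (s l) =
      (f.toLinearMap ∘ₗ sourceCounital K H) ∘ₗ
        LinearMap.mulLeft K (t (.op (F.nakayama l))) := by
    refine LinearMap.ext fun b => ?_
    simp only [LinearMap.comp_apply, LinearMap.mulLeft_apply, h.sourceCounital_apply,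
      h.kappa_tgt_nakayama_mul, h.kappa_src_mul, one_mul]
  have h2 : f.toLinearMap ∘ₗ LinearMap.mulLeft K (t (.op (F.nakayama l))) =
      LinearMap.mulLeft K b ∘ₗ f.toLinearMap := by
    refine LinearMap.ext fun b => ?_
    simp [hb]
  have h3 : LinearMap.mulLeft K b ∘ₗ f.toLinearMap ∘ₗ targetCounital K H =
      LinearMap.mulRight K b ∘ₗ f.toLinearMap ∘ₗ targetCounital K H := by
    refine LinearMap.ext fun b => ?_
    simp [h.targetCounital_apply, hb, ← map_mul, (h.commute _ _).eq]
  have h4 : g ∘ₗ LinearMap.mulLeft K (s l) = LinearMap.mulRight K b ∘ₗ g := by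
    conv_lhs => rw [← h.conv_source_antipode hg, h.conv_comp_src_mul, h1, ← hg.left_inv,
      h.conv_comp_tgt_mul, h2, conv_assoc, ← mulLeft_comp_conv, hg.right_inv, h3,
      ← mulRight_comp_conv, h.conv_antipode_target hg]
  exact LinearMap.congr_fun h4 a

variable {ι : Type*} [Fintype ι] {u : ι → ι → H}
  (hu : ∀ i j, Coalgebra.comul (R := K) (u i j) = F.idem s t * ∑ k, u i k ⊗ₜ u k j)
include hu

/-- In g ⋆ f = f ∘ ε_s at u_{ij}, the idempotent contributes f(s(e⁽¹⁾))f(s(e⁽²⁾)) between g(u_{ik})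
and f(u_{kj}), and this sums to 1. When `kappa` is a multiple of the Kronecker delta, g(u) is a left
inverse of the matrix f(u). -/
theorem sum_antipode_mul_map (i j : ι) :
    ∑ k, g (u i k) * f (u k j) = f (t (.op (kappa F χ 1 (u i j)))) := by
  have h1 := LinearMap.congr_fun hg.left_inv (u i j)
  rw [LinearMap.comp_apply, h.sourceCounital_apply, conv_apply, hu, F.idem_eq,
    Finset.sum_mul_sum, Finset.sum_comm] at h1
  simp only [map_sum, Algebra.TensorProduct.tmul_mul_tmul, TensorProduct.map_tmul,
    LinearMap.mul'_apply, h.antipode_tgt_mul hg, AlgHom.toLinearMap_apply, map_mul] at h1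
  rw [← h1]
  refine Finset.sum_congr rfl fun k _ => ?_
  have h2 : ∀ i', g (u i k) * f (s (F.fst i')) * (f (s (F.snd i')) * f (u k j)) =
      g (u i k) * (f (s (F.fst i' * F.snd i')) * f (u k j)) := by
    intro i'
    simp only [map_mul, mul_assoc]
  simp only [h2, ← Finset.mul_sum, ← Finset.sum_mul, ← map_sum, F.sum_fst_mul_snd, map_one, one_mul]

/-- Here the idempotent surrounds p = ∑ f(u_{ik})g(u_{kj}) as f(t(e⁽¹⁾)) p f(t(θ(e⁽²⁾))). The
commutation hypothesis brings the two outer factors together, and θ(e⁽²⁾)e⁽¹⁾ = 1 removes them. -/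
theorem sum_map_mul_antipode (i j : ι)
    (hc : ∀ l, Commute (∑ k, f (u i k) * g (u k j)) (f (t l))) :
    ∑ k, f (u i k) * g (u k j) = f (s (χ (u i j) 1)) := by
  have h1 := LinearMap.congr_fun hg.right_inv (u i j)
  rw [LinearMap.comp_apply, h.targetCounital_apply, conv_apply, hu, F.idem_eq,
    Finset.sum_mul_sum] at h1
  simp only [map_sum, Algebra.TensorProduct.tmul_mul_tmul, TensorProduct.map_tmul,
    LinearMap.mul'_apply, h.antipode_src_mul hg, AlgHom.toLinearMap_apply, map_mul] at h1
  have h2 : ∀ i', ∑ k, f (t (.op (F.fst i'))) * f (u i k) *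
      (g (u k j) * f (t (.op (F.nakayama (F.snd i'))))) =
      f (t (.op (F.nakayama (F.snd i') * F.fst i'))) * ∑ k, f (u i k) * g (u k j) := by
    intro i'
    rw [MulOpposite.op_mul, map_mul, map_mul, mul_assoc, ← (hc _).eq, Finset.sum_mul,
      Finset.mul_sum]
    simp only [mul_assoc]
  simp only [h2] at h1
  rw [← Finset.sum_mul, ← map_sum, ← map_sum, ← Finset.op_sum, F.sum_nakayama_snd_mul_fst,
    MulOpposite.op_one, map_one, map_one, one_mul] at h1
  exact h1

end IsFrobeniusWeakBialgebra

end Antipode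

/-! ### The weak bialgebra `A_σ` -/

namespace FRTAlg

section Structure

variable {K R Λ X : Type*} [Field K] [Ring R] [Algebra K R] [Fintype X] [DecidableEq X]
  {deg : X → Equiv.Perm Λ} {σ : X → X → X → X → Λ → R}

theorem base_tmul (f g : Λ → R) :
    base K deg σ (f ⊗ₜ .op g) = src K deg σ f * tgt K deg σ (.op g) := by
  simp [src, tgt, ← map_mul]

-- Scalars need no case of their own, since they are values of s; the same holds for zero. Only sums
-- and products remain, so a property can be transported without assuming that it respects the unit.
@[elab_as_elim]
theorem induction {P : FRTAlg K deg σ → Prop} (src : ∀ f, P (src K deg σ f))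
    (tgt : ∀ f, P (tgt K deg σ f)) (L : ∀ a b, P (L K deg σ a b))
    (Linv : ∀ a b, P (Linv K deg σ a b)) (add : ∀ a b, P a → P b → P (a + b))
    (mul : ∀ a b, P a → P b → P (a * b)) (a : FRTAlg K deg σ) : P a := by
  obtain ⟨x, rfl⟩ : ∃ x, mk K deg σ x = a := RingQuot.mkAlgHom_surjective K (Rel K deg σ) a
  induction x using FreeAlgebra.induction with
  | grade0 r =>
    have h : mk K deg σ (algebraMap K _ r) = FRTAlg.src K deg σ (algebraMap K _ r) := by
      rw [AlgHom.commutes, AlgHom.commutes]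
    rw [h]
    exact src _
  | grade1 g =>
    cases g with
    | base ξ =>
      change P (base K deg σ ξ)
      induction ξ with
      | zero =>
        rw [map_zero, ← map_zero (FRTAlg.src K deg σ)]
        exact src 0
      | add x y hx hy => rw [map_add]; exact add _ _ hx hy
      | tmul f g =>
        induction g using MulOpposite.rec' with
        | h g => rw [base_tmul]; exact mul _ _ (src f) (tgt _)
    | L a b => exact L a b
    | Linv a b => exact Linv a b
  | mul a b ha hb => rw [map_mul]; exact mul _ _ ha hb
  | add a b ha hb => rw [map_add]; exact add _ _ ha hb

theorem deltaAct_src (f : Λ → R) : deltaAct K deg σ (src K deg σ f) =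
    takeuchiAct _ _ ⟨_, base_mem K deg σ (f ⊗ₜ 1)⟩ :=
  lift_mk K deg σ (.base (f ⊗ₜ 1))

theorem deltaAct_tgt (f : (Λ → R)ᵐᵒᵖ) : deltaAct K deg σ (tgt K deg σ f) =
    takeuchiAct _ _ ⟨_, base_mem K deg σ (1 ⊗ₜ f)⟩ :=
  lift_mk K deg σ (.base (1 ⊗ₜ f))

theorem deltaAct_L (a b : X) : deltaAct K deg σ (L K deg σ a b) =
    takeuchiAct _ _ ⟨_, L_mem K deg σ a b⟩ :=
  lift_mk K deg σ (.L a b)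

theorem deltaAct_Linv (a b : X) : deltaAct K deg σ (Linv K deg σ a b) =
    takeuchiAct _ _ ⟨_, Linv_mem K deg σ a b⟩ :=
  lift_mk K deg σ (.Linv a b)

/-- The hypothesis of `weakComul_mul_of_act`: every generator acts by left multiplication with an
element of `takeuchi`, and this property passes to sums and products. -/
theorem exists_deltaAct_eq (a : FRTAlg K deg σ) :
    ∃ x, deltaAct K deg σ a = takeuchiAct (src K deg σ) (tgt K deg σ) x := by
  induction a using induction with
  | src f => exact ⟨_, deltaAct_src f⟩
  | tgt f => exact ⟨_, deltaAct_tgt f⟩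
  | L a b => exact ⟨_, deltaAct_L a b⟩
  | Linv a b => exact ⟨_, deltaAct_Linv a b⟩
  | add a b ha hb =>
    obtain ⟨x, hx⟩ := ha
    obtain ⟨y, hy⟩ := hb
    exact ⟨x + y, by rw [map_add, map_add, hx, hy]⟩
  | mul a b ha hb =>
    obtain ⟨x, hx⟩ := ha
    obtain ⟨y, hy⟩ := hb
    exact ⟨x * y, by rw [map_mul, map_mul, hx, hy]⟩

theorem chi_src (hσ : IsFRTFamily deg σ) (f g : Λ → R) : chi K hσ (src K deg σ f) g = f * g := by
  have h : chi K hσ (src K deg σ f) = biMul K R Λ (f ⊗ₜ 1) := lift_mk K deg σ (.base (f ⊗ₜ 1))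
  rw [h, biMul_tmul]
  simp

theorem chi_tgt (hσ : IsFRTFamily deg σ) (f g : Λ → R) :
    chi K hσ (tgt K deg σ (.op f)) g = g * f := by
  have h : chi K hσ (tgt K deg σ (.op f)) = biMul K R Λ (1 ⊗ₜ .op f) :=
    lift_mk K deg σ (.base (1 ⊗ₜ .op f))
  rw [h, biMul_tmul]
  simp

theorem chi_L (hσ : IsFRTFamily deg σ) (a b : X) (g : Λ → R) :
    chi K hσ (L K deg σ a b) g = if a = b then g ∘ deg a else 0 := by
  have h : chi K hσ (L K deg σ a b) = if a = b then LinearMap.funLeft K R (deg a) else 0 :=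
    lift_mk K deg σ (.L a b)
  rw [h]
  split_ifs <;> rfl

theorem chi_Linv (hσ : IsFRTFamily deg σ) (a b : X) (g : Λ → R) :
    chi K hσ (Linv K deg σ a b) g = if a = b then g ∘ (deg a).symm else 0 := by
  have h : chi K hσ (Linv K deg σ a b) =
      if a = b then LinearMap.funLeft K R (deg a).symm else 0 :=
    lift_mk K deg σ (.Linv a b)
  rw [h]
  split_ifs <;> rfl

end Structure

section WeakBialgebra

variable {K R Λ X : Type*} [Field K] [Ring R] [Algebra K R] [Fintype Λ] [DecidableEq Λ]
  [Fintype X] [DecidableEq X] (F : FrobeniusSystem K R)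
  (deg : X → Equiv.Perm Λ) (σ : X → X → X → X → Λ → R)

theorem frtComul_of_act {a : FRTAlg K deg σ} {x : takeuchi (src K deg σ) (tgt K deg σ)}
    (h : deltaAct K deg σ a = takeuchiAct _ _ x) :
    frtComul F deg σ a = (F.pi Λ).idem (src K deg σ) (tgt K deg σ) * x.1 :=
  weakComul_of_act (F.pi Λ) (src K deg σ) (tgt K deg σ) (deltaAct K deg σ) h

theorem frtComul_mul (a b : FRTAlg K deg σ) :
    frtComul F deg σ (a * b) = frtComul F deg σ a * frtComul F deg σ b :=
  weakComul_mul_of_act (F.pi Λ) (src K deg σ) (tgt K deg σ) (deltaAct K deg σ)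
    exists_deltaAct_eq a b

theorem frtComul_src (f : Λ → R) : frtComul F deg σ (src K deg σ f) =
    (F.pi Λ).idem (src K deg σ) (tgt K deg σ) * (src K deg σ f ⊗ₜ 1) := by
  rw [frtComul_of_act F deg σ (deltaAct_src f)]
  simp

theorem frtComul_tgt (f : (Λ → R)ᵐᵒᵖ) : frtComul F deg σ (tgt K deg σ f) =
    (F.pi Λ).idem (src K deg σ) (tgt K deg σ) * (1 ⊗ₜ tgt K deg σ f) := by
  rw [frtComul_of_act F deg σ (deltaAct_tgt f)]
  simp

theorem frtComul_L (a b : X) : frtComul F deg σ (L K deg σ a b) =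
    (F.pi Λ).idem (src K deg σ) (tgt K deg σ) * ∑ c, L K deg σ a c ⊗ₜ L K deg σ c b :=
  frtComul_of_act F deg σ (deltaAct_L a b)

theorem frtComul_Linv (a b : X) : frtComul F deg σ (Linv K deg σ a b) =
    (F.pi Λ).idem (src K deg σ) (tgt K deg σ) * ∑ c, Linv K deg σ c b ⊗ₜ Linv K deg σ a c :=
  frtComul_of_act F deg σ (deltaAct_Linv a b)

variable {deg σ}

theorem isPreBialgebroid (hσ : IsFRTFamily deg σ) :
    IsPreBialgebroid (F.pi Λ) (src K deg σ) (tgt K deg σ) (frtComul F deg σ) (chi K hσ) where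
  commute := src_tgt_comm K deg σ
  comul_one := by
    have h := frtComul_src F deg σ 1
    rwa [map_one, ← Algebra.TensorProduct.one_def, mul_one] at h
  comul_mul := frtComul_mul F deg σ
  act_src := chi_src hσ
  act_tgt := chi_tgt hσ

theorem isBialgebroid (hσ : IsFRTFamily deg σ) :
    IsBialgebroid (F.pi Λ) (src K deg σ) (tgt K deg σ) (frtComul F deg σ) (chi K hσ) := by
  have h := isPreBialgebroid F hσ
  refine h.isBialgebroid (frtComul_src F deg σ) (frtComul_tgt F deg σ)
    (Set.range (fun p : X × X => L K deg σ p.1 p.2) ∪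
      Set.range (fun p : X × X => Linv K deg σ p.1 p.2)) ?_ ?_ ?_ ?_
  · intro P h1 h2 h3 h4 h5 a
    exact induction h1 h2 (fun a b => h3 _ (Or.inl ⟨(a, b), rfl⟩))
      (fun a b => h3 _ (Or.inr ⟨(a, b), rfl⟩)) h4 h5 a
  · rintro _ (⟨⟨a, b⟩, rfl⟩ | ⟨⟨a, b⟩, rfl⟩)
    · exact h.coassoc_matrix (frtComul_src F deg σ) (frtComul_tgt F deg σ) _
        (frtComul_L F deg σ) a b
    -- The coproduct of L⁻¹ reverses the order of the indices, so it is the transpose of L⁻¹ that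
    -- has a comatrix coproduct.
    · exact h.coassoc_matrix (frtComul_src F deg σ) (frtComul_tgt F deg σ)
        (fun i j => Linv K deg σ j i) (fun i j => frtComul_Linv F deg σ j i) b a
  · rintro _ (⟨⟨a, b⟩, rfl⟩ | ⟨⟨a, b⟩, rfl⟩)
    · dsimp only
      rw [frtComul_L, h.contractLeft_idem_mul, map_sum]
      simp [contractLeft_tmul, chi_L, apply_ite]
    · dsimp only
      rw [frtComul_Linv, h.contractLeft_idem_mul, map_sum]
      simp [contractLeft_tmul, chi_Linv, apply_ite]
  · rintro _ (⟨⟨a, b⟩, rfl⟩ | ⟨⟨a, b⟩, rfl⟩)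
    · dsimp only
      rw [frtComul_L, h.contractRight_idem_mul, map_sum]
      simp [contractRight_tmul, chi_L, apply_ite]
    · dsimp only
      rw [frtComul_Linv, h.contractRight_idem_mul, map_sum]
      simp [contractRight_tmul, chi_Linv, apply_ite]

end WeakBialgebra

end FRTAlg

/-! ### A criterion for weak Hopf algebras -/

section WeakHopf

variable {K L A : Type*} [Field K] [Ring L] [Algebra K L] [Ring A] [Algebra K A]

/-- The map `x ⊗ y ↦ S(x) b y`. -/
def sandwichLeft (S : A →ₗ[K] A) (b : A) : A ⊗[K] A →ₗ[K] A :=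
  LinearMap.mul' K A ∘ₗ TensorProduct.map S (LinearMap.mulLeft K b)

/-- The map `x ⊗ y ↦ x b S(y)`. -/
def sandwichRight (S : A →ₗ[K] A) (b : A) : A ⊗[K] A →ₗ[K] A :=
  LinearMap.mul' K A ∘ₗ TensorProduct.map (LinearMap.mulRight K b) S

theorem sandwichLeft_tmul (S : A →ₗ[K] A) (b x y : A) :
    sandwichLeft S b (x ⊗ₜ y) = S x * (b * y) := rfl

theorem sandwichRight_tmul (S : A →ₗ[K] A) (b x y : A) :
    sandwichRight S b (x ⊗ₜ y) = x * b * S y := rfl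

/-- For antimultiplicative S, the product S(px) b qy equals S(x)(S(p) b q)y, so sandwiches nest.
Allowing an arbitrary middle element b is what makes the antipode axioms amenable to induction over
products. -/
theorem sandwichLeft_mul {S : A →ₗ[K] A} (hS : ∀ a b, S (a * b) = S b * S a) (b : A)
    (z w : A ⊗[K] A) : sandwichLeft S b (z * w) = sandwichLeft S (sandwichLeft S b z) w := by
  induction w with
  | zero => simp
  | add x y hx hy => simp only [mul_add, map_add, hx, hy]
  | tmul x y =>
    induction z with
    | zero => simp [sandwichLeft_tmul]
    | add z w hz hw =>
      rw [add_mul, map_add, map_add, hz, hw]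
      simp only [sandwichLeft_tmul, mul_add, add_mul]
    | tmul p q => simp only [Algebra.TensorProduct.tmul_mul_tmul, sandwichLeft_tmul, hS, mul_assoc]

theorem sandwichRight_mul {S : A →ₗ[K] A} (hS : ∀ a b, S (a * b) = S b * S a) (b : A)
    (z w : A ⊗[K] A) : sandwichRight S b (z * w) = sandwichRight S (sandwichRight S b w) z := by
  induction z with
  | zero => simp
  | add x y hx hy => simp only [add_mul, map_add, hx, hy]
  | tmul x y =>
    induction w with
    | zero => simp [sandwichRight_tmul]
    | add z w hz hw =>
      rw [mul_add, map_add, map_add, hz, hw]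
      simp only [sandwichRight_tmul, mul_add, add_mul]
    | tmul p q =>
      simp only [Algebra.TensorProduct.tmul_mul_tmul, sandwichRight_tmul, hS, mul_assoc]

namespace IsFrobeniusWeakBialgebra

variable [WeakBialgebra K A] {F : FrobeniusSystem K L} {s : L →ₐ[K] A} {t : Lᵐᵒᵖ →ₐ[K] A}
  {χ : A →ₐ[K] Module.End K L} (h : IsFrobeniusWeakBialgebra F s t χ) {S : A →ₗ[K] A}
  (hS : ∀ a b, S (a * b) = S b * S a) (hSs : ∀ l, S (s l) = t (.op (F.nakayama l)))
  (hSt : ∀ l, S (t (.op l)) = s l)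
include h hS

-- S turns t(e⁽¹⁾) into s(e⁽¹⁾), which commutes past t(l) and meets s(e⁽²⁾). Plain separability is
-- enough on this side.
include hSt in
theorem sandwichLeft_idem_mul (l : L) (z : A ⊗[K] A) :
    sandwichLeft S (t (.op l)) (F.idem s t * z) = sandwichLeft S (t (.op l)) z := by
  have h1 : sandwichLeft S (t (.op l)) (F.idem s t) = t (.op l) := by
    have h2 : ∀ i, s (F.fst i) * (t (.op l) * s (F.snd i)) =
        s (F.fst i * F.snd i) * t (.op l) := by
      intro i
      rw [← (h.commute _ _).eq, map_mul, mul_assoc]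
    simp only [F.idem_eq, map_sum, sandwichLeft_tmul, hSt, h2]
    rw [← Finset.sum_mul, ← map_sum, F.sum_fst_mul_snd, map_one, one_mul]
  rw [sandwichLeft_mul hS, h1]

-- On this side S turns s(e⁽²⁾) into t(θ(e⁽²⁾)). The value s(m) commutes with the target factors, so
-- they can be collected into t(θ(e⁽²⁾)e⁽¹⁾), whose sum is 1.
include hSs in
theorem sandwichRight_idem_mul {b : A} {z : A ⊗[K] A} {m : L}
    (hz : sandwichRight S b z = s m) : sandwichRight S b (F.idem s t * z) = s m := by
  have h2 : ∀ i, t (.op (F.fst i)) * s m * t (.op (F.nakayama (F.snd i))) =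
      s m * t (.op (F.nakayama (F.snd i) * F.fst i)) := by
    intro i
    rw [← (h.commute _ _).eq, MulOpposite.op_mul, map_mul, mul_assoc]
  rw [sandwichRight_mul hS, hz]
  simp only [F.idem_eq, map_sum, sandwichRight_tmul, hSs, h2]
  rw [← Finset.mul_sum, ← map_sum, ← Finset.op_sum, F.sum_nakayama_snd_mul_fst, MulOpposite.op_one,
    map_one, mul_one]

/-- The case n = 1 of the hypotheses is the axiom S ⋆ id = ε_s. Nesting puts t(`kappa` n a) in the
middle for b; surjectivity of θ rewrites it as t(θ(m)), so that the hypothesis on b applies.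
Composition of transposes with respect to ψ does the rest. -/
theorem sandwichLeft_comul_mul {a b : A}
    (ha : ∀ n, sandwichLeft S (t (.op (F.nakayama n))) (Coalgebra.comul (R := K) a) =
      t (.op (kappa F χ n a)))
    (hb : ∀ n, sandwichLeft S (t (.op (F.nakayama n))) (Coalgebra.comul (R := K) b) =
      t (.op (kappa F χ n b))) (n : L) :
    sandwichLeft S (t (.op (F.nakayama n))) (Coalgebra.comul (R := K) (a * b)) =
      t (.op (kappa F χ n (a * b))) := by
  obtain ⟨m, hm⟩ := F.nakayama_surjective (kappa F χ n a)
  rw [h.comul_mul, sandwichLeft_mul hS, ha, ← hm, hb]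
  congr 2
  refine F.ext_psi_left fun p => ?_
  rw [psi_mul_kappa, psi_mul_kappa, ← F.psi_mul_nakayama, hm, psi_mul_kappa, map_mul χ,
    Module.End.mul_apply]

theorem sandwichRight_comul_mul {a b : A}
    (ha : ∀ n, sandwichRight S (s n) (Coalgebra.comul (R := K) a) = s (χ a n))
    (hb : ∀ n, sandwichRight S (s n) (Coalgebra.comul (R := K) b) = s (χ b n)) (n : L) :
    sandwichRight S (s n) (Coalgebra.comul (R := K) (a * b)) = s (χ (a * b) n) := by
  rw [h.comul_mul, sandwichRight_mul hS, hb, ha, map_mul χ, Module.End.mul_apply]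

include hSs hSt in
/-- An antimultiplicative map which satisfies the antipode axioms on generators is an antipode. -/
theorem isWeakHopfAntipode (T : Set A)
    (hT : ∀ P : A → Prop, (∀ l, P (s l)) → (∀ l, P (t l)) → (∀ a ∈ T, P a) →
      (∀ a b, P a → P b → P (a + b)) → (∀ a b, P a → P b → P (a * b)) → ∀ a, P a)
    (h1 : ∀ a ∈ T, ∀ n, sandwichLeft S (t (.op (F.nakayama n))) (Coalgebra.comul (R := K) a) =
      t (.op (kappa F χ n a)))
    (h2 : ∀ a ∈ T, ∀ n, sandwichRight S (s n) (Coalgebra.comul (R := K) a) = s (χ a n)) :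
    IsWeakHopfAntipode S := by
  have hS1 : S 1 = 1 := by rw [← map_one s, hSs, map_one, MulOpposite.op_one, map_one, map_one]
  have left : ∀ a n, sandwichLeft S (t (.op (F.nakayama n))) (Coalgebra.comul (R := K) a) =
      t (.op (kappa F χ n a)) := by
    refine hT _ (fun l n => ?_) (fun l n => ?_) h1 (fun a b ha hb n => ?_)
      (fun a b ha hb => h.sandwichLeft_comul_mul hS ha hb)
    · rw [h.comul_src, h.sandwichLeft_idem_mul hS hSt, sandwichLeft_tmul, hSs, mul_one, ← map_mul,
        ← MulOpposite.op_mul, ← map_mul]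
      congr 2
      refine F.ext_psi_left fun p => ?_
      rw [psi_mul_kappa, F.psi_mul_nakayama, h.act_src, mul_assoc]
    · induction l using MulOpposite.rec' with
      | h l =>
      rw [h.comul_tgt, h.sandwichLeft_idem_mul hS hSt, sandwichLeft_tmul, hS1, one_mul, ← map_mul,
        ← MulOpposite.op_mul]
      congr 2
      refine F.ext_psi_left fun p => ?_
      rw [psi_mul_kappa, ← mul_assoc, F.psi_mul_nakayama, h.act_tgt]
    · have hk : kappa F χ n (a + b) = kappa F χ n a + kappa F χ n b := by
        refine F.ext_psi_left fun p => ?_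
        rw [mul_add, map_add, psi_mul_kappa, psi_mul_kappa, psi_mul_kappa, map_add,
          LinearMap.add_apply, mul_add, map_add]
      rw [map_add, map_add, ha, hb, hk, MulOpposite.op_add, map_add]
  have right : ∀ a n, sandwichRight S (s n) (Coalgebra.comul (R := K) a) = s (χ a n) := by
    refine hT _ (fun l n => ?_) (fun l n => ?_) h2 (fun a b ha hb n => ?_)
      (fun a b ha hb => h.sandwichRight_comul_mul hS ha hb)
    · rw [h.comul_src]
      refine h.sandwichRight_idem_mul hS hSs ?_
      rw [sandwichRight_tmul, hS1, mul_one, ← map_mul, h.act_src]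
    · induction l using MulOpposite.rec' with
      | h l =>
      rw [h.comul_tgt]
      refine h.sandwichRight_idem_mul hS hSs ?_
      rw [sandwichRight_tmul, hSt, one_mul, ← map_mul, h.act_tgt]
    · rw [map_add, map_add, ha, hb, map_add, LinearMap.add_apply, map_add]
  have hid : conv LinearMap.id S = targetCounital K A := by
    refine LinearMap.ext fun a => ?_
    have h3 := right a 1
    rw [map_one] at h3
    rw [h.targetCounital_apply, ← h3, conv_apply, sandwichRight, LinearMap.mulRight_one]
    rfl
  refine ⟨LinearMap.ext fun a => ?_, hid, ?_⟩
  · have h3 := left a 1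
    rw [map_one, MulOpposite.op_one, map_one] at h3
    rw [h.sourceCounital_apply, ← h3, conv_apply, sandwichLeft, LinearMap.mulLeft_one]
    rfl
  -- The remaining axiom reads S ⋆ ε_t = S. Here S(x)s(χ(y)(1)) = S(t(χ(y)(1))x), and the elements
  -- inside S sum to a by the right counit axiom.
  · rw [conv_assoc, hid]
    refine LinearMap.ext fun a => ?_
    conv_rhs => rw [← h.counit_right a]
    rw [conv_apply]
    induction (Coalgebra.comul (R := K) a) with
    | zero => simp
    | add x y hx hy => simp only [map_add, hx, hy]
    | tmul x y =>
      rw [TensorProduct.map_tmul, LinearMap.mul'_apply, h.targetCounital_apply, contractRight_tmul,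
        hS, hSt]

end IsFrobeniusWeakBialgebra

end WeakHopf

/-! ### Homomorphisms out of `A_σ` and its antipode -/

/-! ### Permutation invariance of the Frobenius system on M_Λ(R) -/

section Pi

variable {K R Λ : Type*} [Field K] [Ring R] [Algebra K R] [Fintype Λ] [DecidableEq Λ]
  (F : FrobeniusSystem K R)

theorem FrobeniusSystem.pi_psi_apply (f : Λ → R) : (F.pi Λ).ψ f = ∑ v, F.ψ (f v) := by
  simp [FrobeniusSystem.pi]

theorem FrobeniusSystem.pi_psi_comp (f : Λ → R) (α : Equiv.Perm Λ) :
    (F.pi Λ).ψ (f ∘ α) = (F.pi Λ).ψ f := by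
  rw [pi_psi_apply, pi_psi_apply]
  exact Equiv.sum_comp α fun v => F.ψ (f v)

/-- The functional ψ on M_Λ(R) sums over Λ, so it is invariant under permutations, and the transpose
of a translation is the inverse translation. -/
theorem FrobeniusSystem.pi_psi_mul_comp (f g : Λ → R) (α : Equiv.Perm Λ) :
    (F.pi Λ).ψ (f * (g ∘ α)) = (F.pi Λ).ψ ((f ∘ α.symm) * g) := by
  rw [← F.pi_psi_comp ((f ∘ α.symm) * g) α]
  congr 1
  ext v
  simp

theorem FrobeniusSystem.pi_psi_comp_mul (f g : Λ → R) (α : Equiv.Perm Λ) :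
    (F.pi Λ).ψ ((f ∘ α) * g) = (F.pi Λ).ψ (f * (g ∘ α.symm)) := by
  rw [← F.pi_psi_comp (f * _) α]
  congr 1
  ext v
  simp

theorem FrobeniusSystem.pi_nakayama_comp (f : Λ → R) (α : Equiv.Perm Λ) :
    (F.pi Λ).nakayama (f ∘ α) = (F.pi Λ).nakayama f ∘ α := by
  refine (F.pi Λ).ext_psi_left fun m => ?_
  rw [psi_mul_nakayama, F.pi_psi_comp_mul, F.pi_psi_mul_comp m, psi_mul_nakayama]

theorem FrobeniusSystem.pi_nakayama_central {f : Λ → R} (hf : ∀ v, f v ∈ Subring.center R) :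
    (F.pi Λ).nakayama f = f :=
  FrobeniusSystem.nakayama_central _ (Subring.mem_center_iff.2 fun g =>
    funext fun v => Subring.mem_center_iff.1 (hf v) (g v))

end Pi

/-- Applied to matrices, with u = L: an intertwining relation for L becomes one for its inverse. -/
theorem inv_mul_eq_mul_inv {M : Type*} [Monoid M] {u v x y : M} (huv : u * v = 1) (hvu : v * u = 1)
    (h : x * u = u * y) : v * x = y * v :=
  calc v * x = v * (x * u) * v := by rw [mul_assoc, mul_assoc, huv, mul_one]
    _ = y * v := by rw [h, ← mul_assoc, hvu, one_mul]

namespace FRTAlg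

variable {K R Λ X : Type*} [Field K] [Ring R] [Algebra K R] [Fintype X] [DecidableEq X]
  {deg : X → Equiv.Perm Λ} {σ : X → X → X → X → Λ → R}

/-- The relations for `L⁻¹` follow from those for `L`. -/
theorem exists_lift {B : Type*} [Ring B] [Algebra K B] (s' : (Λ → R) →ₐ[K] B)
    (t' : (Λ → R)ᵐᵒᵖ →ₐ[K] B) (hst : ∀ f g, Commute (s' f) (t' g)) (l li : X → X → B)
    (h1 : ∀ a b, ∑ c, l a c * li c b = if a = b then 1 else 0)
    (h2 : ∀ a b, ∑ c, li a c * l c b = if a = b then 1 else 0)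
    (h3 : ∀ f a b, s' (f ∘ deg a) * l a b = l a b * s' f)
    (h4 : ∀ f a b, t' (.op (f ∘ deg b)) * l a b = l a b * t' (.op f))
    (h5 : ∀ a b c d, ∑ x, ∑ y, s' (σ x y a c) * l y d * l x b =
      ∑ x, ∑ y, t' (.op (σ b d x y)) * l c y * l a x) :
    ∃ G : FRTAlg K deg σ →ₐ[K] B, (∀ f, G (src K deg σ f) = s' f) ∧
      (∀ f, G (tgt K deg σ f) = t' f) ∧ (∀ a b, G (L K deg σ a b) = l a b) ∧
      ∀ a b, G (Linv K deg σ a b) = li a b := by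
  have hm1 : Matrix.of l * Matrix.of li = 1 := by
    ext a b; rw [Matrix.mul_apply, Matrix.one_apply]; exact h1 a b
  have hm2 : Matrix.of li * Matrix.of l = 1 := by
    ext a b; rw [Matrix.mul_apply, Matrix.one_apply]; exact h2 a b
  have h6 : ∀ f a b, s' f * li a b = li a b * s' (f ∘ deg b) := by
    intro f a b
    have h : Matrix.diagonal (fun a => s' (f ∘ deg a)) * Matrix.of l =
        Matrix.of l * Matrix.diagonal (fun _ => s' f) := by
      ext a b; simpa using h3 f a b
    have h' := inv_mul_eq_mul_inv hm1 hm2 h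
    simpa using (congrFun (congrFun h' a) b).symm
  have h7 : ∀ f a b, t' (.op f) * li a b = li a b * t' (.op (f ∘ deg a)) := by
    intro f a b
    -- The target rule shifts by the column index of L. Keeping the row index a fixed, a constant
    -- diagonal on the left forces the column-dependent diagonal on the right, and its entry at a is
    -- t'(f).
    have h : Matrix.diagonal (fun _ => t' (.op (f ∘ deg a))) * Matrix.of l =
        Matrix.of l * Matrix.diagonal (fun b => t' (.op ((f ∘ deg a) ∘ (deg b).symm))) := by
      ext c d
      have := h4 ((f ∘ deg a) ∘ (deg d).symm) c d
      rw [Function.comp_assoc _ (deg d).symm, Equiv.symm_comp_self, Function.comp_id] at this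
      simpa using this
    have h' := inv_mul_eq_mul_inv hm1 hm2 h
    simpa [Function.comp_assoc] using (congrFun (congrFun h' a) b).symm
  have hb : ∀ f g, Algebra.TensorProduct.lift s' t' hst (f ⊗ₜ g) = s' f * t' g :=
    fun f g => Algebra.TensorProduct.lift_tmul _ _ _ _ _
  refine ⟨lift K deg σ (Algebra.TensorProduct.lift s' t' hst) l li h1 h2 ?_ ?_ ?_ ?_ ?_,
    fun f => ?_, fun f => ?_, fun a b => ?_, fun a b => ?_⟩
  · intro f a b; simpa [hb] using h3 f a b
  · intro f a b; simpa [hb] using h4 f a b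
  · intro f a b; simpa [hb] using h6 f a b
  · intro f a b; simpa [hb] using h7 f a b
  · intro a b c d; simpa [hb] using h5 a b c d
  · exact (lift_mk K deg σ (.base (f ⊗ₜ 1))).trans (by simp [hb])
  · exact (lift_mk K deg σ (.base (1 ⊗ₜ f))).trans (by simp [hb])
  · exact lift_mk K deg σ (.L a b)
  · exact lift_mk K deg σ (.Linv a b)

/-- The support condition makes the composite permutation fix every point where σ is nonzero. At any
other point both sides vanish, since the two double translates agree at the moved point only if they
agree at the original one. -/
theorem sigma_comp (hσ : IsFRTFamily deg σ) (a b c d : X) :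
    (((σ b d a c ∘ (deg c).symm) ∘ (deg a).symm) ∘ deg b) ∘ deg d = σ b d a c := by
  ext v
  simp only [Function.comp_apply]
  by_cases hv : deg b (deg d v) = deg a (deg c v)
  · simp [hv]
  · rw [hσ.invariant a b c d v hv]
    refine hσ.invariant a b c d _ fun h => hv ?_
    have h2 : (deg c).symm ((deg a).symm (deg b (deg d v))) = v :=
      (deg d).injective ((deg b).injective (h.trans (by simp)))
    simpa using congrArg (fun u => deg a (deg c u)) h2

/-- The relation of Yang–Baxter type for `L⁻¹`. -/
theorem yangBaxter_inv (hσ : IsFRTFamily deg σ) (a b c d : X) :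
    ∑ x, ∑ y, Linv K deg σ x b * (Linv K deg σ y d * tgt K deg σ (.op (σ x y a c))) =
      ∑ x, ∑ y, Linv K deg σ a x * (Linv K deg σ c y * src K deg σ (σ b d x y)) := by
  -- Over the index set X × X the relation for L reads PM = MT, once the target factors have been
  -- pushed through the two L's; this introduces the inverse translations in T. Since W is the
  -- inverse of M, conjugation gives WP = TW. Moving the target factors back through L⁻¹ composes σ
  -- with further translations, which `sigma_comp` cancels.
  let P : Matrix (X × X) (X × X) (FRTAlg K deg σ) :=
    .of fun i j => src K deg σ (σ j.1 j.2 i.1 i.2)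
  let M : Matrix (X × X) (X × X) (FRTAlg K deg σ) :=
    .of fun i j => L K deg σ i.2 j.2 * L K deg σ i.1 j.1
  let W : Matrix (X × X) (X × X) (FRTAlg K deg σ) :=
    .of fun i j => Linv K deg σ i.1 j.1 * Linv K deg σ i.2 j.2
  let T : Matrix (X × X) (X × X) (FRTAlg K deg σ) :=
    .of fun i j => tgt K deg σ (.op ((σ j.1 j.2 i.1 i.2 ∘ (deg i.2).symm) ∘ (deg i.1).symm))
  have hMW : M * W = 1 := by
    ext ⟨x, y⟩ ⟨b, d⟩
    rw [Matrix.mul_apply, Fintype.sum_prod_type, Finset.sum_comm, Matrix.one_apply]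
    have h : ∀ p q, M (x, y) (p, q) * W (p, q) (b, d) =
        L K deg σ y q * ((L K deg σ x p * Linv K deg σ p b) * Linv K deg σ q d) := by
      intro p q; simp only [M, W, Matrix.of_apply, mul_assoc]
    simp only [h, ← Finset.mul_sum, ← Finset.sum_mul, sum_L_Linv]
    by_cases h1 : x = b <;> simp [h1, sum_L_Linv]
  have hWM : W * M = 1 := by
    ext ⟨x, y⟩ ⟨b, d⟩
    rw [Matrix.mul_apply, Fintype.sum_prod_type, Matrix.one_apply]
    have h : ∀ p q, W (x, y) (p, q) * M (p, q) (b, d) =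
        Linv K deg σ x p * ((Linv K deg σ y q * L K deg σ q d) * L K deg σ p b) := by
      intro p q; simp only [M, W, Matrix.of_apply, mul_assoc]
    simp only [h, ← Finset.mul_sum, ← Finset.sum_mul, sum_Linv_L]
    by_cases h1 : y = d <;> simp [h1, sum_Linv_L]
  have hPM : P * M = M * T := by
    ext ⟨a, c⟩ ⟨b, d⟩
    have h := yangBaxter K deg σ a b c d
    rw [Matrix.mul_apply, Matrix.mul_apply, Fintype.sum_prod_type, Fintype.sum_prod_type]
    simp only [P, M, T, Matrix.of_apply, ← mul_assoc]
    rw [h]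
    refine Finset.sum_congr rfl fun x _ => Finset.sum_congr rfl fun y _ => ?_
    have hx : ∀ (f : Λ → R) (x : X), (f ∘ (deg x).symm) ∘ deg x = f := by
      intro f x; ext; simp
    rw [mul_assoc, mul_assoc, L_tgt, hx, ← mul_assoc, ← mul_assoc, L_tgt, hx]
  have hWP := inv_mul_eq_mul_inv hMW hWM hPM
  have h := congrFun (congrFun hWP (a, c)) (b, d)
  rw [Matrix.mul_apply, Matrix.mul_apply, Fintype.sum_prod_type, Fintype.sum_prod_type] at h
  simp only [P, W, T, Matrix.of_apply, mul_assoc] at h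
  rw [h]
  refine Finset.sum_congr rfl fun x _ => Finset.sum_congr rfl fun y _ => ?_
  rw [← mul_assoc (tgt K deg σ _), tgt_Linv, mul_assoc, tgt_Linv, sigma_comp hσ]

end FRTAlg

/-! ### The antipode of A_σ for rigid σ -/

namespace FRTAlg

section WeakHopf

variable {K R Λ X : Type*} [Field K] [Ring R] [Algebra K R] [Fintype Λ] [DecidableEq Λ]
  [Fintype X] [DecidableEq X] {F : FrobeniusSystem K R}
  {deg : X → Equiv.Perm Λ} {σ : X → X → X → X → Λ → R}

/-- S is an algebra homomorphism into the opposite algebra, produced by `exists_lift`. In the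
opposite algebra the two equations for x say exactly that the matrix x is inverse to L⁻¹, and the
quadratic relation is `yangBaxter_inv`, where θ fixes σ because its values are central. -/
theorem exists_antipode_map (F : FrobeniusSystem K R) (hσ : IsFRTFamily deg σ)
    (x : X → X → FRTAlg K deg σ)
    (hx1 : ∀ a b, ∑ c, Linv K deg σ c b * x a c = if a = b then 1 else 0)
    (hx2 : ∀ a b, ∑ c, x c b * Linv K deg σ a c = if a = b then 1 else 0) :
    ∃ S : FRTAlg K deg σ →ₗ[K] FRTAlg K deg σ, (∀ a b, S (a * b) = S b * S a) ∧
      (∀ f, S (src K deg σ f) = tgt K deg σ (.op ((F.pi Λ).nakayama f))) ∧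
      (∀ f, S (tgt K deg σ (.op f)) = src K deg σ f) ∧
      (∀ a b, S (L K deg σ a b) = Linv K deg σ a b) ∧ ∀ a b, S (Linv K deg σ a b) = x a b := by
  let s' : (Λ → R) →ₐ[K] (FRTAlg K deg σ)ᵐᵒᵖ := (AlgHom.op (tgt K deg σ)).comp
    ((AlgEquiv.opOp K (Λ → R)).toAlgHom.comp (F.pi Λ).nakayama)
  let t' : (Λ → R)ᵐᵒᵖ →ₐ[K] (FRTAlg K deg σ)ᵐᵒᵖ := AlgHom.op (src K deg σ)
  have hs' : ∀ f, s' f = .op (tgt K deg σ (.op ((F.pi Λ).nakayama f))) := fun _ => rfl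
  have ht' : ∀ f, t' (.op f) = .op (src K deg σ f) := fun _ => rfl
  obtain ⟨G, h1, h2, h3, h4⟩ := exists_lift (deg := deg) (σ := σ) s' t'
    (by
      intro f g
      induction g using MulOpposite.rec' with
      | h g =>
      rw [hs', ht']
      exact (src_tgt_comm K deg σ _ _).op.symm)
    (fun a b => .op (Linv K deg σ a b)) (fun a b => .op (x a b))
    (by
      intro a b
      have h := congrArg MulOpposite.op (hx2 a b)
      rw [Finset.op_sum] at h
      simpa [apply_ite MulOpposite.op] using h)
    (by
      intro a b
      have h := congrArg MulOpposite.op (hx1 a b)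
      rw [Finset.op_sum] at h
      simpa [apply_ite MulOpposite.op] using h)
    (by
      intro f a b
      rw [hs', hs', ← MulOpposite.op_mul, ← MulOpposite.op_mul, F.pi_nakayama_comp, tgt_Linv])
    (by
      intro f a b
      rw [ht', ht', ← MulOpposite.op_mul, ← MulOpposite.op_mul, src_Linv])
    (by
      intro a b c d
      have h := congrArg MulOpposite.op (yangBaxter_inv (K := K) hσ a b c d)
      simp only [Finset.op_sum, MulOpposite.op_mul] at h
      simp only [hs', ht', F.pi_nakayama_central (hσ.central _ _ _ _)]
      exact h)
  refine ⟨(MulOpposite.opLinearEquiv K).symm.toLinearMap ∘ₗ G.toLinearMap, fun a b => ?_,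
    fun f => ?_, fun f => ?_, fun a b => ?_, fun a b => ?_⟩
  · simp
  · simp [h1, hs']
  · simp [h2, ht']
  · simp [h3]
  · simp [h4]

/-- The transpose of a translation is the inverse translation, and θ commutes with translations. -/
theorem kappa_L (hσ : IsFRTFamily deg σ) (n : Λ → R) (a b : X) :
    kappa (F.pi Λ) (chi K hσ) n (L K deg σ a b) =
      if a = b then (F.pi Λ).nakayama n ∘ (deg a).symm else 0 := by
  refine (F.pi Λ).ext_psi_left fun p => ?_
  rw [psi_mul_kappa, chi_L]
  split_ifs
  · rw [F.pi_psi_mul_comp, ← F.pi_nakayama_comp, FrobeniusSystem.psi_mul_nakayama]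
  · rw [mul_zero, mul_zero]

theorem kappa_Linv (hσ : IsFRTFamily deg σ) (n : Λ → R) (a b : X) :
    kappa (F.pi Λ) (chi K hσ) n (Linv K deg σ a b) =
      if a = b then (F.pi Λ).nakayama n ∘ deg a else 0 := by
  refine (F.pi Λ).ext_psi_left fun p => ?_
  rw [psi_mul_kappa, chi_Linv]
  split_ifs
  · rw [F.pi_psi_mul_comp, ← F.pi_nakayama_comp, FrobeniusSystem.psi_mul_nakayama, Equiv.symm_symm]
  · rw [mul_zero, mul_zero]

theorem tgt_L (f : Λ → R) (a b : X) : tgt K deg σ (.op f) * L K deg σ a b =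
    L K deg σ a b * tgt K deg σ (.op (f ∘ (deg b).symm)) := by
  rw [L_tgt, Function.comp_assoc, Equiv.symm_comp_self, Function.comp_id]

theorem Linv_src (f : Λ → R) (a b : X) : Linv K deg σ a b * src K deg σ f =
    src K deg σ (f ∘ (deg b).symm) * Linv K deg σ a b := by
  rw [src_Linv, Function.comp_assoc, Equiv.symm_comp_self, Function.comp_id]

theorem exists_isWeakHopfAntipode [WeakBialgebra K (FRTAlg K deg σ)] {hσ : IsFRTFamily deg σ}
    (h : IsFrobeniusWeakBialgebra (F.pi Λ) (src K deg σ) (tgt K deg σ) (chi K hσ))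
    (hΔ : Coalgebra.comul (R := K) (A := FRTAlg K deg σ) = frtComul F deg σ)
    (hrigid : IsRigid K deg σ) :
    ∃ S : FRTAlg K deg σ →ₗ[K] FRTAlg K deg σ, IsWeakHopfAntipode S := by
  obtain ⟨x, y, hxy⟩ := hrigid
  obtain ⟨S, hS, hs, ht, hL, hLi⟩ := exists_antipode_map F hσ x (fun a b => (hxy a b).1)
    (fun a b => (hxy a b).2.1)
  refine ⟨S, h.isWeakHopfAntipode hS hs ht (Set.range (fun p : X × X => L K deg σ p.1 p.2) ∪
      Set.range (fun p : X × X => Linv K deg σ p.1 p.2)) ?_ ?_ ?_⟩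
  · intro P h1 h2 h3 h4 h5 a
    exact induction h1 h2 (fun a b => h3 _ (Or.inl ⟨(a, b), rfl⟩))
      (fun a b => h3 _ (Or.inr ⟨(a, b), rfl⟩)) h4 h5 a
  · rintro _ (⟨⟨a, b⟩, rfl⟩ | ⟨⟨a, b⟩, rfl⟩) n
    · dsimp only
      -- After E is discarded, the middle factor t is moved to the right of L, and L⁻¹L = 1 leaves
      -- it translated by the inverse of the degree, as `kappa_L` demands. The other three cases
      -- have the same pattern; those for L⁻¹ use the rigidity equations in place of the inverse
      -- relations.
      rw [hΔ, frtComul_L, h.sandwichLeft_idem_mul hS ht, map_sum, kappa_L]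
      simp only [sandwichLeft_tmul, hL, tgt_L, ← mul_assoc]
      rw [← Finset.sum_mul, sum_Linv_L]
      split_ifs with hab
      · rw [one_mul, hab]
      · rw [zero_mul, MulOpposite.op_zero, map_zero]
    · dsimp only
      rw [hΔ, frtComul_Linv, h.sandwichLeft_idem_mul hS ht, map_sum, kappa_Linv]
      simp only [sandwichLeft_tmul, hLi, tgt_Linv, ← mul_assoc]
      rw [← Finset.sum_mul, (hxy a b).2.1]
      split_ifs with hab
      · rw [one_mul]
      · rw [zero_mul, MulOpposite.op_zero, map_zero]
  · rintro _ (⟨⟨a, b⟩, rfl⟩ | ⟨⟨a, b⟩, rfl⟩) n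
    · dsimp only
      rw [hΔ, frtComul_L]
      refine h.sandwichRight_idem_mul hS hs ?_
      rw [map_sum, chi_L]
      simp only [sandwichRight_tmul, hL, L_src, mul_assoc]
      rw [← Finset.mul_sum, sum_L_Linv]
      split_ifs with hab
      · rw [mul_one]
      · rw [mul_zero, map_zero]
    · dsimp only
      rw [hΔ, frtComul_Linv]
      refine h.sandwichRight_idem_mul hS hs ?_
      rw [map_sum, chi_Linv]
      simp only [sandwichRight_tmul, hLi, Linv_src, mul_assoc]
      rw [← Finset.mul_sum, (hxy a b).1]
      split_ifs with hab
      · rw [mul_one, hab]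
      · rw [mul_zero, map_zero]

end WeakHopf

end FRTAlg

/-! ### The weak bialgebra `𝔄(w_σ)` -/

namespace FaceAlg

section Generators

variable {K R Λ Q : Type*} [Field K] [Ring R] [Algebra K R] [Fintype Λ]
  [DecidableEq Λ] [Fintype Q] {s t : Q → Λ} {w : Q → Q → Q → Q → R}

theorem vertex_mul_E (x : Sym s t) (u v : Λ) : E K s t w (Sym.vertex u v) * E K s t w x =
    if u = x.top.src then if v = x.bot.src then E K s t w x else 0 else 0 := by
  rw [E, E, ← map_mul, GAlg.vertex_mul K u v x, ← ite_and]
  split_ifs <;> simp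

theorem src_mul_E (x : Sym s t) (f : Λ → R) : src K s t w f * E K s t w x =
    left K s t w (f x.top.src) * E K s t w x := by
  simp only [src_apply, Finset.sum_mul, mul_assoc, vertex_mul_E]
  simp [Finset.sum_ite_irrel, mul_ite]

theorem tgt_mul_E (x : Sym s t) (f : Λ → R) : tgt K s t w (.op f) * E K s t w x =
    right K s t w (.op (f x.bot.src)) * E K s t w x := by
  simp only [tgt_apply, Finset.sum_mul, mul_assoc, vertex_mul_E]
  simp [mul_ite]

theorem src_tgt_comm (f : Λ → R) (g : (Λ → R)ᵐᵒᵖ) :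
    Commute (src K s t w f) (tgt K s t w g) := by
  induction g using MulOpposite.rec' with
  | h g =>
  rw [src_apply, tgt_apply]
  refine Commute.sum_left _ _ _ fun u _ => Commute.sum_left _ _ _ fun v _ =>
    Commute.sum_right _ _ _ fun u' _ => Commute.sum_right _ _ _ fun v' _ => ?_
  refine Commute.mul_left ((left_right K s t w _ _).mul_right (left_E K s t w _ _))
    ((right_E K s t w _ _).symm.mul_right ?_)
  rw [Commute, SemiconjBy, vertex_mul_vertex, vertex_mul_vertex]
  by_cases h : u = v' ∧ v = u'
  · rw [if_pos h, if_pos ⟨h.1.symm, h.2.symm⟩, h.1, h.2]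
  · rw [if_neg h, if_neg fun h' => h ⟨h'.1.symm, h'.2.symm⟩]

/-- The product of the row sum and the column sum of vertex idempotents picks out their common term,
so vertex symbols lie in the subalgebra generated by s and t. -/
theorem vertex_eq (u v : Λ) : E K s t w (Sym.vertex u v) =
    src K s t w (Pi.single u 1) * tgt K s t w (.op (Pi.single v 1)) := by
  rw [src_single, Finset.sum_mul, Finset.sum_eq_single v]
  · rw [E_tgt]
    change _ = right K s t w (.op ((Pi.single v 1 : Λ → R) v)) * _
    simp
  · intro b _ hb
    rw [E_tgt]
    change right K s t w (.op ((Pi.single v 1 : Λ → R) b)) * _ = 0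
    rw [Pi.single_eq_of_ne hb]
    simp
  · simp

theorem E_cons (a b : Q) (l l' : List Q) (hl : IsPathFrom s t (t a) l)
    (hl' : IsPathFrom s t (t b) l') (h : l.length = l'.length) :
    E K s t w ⟨⟨s a, a :: l, rfl, hl⟩, ⟨s b, b :: l', rfl, hl'⟩, congrArg Nat.succ h⟩ =
      E K s t w (Sym.arrow a b) * E K s t w ⟨⟨t a, l, hl⟩, ⟨t b, l', hl'⟩, h⟩ := by
  rw [E_mul_E K s t w (x := Sym.arrow a b) (y := ⟨⟨t a, l, hl⟩, ⟨t b, l', hl'⟩, h⟩) ⟨rfl, rfl⟩]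
  rfl

/-- A symbol e[p; q] of positive length factors into arrow symbols, vertex symbols come from s and
t, and the coefficients r and r' are s and t of constant functions. Scalars are again values of s.
-/
theorem induction_arrow {P : FaceAlg K s t w → Prop} (src : ∀ f, P (src K s t w f))
    (tgt : ∀ f, P (tgt K s t w f)) (arrow : ∀ a b, P (E K s t w (Sym.arrow a b)))
    (add : ∀ a b, P a → P b → P (a + b)) (mul : ∀ a b, P a → P b → P (a * b))
    (a : FaceAlg K s t w) : P a := by
  have hE : ∀ (l l' : List Q) (u v : Λ) (hl : IsPathFrom s t u l) (hl' : IsPathFrom s t v l')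
      (h : l.length = l'.length), P (E K s t w ⟨⟨u, l, hl⟩, ⟨v, l', hl'⟩, h⟩) := by
    intro l
    induction l with
    | nil =>
      intro l' u v hl hl' h
      obtain rfl : l' = [] := List.length_eq_zero_iff.1 h.symm
      have := vertex_eq (K := K) (s := s) (t := t) (w := w) u v
      rw [show E K s t w ⟨⟨u, [], hl⟩, ⟨v, [], hl'⟩, h⟩ = E K s t w (Sym.vertex u v) from rfl, this]
      exact mul _ _ (src _) (tgt _)
    | cons a l ih =>
      intro l' u v hl hl' h
      cases l' with
      | nil => simp at h
      | cons b l' =>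
        obtain ⟨rfl, hl⟩ := hl
        obtain ⟨rfl, hl'⟩ := hl'
        have h' : l.length = l'.length := by simpa using h
        have := E_cons (K := K) (w := w) a b l l' hl hl' h'
        rw [this]
        exact mul _ _ (arrow a b) (ih _ _ _ _ _ _)
  have hzero : P 0 := by
    rw [← map_zero (FaceAlg.src K s t w)]
    exact src 0
  obtain ⟨x, rfl⟩ : ∃ x, mk K s t w x = a := RingQuot.mkAlgHom_surjective K (FaceRel K s t w) a
  have key : ∀ (z : R ⊗[K] Rᵐᵒᵖ) (g : GAlg K s t),
      P (mk K s t w (z ⊗ₜ[K] g : (R ⊗[K] Rᵐᵒᵖ) ⊗[K] GAlg K s t)) := by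
    intro z g
    induction z with
    | zero => rw [zero_tmul]; exact (map_zero (mk K s t w)).symm ▸ hzero
    | add z z' hz hz' =>
      rw [add_tmul]
      exact (map_add (mk K s t w) (z ⊗ₜ[K] g : (R ⊗[K] Rᵐᵒᵖ) ⊗[K] GAlg K s t) _).symm ▸
        add _ _ hz hz'
    | tmul r r' =>
      change P (mk K s t w (HAlg.tmul K r r' g))
      rw [mk_tmul]
      refine mul _ _ (mul _ _ ?_ ?_) ?_
      · rw [← src_const]; exact src _
      · induction r' using MulOpposite.rec' with
        | h r' => rw [← tgt_const]; exact tgt _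
      · induction g using GAlg.induction_e with
        | zero => rw [map_zero]; exact hzero
        | add a b ha hb => rw [map_add]; exact add _ _ ha hb
        | smul r x =>
          rw [map_smul, Algebra.smul_def, ← AlgHom.commutes (FaceAlg.src K s t w)]
          exact mul _ _ (src _) (hE _ _ _ _ _ _ _)
  induction x using TensorProduct.induction_on with
  | zero => exact (map_zero (mk K s t w)).symm ▸ hzero
  | add x y hx hy => exact (map_add (mk K s t w) x y).symm ▸ add _ _ hx hy
  | tmul z g => exact key z g

end Generators

end FaceAlg

/-! ### The coproduct action of 𝔄(w) through `takeuchi` -/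

namespace FaceAlg

section Act

variable {K R Λ Q : Type*} [Field K] [Ring R] [Algebra K R] [Fintype Λ]
  [DecidableEq Λ] [Fintype Q] {s t : Q → Λ} {w : Q → Q → Q → Q → R}

theorem mk_tmul_e (r : R) (r' : Rᵐᵒᵖ) (x : Sym s t) :
    mk K s t w (HAlg.tmul K r r' (GAlg.e K x)) =
      left K s t w r * right K s t w r' * E K s t w x :=
  mk_tmul K s t w r r' _

theorem left_mul_E (r : R) (x : Sym s t) : left K s t w r * E K s t w x =
    mk K s t w (HAlg.tmul K r 1 (GAlg.e K x)) := by
  rw [mk_tmul_e, map_one, mul_one]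

theorem right_mul_E (r : Rᵐᵒᵖ) (x : Sym s t) : right K s t w r * E K s t w x =
    mk K s t w (HAlg.tmul K 1 r (GAlg.e K x)) := by
  rw [mk_tmul_e, map_one, one_mul]

theorem E_eq_mk (x : Sym s t) : E K s t w x = mk K s t w (HAlg.tmul K 1 1 (GAlg.e K x)) := by
  rw [mk_tmul_e, map_one, map_one, one_mul, one_mul]

theorem exists_deltaAct_mk (r : R) (r' : Rᵐᵒᵖ) (x : Sym s t) :
    ∃ y, deltaAct K s t w (mk K s t w (HAlg.tmul K r r' (GAlg.e K x))) =
      takeuchiAct (src K s t w) (tgt K s t w) y := by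
  have h : deltaAct K s t w (mk K s t w (HAlg.tmul K r r' (GAlg.e K x))) =
      takeuchiAct _ _ (leftT K s t w r) * takeuchiAct _ _ (rightT K s t w r') *
        nablaG K s t w (GAlg.e K x) := lift_mk K s t w r r' _
  rw [nablaG, GAlg.lift_e, ← map_mul, ← map_mul] at h
  exact ⟨_, h⟩

theorem exists_deltaAct_eq (a : FaceAlg K s t w) :
    ∃ x, deltaAct K s t w a = takeuchiAct (src K s t w) (tgt K s t w) x := by
  -- The image of `takeuchiAct` is a subalgebra, which reduces the claim to elements of the form r ⊗
  -- r' ⊗ e[p; q].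
  suffices h : deltaAct K s t w a ∈ (takeuchiAct (src K s t w) (tgt K s t w)).range by
    obtain ⟨x, hx⟩ := h
    exact ⟨x, hx.symm⟩
  have hmk : ∀ r r' x, deltaAct K s t w (mk K s t w (HAlg.tmul K r r' (GAlg.e K x))) ∈
      (takeuchiAct (src K s t w) (tgt K s t w)).range := by
    intro r r' x
    obtain ⟨y, hy⟩ := exists_deltaAct_mk (K := K) (w := w) r r' x
    exact ⟨y, hy.symm⟩
  induction a using induction_arrow with
  | src f =>
    rw [src_apply]
    simp only [left_mul_E, map_sum]
    exact sum_mem fun u _ => sum_mem fun v _ => hmk _ _ _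
  | tgt f =>
    induction f using MulOpposite.rec' with
    | h f =>
    rw [tgt_apply]
    simp only [right_mul_E, map_sum]
    exact sum_mem fun u _ => sum_mem fun v _ => hmk _ _ _
  | arrow a b => rw [E_eq_mk]; exact hmk _ _ _
  | add a b ha hb => rw [map_add]; exact add_mem ha hb
  | mul a b ha hb => rw [map_mul]; exact mul_mem ha hb

theorem nabla_vertex (u v : Λ) : nabla K s t w (Sym.vertex u v) =
    ∑ z : Λ, E K s t w (Sym.vertex u z) ⊗ₜ[K] E K s t w (Sym.vertex z v) := by
  rw [nabla]
  symm
  refine Fintype.sum_bijective (fun z : Λ => (⟨QPath.nil z, rfl⟩ :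
    QPath.OfLength s t (Sym.vertex (s := s) (t := t) u v).top.length)) ⟨?_, ?_⟩ _ _ ?_
  · intro z z' hz
    exact congrArg (fun q => q.1.src) hz
  · rintro ⟨⟨z, l, hl⟩, h⟩
    refine ⟨z, ?_⟩
    obtain rfl : l = [] := List.length_eq_zero_iff.1 h
    rfl
  · intro z; rfl

end Act

end FaceAlg

/-! ### The matrix `ell` in 𝔄(w_σ) and its relations -/

namespace FaceSigma

variable {K R Λ X : Type*} [Field K] [Ring R] [Algebra K R] [Fintype Λ] [DecidableEq Λ]
  [Fintype X] [DecidableEq X]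

section Relations

variable (K) (deg : X → Equiv.Perm Λ) (σ : X → X → X → X → Λ → R)

/-- The source map of `𝔄(w_σ)`. -/
abbrev src : (Λ → R) →ₐ[K] FaceSigma K deg σ := FaceAlg.src K (qs Λ X) (qt deg) (wSigma σ)

/-- The target map of `𝔄(w_σ)`. -/
abbrev tgt : (Λ → R)ᵐᵒᵖ →ₐ[K] FaceSigma K deg σ := FaceAlg.tgt K (qs Λ X) (qt deg) (wSigma σ)

/-- The class of `e[a; b]` for arrows `a`, `b`. -/
abbrev arrow (a b : Λ × X) : FaceSigma K deg σ :=
  FaceAlg.E K (qs Λ X) (qt deg) (wSigma σ) (Sym.arrow a b)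

/-- The element `∑ e[(u, a); (v, b)]` of `𝔄(w_σ)`, which `Φ` maps to `L_{ab}`. -/
def ell (a b : X) : FaceSigma K deg σ := ∑ u : Λ, ∑ v : Λ, arrow K deg σ (u, a) (v, b)

variable {K deg σ}

theorem sum_src_single : ∑ u : Λ, src K deg σ (Pi.single u 1) = 1 := by
  rw [← map_sum]
  exact (congrArg _ (Finset.univ_sum_single (1 : Λ → R))).trans (map_one _)

theorem sum_tgt_single : ∑ u : Λ, tgt K deg σ (.op (Pi.single u 1)) = 1 := by
  rw [← map_sum, ← Finset.op_sum]
  exact (congrArg (fun z => tgt K deg σ (.op z)) (Finset.univ_sum_single (1 : Λ → R))).trans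
    (map_one (tgt K deg σ))

theorem ell_src (f : Λ → R) (a b : X) :
    ell K deg σ a b * src K deg σ f = src K deg σ (f ∘ deg a) * ell K deg σ a b := by
  simp only [ell, Finset.sum_mul, Finset.mul_sum]
  refine Finset.sum_congr rfl fun u _ => Finset.sum_congr rfl fun v _ => ?_
  rw [FaceAlg.E_src, FaceAlg.src_mul_E]
  rfl

theorem ell_tgt (f : Λ → R) (a b : X) :
    ell K deg σ a b * tgt K deg σ (.op f) = tgt K deg σ (.op (f ∘ deg b)) * ell K deg σ a b := by
  simp only [ell, Finset.sum_mul, Finset.mul_sum]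
  refine Finset.sum_congr rfl fun u _ => Finset.sum_congr rfl fun v _ => ?_
  rw [FaceAlg.E_tgt, FaceAlg.tgt_mul_E]
  rfl

theorem sum_arrow_top (a b : X) (v : Λ) : ∑ u : Λ, arrow K deg σ (u, a) (v, b) =
    tgt K deg σ (.op (Pi.single v 1)) * ell K deg σ a b := by
  simp only [ell, Finset.mul_sum]
  refine Finset.sum_congr rfl fun u _ => ?_
  have h : ∀ v', tgt K deg σ (.op (Pi.single v 1)) * arrow K deg σ (u, a) (v', b) =
      if v' = v then arrow K deg σ (u, a) (v, b) else 0 := by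
    intro v'
    rw [FaceAlg.tgt_mul_E]
    change FaceAlg.right K _ _ _ (.op ((Pi.single v 1 : Λ → R) v')) * _ = _
    split_ifs with h
    · rw [h, Pi.single_eq_same, MulOpposite.op_one, map_one, one_mul]
    · rw [Pi.single_eq_of_ne h, MulOpposite.op_zero, map_zero, zero_mul]
  simp only [h]
  simp

theorem sum_arrow_bot (a b : X) (u : Λ) : ∑ v : Λ, arrow K deg σ (u, a) (v, b) =
    src K deg σ (Pi.single u 1) * ell K deg σ a b := by
  rw [ell, Finset.sum_comm]
  simp only [Finset.mul_sum]
  refine Finset.sum_congr rfl fun v _ => ?_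
  have h : ∀ u', src K deg σ (Pi.single u 1) * arrow K deg σ (u', a) (v, b) =
      if u' = u then arrow K deg σ (u, a) (v, b) else 0 := by
    intro u'
    rw [FaceAlg.src_mul_E]
    change FaceAlg.left K _ _ _ ((Pi.single u 1 : Λ → R) u') * _ = _
    split_ifs with h
    · rw [h, Pi.single_eq_same, map_one, one_mul]
    · rw [Pi.single_eq_of_ne h, map_zero, zero_mul]
  simp only [h]
  simp

/-- Source and target idempotents at the starting vertices cut a single arrow symbol out of `ell`.
Hence `ell` and the base generate 𝔄(w_σ). -/
theorem arrow_eq (u v : Λ) (a b : X) : arrow K deg σ (u, a) (v, b) =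
    src K deg σ (Pi.single u 1) * tgt K deg σ (.op (Pi.single v 1)) * ell K deg σ a b := by
  rw [mul_assoc, ← sum_arrow_top, Finset.mul_sum]
  have h : ∀ u', src K deg σ (Pi.single u 1) * arrow K deg σ (u', a) (v, b) =
      if u' = u then arrow K deg σ (u, a) (v, b) else 0 := by
    intro u'
    rw [FaceAlg.src_mul_E]
    change FaceAlg.left K _ _ _ ((Pi.single u 1 : Λ → R) u') * _ = _
    split_ifs with h
    · rw [h, Pi.single_eq_same, map_one, one_mul]
    · rw [Pi.single_eq_of_ne h, map_zero, zero_mul]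
  simp only [h]
  simp

/-- Composability on the top and on the bottom leaves one pair of starting vertices in the double
sum. -/
theorem arrow_mul_ell (u v : Λ) (a b c d : X) :
    arrow K deg σ (u, a) (v, c) * ell K deg σ b d =
      arrow K deg σ (u, a) (v, c) * arrow K deg σ (deg a u, b) (deg c v, d) := by
  rw [ell, Finset.mul_sum, Finset.sum_eq_single (deg a u), Finset.mul_sum,
    Finset.sum_eq_single (deg c v)]
  · intro v' _ hv'
    exact FaceAlg.arrow_mul_arrow_bot K _ _ _ (fun h => hv' h.symm) _ _
  · simp
  · intro u' _ hu'
    rw [Finset.mul_sum]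
    exact Finset.sum_eq_zero fun v' _ =>
      FaceAlg.arrow_mul_arrow_top K _ _ _ (fun h => hu' h.symm) _ _
  · simp

theorem arrow_mul_arrow (u v : Λ) (a b c d : X) :
    arrow K deg σ (u, a) (v, c) * arrow K deg σ (deg a u, b) (deg c v, d) =
      src K deg σ (Pi.single u 1) * tgt K deg σ (.op (Pi.single v 1)) *
        (ell K deg σ a c * ell K deg σ b d) := by
  rw [← arrow_mul_ell, arrow_eq, mul_assoc]

/-- The component at vertices u, v of one side of the quadratic relation for `ell` is one side of
the face relation for the paths through (u, c), (deg c u, a) and (v, d), (deg d v, b). The next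
lemma treats the other side. -/
theorem single_mul_left_sum (u v : Λ) (a b c d : X) :
    ∑ xy ∈ composablePairs (qs Λ X) (qt deg),
      FaceAlg.left K _ _ _ (wSigma σ xy.1 xy.2 (u, c) (deg c u, a)) *
        (arrow K deg σ xy.1 (v, d) * arrow K deg σ xy.2 (deg d v, b)) =
      src K deg σ (Pi.single u 1) * tgt K deg σ (.op (Pi.single v 1)) *
        ∑ x, ∑ y, src K deg σ (σ x y a c) * ell K deg σ y d * ell K deg σ x b := by
  rw [Phi.sum_composablePairs, Finset.sum_eq_single u]
  · rw [Finset.sum_comm, Finset.mul_sum]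
    refine Finset.sum_congr rfl fun x _ => ?_
    rw [Finset.mul_sum]
    refine Finset.sum_congr rfl fun y _ => ?_
    rw [arrow_mul_arrow, wSigma, if_pos rfl, ← FaceAlg.src_const]
    simp only [← mul_assoc]
    rw [← map_mul, Phi.const_mul_single, mul_assoc (src K deg σ (Pi.single u 1)),
      ← (FaceAlg.src_tgt_comm _ _).eq, ← mul_assoc, ← map_mul, Phi.single_mul]
  · intro u' _ hu'
    refine Finset.sum_eq_zero fun x _ => Finset.sum_eq_zero fun y _ => ?_
    rw [wSigma, if_neg hu', map_zero, zero_mul]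
  · simp

theorem single_mul_right_sum (u v : Λ) (a b c d : X) :
    ∑ xy ∈ composablePairs (qs Λ X) (qt deg),
      FaceAlg.right K _ _ _ (.op (wSigma σ (v, d) (deg d v, b) xy.1 xy.2)) *
        (arrow K deg σ (u, c) xy.1 * arrow K deg σ (deg c u, a) xy.2) =
      src K deg σ (Pi.single u 1) * tgt K deg σ (.op (Pi.single v 1)) *
        ∑ x, ∑ y, tgt K deg σ (.op (σ b d x y)) * ell K deg σ c y * ell K deg σ a x := by
  rw [Phi.sum_composablePairs, Finset.sum_eq_single v]
  · rw [Finset.sum_comm, Finset.mul_sum]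
    refine Finset.sum_congr rfl fun x _ => ?_
    rw [Finset.mul_sum]
    refine Finset.sum_congr rfl fun y _ => ?_
    rw [arrow_mul_arrow, wSigma, if_pos rfl, ← FaceAlg.tgt_const]
    simp only [← mul_assoc]
    have hc : Pi.single v 1 * (fun _ => σ b d x y v) = σ b d x y * Pi.single v 1 := by
      rw [Phi.single_mul_const, Phi.mul_single]
    rw [← (FaceAlg.src_tgt_comm _ _).eq,
      mul_assoc (src K deg σ (Pi.single u 1)) _ (tgt K deg σ (.op (Pi.single v 1))),
      mul_assoc (src K deg σ (Pi.single u 1)) _ (tgt K deg σ (.op (σ b d x y))),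
      ← map_mul, ← map_mul, ← MulOpposite.op_mul, ← MulOpposite.op_mul, hc]
  · intro u' _ hu'
    refine Finset.sum_eq_zero fun x _ => Finset.sum_eq_zero fun y _ => ?_
    rw [wSigma, if_neg (Ne.symm hu'), MulOpposite.op_zero, map_zero, zero_mul]
  · simp

/-- The face relations give the identity after multiplication by each idempotent s(δ_u)t(δ_v), and
these idempotents sum to 1. -/
theorem yangBaxter (a b c d : X) :
    ∑ x, ∑ y, src K deg σ (σ x y a c) * ell K deg σ y d * ell K deg σ x b =
      ∑ x, ∑ y, tgt K deg σ (.op (σ b d x y)) * ell K deg σ c y * ell K deg σ a x := by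
  have h : ∀ u v, src K deg σ (Pi.single u 1) * tgt K deg σ (.op (Pi.single v 1)) *
      (∑ x, ∑ y, src K deg σ (σ x y a c) * ell K deg σ y d * ell K deg σ x b) =
      src K deg σ (Pi.single u 1) * tgt K deg σ (.op (Pi.single v 1)) *
      ∑ x, ∑ y, tgt K deg σ (.op (σ b d x y)) * ell K deg σ c y * ell K deg σ a x := by
    intro u v
    rw [← single_mul_left_sum, ← single_mul_right_sum]
    exact FaceAlg.face_rel K (qs Λ X) (qt deg) (wSigma σ) (u, c) (deg c u, a) (v, d) (deg d v, b)
      rfl rfl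
  have h1 : ∀ z : FaceSigma K deg σ, z = ∑ u, ∑ v, src K deg σ (Pi.single u 1) *
      tgt K deg σ (.op (Pi.single v 1)) * z := by
    intro z
    simp only [← Finset.sum_mul, ← Finset.mul_sum, sum_src_single, sum_tgt_single, one_mul]
  rw [h1 (∑ x, ∑ y, src K deg σ (σ x y a c) * ell K deg σ y d * ell K deg σ x b)]
  simp only [h]
  exact (h1 _).symm

-- By `arrow_eq` the arrow symbols are products of base elements and entries of `ell`. This is why
-- homomorphisms out of 𝔄(w_σ) can be compared with homomorphisms out of A_σ.
@[elab_as_elim]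
theorem induction {P : FaceSigma K deg σ → Prop} (src : ∀ f, P (src K deg σ f))
    (tgt : ∀ f, P (tgt K deg σ f)) (ell : ∀ a b, P (ell K deg σ a b))
    (add : ∀ a b, P a → P b → P (a + b)) (mul : ∀ a b, P a → P b → P (a * b))
    (a : FaceSigma K deg σ) : P a := by
  refine FaceAlg.induction_arrow src tgt (fun a b => ?_) add mul a
  have h := arrow_eq (K := K) (deg := deg) (σ := σ) a.1 b.1 a.2 b.2
  rw [show FaceAlg.E K (qs Λ X) (qt deg) (wSigma σ) (Sym.arrow a b) =
    arrow K deg σ (a.1, a.2) (b.1, b.2) from rfl, h]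
  exact mul _ _ (mul _ _ (src _) (tgt _)) (ell _ _)

end Relations

end FaceSigma

/-! ### The weak bialgebra structure on 𝔄(w_σ) -/

namespace FaceSigma

section WeakBialgebra

variable {K R Λ X : Type*} [Field K] [Ring R] [Algebra K R] [Fintype Λ] [DecidableEq Λ]
  [Fintype X] [DecidableEq X] (F : FrobeniusSystem K R)
  (deg : X → Equiv.Perm Λ) (σ : X → X → X → X → Λ → R)

/-- Behind E the factor t(δ_z) crosses to the second leg as s(δ_z), merges with the idempotent
already there, and the sum over z is 1. Thus requiring both legs to pass through a common middle
vertex costs nothing once E is present. -/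
theorem idem_mul_sum_single (x y : FaceSigma K deg σ) :
    (F.pi Λ).idem (src K deg σ) (tgt K deg σ) *
      ∑ z : Λ, (tgt K deg σ (.op (Pi.single z 1)) * x) ⊗ₜ[K] (src K deg σ (Pi.single z 1) * y) =
    (F.pi Λ).idem (src K deg σ) (tgt K deg σ) * (x ⊗ₜ y) := by
  rw [Finset.mul_sum]
  have h : ∀ z : Λ, (F.pi Λ).idem (src K deg σ) (tgt K deg σ) *
      ((tgt K deg σ (.op (Pi.single z 1)) * x) ⊗ₜ[K] (src K deg σ (Pi.single z 1) * y)) =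
      (F.pi Λ).idem (src K deg σ) (tgt K deg σ) * (x ⊗ₜ (src K deg σ (Pi.single z 1) * y)) := by
    intro z
    rw [FrobeniusSystem.idem_mul_tgt_mul, ← mul_assoc, ← map_mul, ← Pi.single_mul, one_mul]
  simp only [h]
  rw [← Finset.mul_sum, ← TensorProduct.tmul_sum, ← Finset.sum_mul, sum_src_single, one_mul]

theorem faceComul_of_act {a : FaceSigma K deg σ} {x : takeuchi (src K deg σ) (tgt K deg σ)}
    (h : FaceAlg.deltaAct K _ _ _ a = takeuchiAct _ _ x) :
    faceComul F deg σ a = (F.pi Λ).idem (src K deg σ) (tgt K deg σ) * x.1 :=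
  weakComul_of_act (F.pi Λ) (src K deg σ) (tgt K deg σ) (FaceAlg.deltaAct K _ _ _) h

theorem faceComul_mul (a b : FaceSigma K deg σ) :
    faceComul F deg σ (a * b) = faceComul F deg σ a * faceComul F deg σ b :=
  weakComul_mul_of_act (F.pi Λ) (src K deg σ) (tgt K deg σ) (FaceAlg.deltaAct K _ _ _)
    FaceAlg.exists_deltaAct_eq a b

theorem faceComul_mk (r : R) (r' : Rᵐᵒᵖ) (x : Sym (qs Λ X) (qt deg)) :
    faceComul F deg σ (FaceAlg.mk K _ _ _ (HAlg.tmul K r r' (GAlg.e K x))) =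
      (F.pi Λ).idem (src K deg σ) (tgt K deg σ) *
        ((FaceAlg.left K _ _ _ r ⊗ₜ FaceAlg.right K _ _ _ r') * FaceAlg.nabla K _ _ _ x) := by
  have h : FaceAlg.deltaAct K (qs Λ X) (qt deg) (wSigma σ)
      (FaceAlg.mk K _ _ _ (HAlg.tmul K r r' (GAlg.e K x))) =
      takeuchiAct _ _ (FaceAlg.leftT K _ _ _ r) * takeuchiAct _ _ (FaceAlg.rightT K _ _ _ r') *
        FaceAlg.nablaG K _ _ _ (GAlg.e K x) := FaceAlg.lift_mk K _ _ _ r r' _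
  rw [FaceAlg.nablaG, GAlg.lift_e, ← map_mul, ← map_mul] at h
  rw [faceComul_of_act F deg σ h]
  simp [FaceAlg.coe_leftT, FaceAlg.coe_rightT]

theorem faceComul_vertex (r : R) (r' : Rᵐᵒᵖ) (u v : Λ) :
    faceComul F deg σ (FaceAlg.mk K _ _ _ (HAlg.tmul K r r' (GAlg.e K (Sym.vertex u v)))) =
      (F.pi Λ).idem (src K deg σ) (tgt K deg σ) *
        ((FaceAlg.left K _ _ _ r * src K deg σ (Pi.single u 1)) ⊗ₜ
          (FaceAlg.right K _ _ _ r' * tgt K deg σ (.op (Pi.single v 1)))) := by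
  rw [faceComul_mk, FaceAlg.nabla_vertex, Finset.mul_sum, ← idem_mul_sum_single]
  congr 1
  refine Finset.sum_congr rfl fun z _ => ?_
  induction r' using MulOpposite.rec' with
  | h r' =>
  rw [Algebra.TensorProduct.tmul_mul_tmul, FaceAlg.vertex_eq, FaceAlg.vertex_eq,
    ← FaceAlg.src_const, ← FaceAlg.tgt_const, ← mul_assoc, ← mul_assoc, ← map_mul, ← map_mul,
    (FaceAlg.src_tgt_comm _ _).eq]
  congr 1
  rw [← (FaceAlg.src_tgt_comm _ _).eq, mul_assoc, ← map_mul]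

theorem faceComul_src (f : Λ → R) : faceComul F deg σ (src K deg σ f) =
    (F.pi Λ).idem (src K deg σ) (tgt K deg σ) * (src K deg σ f ⊗ₜ 1) := by
  have h : ∀ u, FaceAlg.left K _ _ _ (f u) * src K deg σ (Pi.single u 1) =
      src K deg σ (Pi.single u (f u)) := by
    intro u
    rw [← FaceAlg.src_const, ← map_mul, Phi.const_mul_single]
  conv_lhs => rw [src, FaceAlg.src_apply]
  simp only [FaceAlg.left_mul_E, map_sum, faceComul_vertex, h, map_one, one_mul]
  simp only [← Finset.mul_sum, ← TensorProduct.tmul_sum, ← TensorProduct.sum_tmul, sum_tgt_single]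
  rw [← map_sum, Finset.univ_sum_single]

theorem faceComul_tgt (f : (Λ → R)ᵐᵒᵖ) : faceComul F deg σ (tgt K deg σ f) =
    (F.pi Λ).idem (src K deg σ) (tgt K deg σ) * (1 ⊗ₜ tgt K deg σ f) := by
  induction f using MulOpposite.rec' with
  | h f =>
  have h : ∀ u, FaceAlg.right K _ _ _ (.op (f u)) * tgt K deg σ (.op (Pi.single u 1)) =
      tgt K deg σ (.op (Pi.single u (f u))) := by
    intro u
    rw [← FaceAlg.tgt_const, ← map_mul, ← MulOpposite.op_mul, Phi.single_mul_const]
  conv_lhs => rw [tgt, FaceAlg.tgt_apply]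
  simp only [FaceAlg.right_mul_E, map_sum, faceComul_vertex, h, map_one, one_mul]
  simp only [← Finset.mul_sum, ← TensorProduct.tmul_sum, ← TensorProduct.sum_tmul, sum_src_single]
  rw [← map_sum, ← Finset.op_sum, Finset.univ_sum_single]

theorem faceComul_arrow (a b : Λ × X) : faceComul F deg σ (arrow K deg σ a b) =
    (F.pi Λ).idem (src K deg σ) (tgt K deg σ) *
      ∑ c, arrow K deg σ a c ⊗ₜ arrow K deg σ c b := by
  rw [arrow, FaceAlg.E_eq_mk, faceComul_mk, map_one, map_one, ← Algebra.TensorProduct.one_def,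
    one_mul, FaceAlg.nabla_arrow]

/-- The coproduct of arrow symbols runs over middle arrows (z, c), whose vertex z is shared by the
legs, while in ell_{ac} ⊗ ell_{cb} the two middle vertices are independent. `idem_mul_sum_single`
identifies the two expressions. -/
theorem faceComul_ell (a b : X) : faceComul F deg σ (ell K deg σ a b) =
    (F.pi Λ).idem (src K deg σ) (tgt K deg σ) * ∑ c, ell K deg σ a c ⊗ₜ ell K deg σ c b := by
  have h : ∀ c, (F.pi Λ).idem (src K deg σ) (tgt K deg σ) * (ell K deg σ a c ⊗ₜ ell K deg σ c b) =
      (F.pi Λ).idem (src K deg σ) (tgt K deg σ) * ∑ z, ∑ u, ∑ v,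
        arrow K deg σ (u, a) (z, c) ⊗ₜ arrow K deg σ (z, c) (v, b) := by
    intro c
    rw [← idem_mul_sum_single]
    simp only [← sum_arrow_top, ← sum_arrow_bot, TensorProduct.sum_tmul]
    simp only [TensorProduct.tmul_sum]
  rw [Finset.mul_sum]
  simp only [h]
  rw [ell]
  simp only [map_sum, faceComul_arrow, ← Finset.mul_sum]
  congr 1
  rw [← Fintype.sum_prod_type', Finset.sum_comm, Fintype.sum_prod_type, Finset.sum_comm]
  simp only [Fintype.sum_prod_type]

variable {deg σ}

theorem vertex_top_eq_iff (u v : Λ) :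
    (Sym.vertex (s := qs Λ X) (t := qt deg) u v).top =
      (Sym.vertex (s := qs Λ X) (t := qt deg) u v).bot ↔ u = v :=
  ⟨fun h => congrArg QPath.src h, fun h => by rw [h]; rfl⟩

theorem zeta_src (hσ : IsFRTFamily deg σ) (f g : Λ → R) :
    FaceAlg.zeta K (isFaceWeight_wSigma hσ) (src K deg σ f) g = f * g := by
  classical
  rw [FaceAlg.src_apply]
  simp only [FaceAlg.left_mul_E, map_sum, LinearMap.sum_apply, ← MulOpposite.op_one,
    FaceAlg.zeta_mk, mul_one]
  simp only [vertex_top_eq_iff, Finset.sum_ite_eq, Finset.mem_univ, if_true]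
  exact Finset.univ_sum_single (f * g)

theorem zeta_tgt (hσ : IsFRTFamily deg σ) (f g : Λ → R) :
    FaceAlg.zeta K (isFaceWeight_wSigma hσ) (tgt K deg σ (.op f)) g = g * f := by
  classical
  rw [FaceAlg.tgt_apply]
  simp only [FaceAlg.right_mul_E, map_sum, LinearMap.sum_apply,
    FaceAlg.zeta_mk, one_mul]
  simp only [vertex_top_eq_iff, Finset.sum_ite_eq', Finset.mem_univ, if_true]
  exact Finset.univ_sum_single (g * f)

theorem zeta_ell (hσ : IsFRTFamily deg σ) (a b : X) (g : Λ → R) :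
    FaceAlg.zeta K (isFaceWeight_wSigma hσ) (ell K deg σ a b) g =
      if a = b then g ∘ deg a else 0 := by
  classical
  rw [ell]
  simp only [arrow, FaceAlg.E_eq_mk, map_sum, LinearMap.sum_apply, ← MulOpposite.op_one,
    FaceAlg.zeta_mk, mul_one, one_mul, FaceAlg.arrow_top_eq_iff, Prod.mk.injEq]
  split_ifs with hab
  · simp only [hab, and_true, Finset.sum_ite_eq, Finset.mem_univ, if_true]
    exact Finset.univ_sum_single (g ∘ deg b)
  · simp [hab]

theorem isPreBialgebroid (hσ : IsFRTFamily deg σ) :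
    IsPreBialgebroid (F.pi Λ) (src K deg σ) (tgt K deg σ) (faceComul F deg σ)
      (FaceAlg.zeta K (isFaceWeight_wSigma hσ)) where
  commute := FaceAlg.src_tgt_comm
  comul_one := by
    have h := faceComul_src F deg σ 1
    rwa [map_one, ← Algebra.TensorProduct.one_def, mul_one] at h
  comul_mul := faceComul_mul F deg σ
  act_src := zeta_src hσ
  act_tgt := zeta_tgt hσ

theorem isBialgebroid (hσ : IsFRTFamily deg σ) :
    IsBialgebroid (F.pi Λ) (src K deg σ) (tgt K deg σ) (faceComul F deg σ)
      (FaceAlg.zeta K (isFaceWeight_wSigma hσ)) := by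
  have h := isPreBialgebroid F hσ
  refine h.isBialgebroid (faceComul_src F deg σ) (faceComul_tgt F deg σ)
    (Set.range (fun p : X × X => ell K deg σ p.1 p.2)) ?_ ?_ ?_ ?_
  · intro P h1 h2 h3 h4 h5 a
    exact induction h1 h2 (fun a b => h3 _ ⟨(a, b), rfl⟩) h4 h5 a
  · rintro _ ⟨⟨a, b⟩, rfl⟩
    exact h.coassoc_matrix (faceComul_src F deg σ) (faceComul_tgt F deg σ) _
      (faceComul_ell F deg σ) a b
  · rintro _ ⟨⟨a, b⟩, rfl⟩
    dsimp only
    rw [faceComul_ell, h.contractLeft_idem_mul, map_sum]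
    simp [contractLeft_tmul, zeta_ell hσ, apply_ite]
  · rintro _ ⟨⟨a, b⟩, rfl⟩
    dsimp only
    rw [faceComul_ell, h.contractRight_idem_mul, map_sum]
    simp [contractRight_tmul, zeta_ell hσ, apply_ite]

variable {F}

theorem kappa_ell (hσ : IsFRTFamily deg σ) (n : Λ → R) (a b : X) :
    kappa (F.pi Λ) (FaceAlg.zeta K (isFaceWeight_wSigma hσ)) n (ell K deg σ a b) =
      if a = b then (F.pi Λ).nakayama n ∘ (deg a).symm else 0 := by
  refine (F.pi Λ).ext_psi_left fun p => ?_
  rw [psi_mul_kappa, zeta_ell hσ]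
  split_ifs
  · rw [F.pi_psi_mul_comp, ← F.pi_nakayama_comp, FrobeniusSystem.psi_mul_nakayama]
  · rw [mul_zero, mul_zero]

end WeakBialgebra

/-! ### Compatibility of `Phi` with source, target, coproduct and counit -/

section Homomorphism

variable {K R Λ X : Type*} [Field K] [Ring R] [Algebra K R] [Fintype Λ] [DecidableEq Λ]
  [Fintype X] [DecidableEq X] {F : FrobeniusSystem K R}
  {deg : X → Equiv.Perm Λ} {σ : X → X → X → X → Λ → R}

theorem Phi_left_mul_E (r : R) (x : Sym (qs Λ X) (qt deg)) :
    Phi K deg σ (FaceAlg.left K _ _ _ r * FaceAlg.E K _ _ _ x) =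
      FRTAlg.src K deg σ (fun _ => r) * Phi.onSym K deg σ x := by
  have h : Phi K deg σ (FaceAlg.mk K _ _ _ (HAlg.tmul K r 1 (GAlg.e K x))) =
      Phi.leftR K deg σ r * Phi.rightR K deg σ 1 * Phi.onG K deg σ (GAlg.e K x) :=
    FaceAlg.lift_mk K _ _ _ r 1 _
  rw [FaceAlg.left_mul_E, h, map_one, mul_one, Phi.onG, GAlg.lift_e, Phi.leftR_apply]

theorem Phi_right_mul_E (r : R) (x : Sym (qs Λ X) (qt deg)) :
    Phi K deg σ (FaceAlg.right K _ _ _ (.op r) * FaceAlg.E K _ _ _ x) =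
      FRTAlg.tgt K deg σ (.op fun _ => r) * Phi.onSym K deg σ x := by
  have h : Phi K deg σ (FaceAlg.mk K _ _ _ (HAlg.tmul K 1 (.op r) (GAlg.e K x))) =
      Phi.leftR K deg σ 1 * Phi.rightR K deg σ (.op r) * Phi.onG K deg σ (GAlg.e K x) :=
    FaceAlg.lift_mk K _ _ _ 1 (.op r) _
  rw [FaceAlg.right_mul_E, h, map_one, one_mul, Phi.onG, GAlg.lift_e, Phi.rightR_apply]

theorem Phi_E (x : Sym (qs Λ X) (qt deg)) :
    Phi K deg σ (FaceAlg.E K _ _ _ x) = Phi.onSym K deg σ x := by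
  have h := Phi_left_mul_E (K := K) (σ := σ) 1 x
  rw [map_one, one_mul] at h
  rw [h]
  exact (congrArg (· * _) (map_one (FRTAlg.src K deg σ))).trans (one_mul _)

theorem onSym_vertex (u v : Λ) : Phi.onSym K deg σ (Sym.vertex u v) =
    FRTAlg.src K deg σ (Pi.single u 1) * FRTAlg.tgt K deg σ (.op (Pi.single v 1)) :=
  mul_one _

theorem Phi_src (f : Λ → R) : Phi K deg σ (src K deg σ f) = FRTAlg.src K deg σ f := by
  rw [src, FaceAlg.src_apply]
  simp only [map_sum, Phi_left_mul_E, onSym_vertex]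
  simp only [← mul_assoc, ← map_mul, Phi.const_mul_single, ← Finset.mul_sum,
    Phi.sum_tgt_single, mul_one]
  rw [← map_sum, Finset.univ_sum_single]

theorem Phi_tgt (f : (Λ → R)ᵐᵒᵖ) : Phi K deg σ (tgt K deg σ f) = FRTAlg.tgt K deg σ f := by
  induction f using MulOpposite.rec' with
  | h f =>
  rw [tgt, FaceAlg.tgt_apply]
  simp only [map_sum, Phi_right_mul_E, onSym_vertex]
  simp only [(FRTAlg.src_tgt_comm K deg σ _ _).eq, ← mul_assoc, ← map_mul, ← MulOpposite.op_mul,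
    Phi.single_mul_const, ← Finset.mul_sum, Phi.sum_src_single, mul_one]
  rw [← map_sum, ← Finset.op_sum, Finset.univ_sum_single]

theorem Phi_ell (a b : X) : Phi K deg σ (ell K deg σ a b) = FRTAlg.L K deg σ a b := by
  have h : ∀ u v, Phi.onSym K deg σ (Sym.arrow (u, a) (v, b)) =
      FRTAlg.src K deg σ (Pi.single u 1) * FRTAlg.tgt K deg σ (.op (Pi.single v 1)) *
        FRTAlg.L K deg σ a b := by
    intro u v
    have hw : Phi.word K deg σ [(u, a)] [(v, b)] = FRTAlg.L K deg σ a b :=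
      (Phi.word_cons K deg σ _ _ [] []).trans (mul_one _)
    rw [← hw]
    rfl
  rw [ell]
  simp only [arrow, map_sum, Phi_E, h]
  simp only [← Finset.sum_mul, ← Finset.mul_sum, Phi.sum_src_single, Phi.sum_tgt_single, one_mul]

/-- Both actions on M_Λ(R) are algebra homomorphisms and agree on generators. Evaluation at 1
followed by ψ gives compatibility with the counits. -/
theorem chi_Phi (hσ : IsFRTFamily deg σ) (a : FaceSigma K deg σ) :
    FRTAlg.chi K hσ (Phi K deg σ a) = FaceAlg.zeta K (isFaceWeight_wSigma hσ) a := by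
  induction a using induction with
  | src f =>
    apply LinearMap.ext
    intro g
    rw [Phi_src, FRTAlg.chi_src, zeta_src hσ]
  | tgt f =>
    induction f using MulOpposite.rec' with
    | h f =>
    apply LinearMap.ext
    intro g
    rw [Phi_tgt, FRTAlg.chi_tgt, zeta_tgt hσ]
  | ell a b =>
    apply LinearMap.ext
    intro g
    rw [Phi_ell, FRTAlg.chi_L, zeta_ell hσ]
  | add a b ha hb => simp only [map_add, ha, hb]
  | mul a b ha hb => simp only [map_mul, ha, hb]

theorem map_Phi_idem : Algebra.TensorProduct.map (Phi K deg σ) (Phi K deg σ)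
    ((F.pi Λ).idem (src K deg σ) (tgt K deg σ)) =
      (F.pi Λ).idem (FRTAlg.src K deg σ) (FRTAlg.tgt K deg σ) := by
  simp only [FrobeniusSystem.idem_eq, map_sum, Algebra.TensorProduct.map_tmul, Phi_src, Phi_tgt]

/-- Both sides are multiplicative in a, and the formulas on generators have the same shape in the
two algebras, with E carried to E. -/
theorem map_Phi_faceComul (a : FaceSigma K deg σ) :
    Algebra.TensorProduct.map (Phi K deg σ) (Phi K deg σ) (faceComul F deg σ a) =
      frtComul F deg σ (Phi K deg σ a) := by
  induction a using induction with
  | src f => simp [faceComul_src, FRTAlg.frtComul_src, map_Phi_idem, Phi_src]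
  | tgt f => simp [faceComul_tgt, FRTAlg.frtComul_tgt, map_Phi_idem, Phi_tgt]
  | ell a b => simp [faceComul_ell, FRTAlg.frtComul_L, map_Phi_idem, Phi_ell]
  | add a b ha hb => simp only [map_add, ha, hb]
  | mul a b ha hb =>
    rw [faceComul_mul, map_mul, map_mul, ha, hb, FRTAlg.frtComul_mul]

end Homomorphism

end FaceSigma

/-! ### The universal property of `Phi` -/

section Universal

variable {K R Λ X : Type*} [Field K] [Ring R] [Algebra K R] [Fintype Λ] [DecidableEq Λ]
  [Fintype X] [DecidableEq X] {F : FrobeniusSystem K R}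
  {deg : X → Equiv.Perm Λ} {σ : X → X → X → X → Λ → R}

/-- A multiplicative linear map on `A_σ` is determined by its values on the `s(f)`, `t(f)` and
`L_{ab}`. -/
theorem FRTAlg.linearMap_ext {C : Type*} [Ring C] [Algebra K C] {φ φ' : FRTAlg K deg σ →ₗ[K] C}
    (hφ : ∀ a b, φ (a * b) = φ a * φ b) (hφ' : ∀ a b, φ' (a * b) = φ' a * φ' b)
    (hs : ∀ f, φ (src K deg σ f) = φ' (src K deg σ f))
    (ht : ∀ f, φ (tgt K deg σ f) = φ' (tgt K deg σ f))
    (hL : ∀ a b, φ (L K deg σ a b) = φ' (L K deg σ a b)) : φ = φ' := by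
  have h1 : φ 1 = φ' 1 := by
    have h := hs 1
    rwa [map_one] at h
  apply LinearMap.ext
  intro a
  induction a using FRTAlg.induction with
  | src f => exact hs f
  | tgt f => exact ht f
  | L a b => exact hL a b
  | Linv a b =>
    -- Uniqueness of the inverse matrix: both values equal the product φ(L⁻¹)φ(L)φ'(L⁻¹), bracketed
    -- in two ways. Only multiplicativity and φ(1) = φ'(1) are used, because the lemma must cover
    -- maps such as Δ, which do not preserve 1.
    have e1 : φ (Linv K deg σ a b) =
        ∑ c, φ (Linv K deg σ a c) * φ' (∑ d, L K deg σ c d * Linv K deg σ d b) := by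
      simp only [sum_L_Linv, apply_ite φ', map_zero, mul_ite, mul_zero, Finset.sum_ite_eq',
        Finset.mem_univ, if_true]
      rw [← h1, ← hφ, mul_one]
    have e2 : φ' (Linv K deg σ a b) =
        ∑ d, φ (∑ c, Linv K deg σ a c * L K deg σ c d) * φ' (Linv K deg σ d b) := by
      simp only [sum_Linv_L, apply_ite φ, map_zero, ite_mul, zero_mul, Finset.sum_ite_eq,
        Finset.mem_univ, if_true]
      rw [h1, ← hφ', one_mul]
    rw [e1, e2]
    simp only [map_sum, hφ, hφ', Finset.sum_mul, Finset.mul_sum, hL, mul_assoc]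
    exact Finset.sum_comm
  | add a b ha hb => rw [map_add, map_add, ha, hb]
  | mul a b ha hb => rw [hφ, hφ', ha, hb]

/-- The property `ε(s(l) (L⁻¹)_{ab} t(m)) = δ_{a,b} ε(s(l ∘ deg(a)) t(m))` of the counit. -/
theorem FRTAlg.apply_src_mul_Linv_mul_tgt {η : FRTAlg K deg σ →ₗ[K] K}
    (hη : ∀ a c, η (a * c) = ∑ i, η (a * tgt K deg σ (.op ((F.pi Λ).fst i))) *
      η (src K deg σ ((F.pi Λ).snd i) * c))
    (hL : ∀ l m a b, η (src K deg σ l * L K deg σ a b * tgt K deg σ (.op m)) =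
      if a = b then (F.pi Λ).ψ (l * (m ∘ deg a)) else 0) (l m : Λ → R) (a b : X) :
    η (src K deg σ l * Linv K deg σ a b * tgt K deg σ (.op m)) =
      if a = b then η (src K deg σ (l ∘ deg a) * tgt K deg σ (.op m)) else 0 := by
  -- The value of η on an element containing LL⁻¹ is computed twice: directly from the inverse
  -- relation, and by splitting off L with `hη`. In the second computation η(L) is a Kronecker delta
  -- with a translation, and the dual basis formula restores l in front of L⁻¹.
  have h1 : η (src K deg σ (l ∘ deg a) * (∑ c, L K deg σ a c * Linv K deg σ c b) *
      tgt K deg σ (.op m)) =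
      if a = b then η (src K deg σ (l ∘ deg a) * tgt K deg σ (.op m)) else 0 := by
    rw [sum_L_Linv]
    split_ifs <;> simp
  have h2 : ∀ c, η (src K deg σ (l ∘ deg a) * L K deg σ a c *
      (Linv K deg σ c b * tgt K deg σ (.op m))) = if a = c then
        η (src K deg σ l * Linv K deg σ a b * tgt K deg σ (.op m)) else 0 := by
    intro c
    rw [hη]
    simp only [hL]
    split_ifs with hac
    · subst hac
      have h3 : ∀ i, (F.pi Λ).ψ ((l ∘ deg a) * ((F.pi Λ).fst i ∘ deg a)) *
          η (src K deg σ ((F.pi Λ).snd i) * (Linv K deg σ a b * tgt K deg σ (.op m))) =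
          η (src K deg σ ((F.pi Λ).ψ (l * (F.pi Λ).fst i) • (F.pi Λ).snd i) *
            (Linv K deg σ a b * tgt K deg σ (.op m))) := by
        intro i
        rw [F.pi_psi_mul_comp, Function.comp_assoc, Equiv.self_comp_symm, Function.comp_id,
          map_smul, smul_mul_assoc, map_smul, smul_eq_mul]
      simp only [h3]
      rw [← map_sum, ← Finset.sum_mul, ← map_sum, FrobeniusSystem.sum_psi_fst, mul_assoc]
    · simp
  rw [← h1, Finset.mul_sum, Finset.sum_mul, map_sum]
  simp only [← mul_assoc] at h2 ⊢
  simp only [h2, Finset.sum_ite_eq, Finset.mem_univ, if_true]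

/-- A counit is not multiplicative, but its value on a product is determined by values with base
factors inserted at the cut. Carrying s(l) on the left and t(m) on the right therefore gives a
statement that passes to products. The values on L⁻¹ are forced by those on L and on the base. -/
theorem FRTAlg.counit_ext {η η' : FRTAlg K deg σ →ₗ[K] K}
    (hη : ∀ a c, η (a * c) = ∑ i, η (a * tgt K deg σ (.op ((F.pi Λ).fst i))) *
      η (src K deg σ ((F.pi Λ).snd i) * c))
    (hη' : ∀ a c, η' (a * c) = ∑ i, η' (a * tgt K deg σ (.op ((F.pi Λ).fst i))) *
      η' (src K deg σ ((F.pi Λ).snd i) * c))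
    (hst : ∀ l m, η (src K deg σ l * tgt K deg σ (.op m)) =
      η' (src K deg σ l * tgt K deg σ (.op m)))
    (hL : ∀ l m a b, η (src K deg σ l * L K deg σ a b * tgt K deg σ (.op m)) =
      if a = b then (F.pi Λ).ψ (l * (m ∘ deg a)) else 0)
    (hL' : ∀ l m a b, η' (src K deg σ l * L K deg σ a b * tgt K deg σ (.op m)) =
      if a = b then (F.pi Λ).ψ (l * (m ∘ deg a)) else 0) : η = η' := by
  have key : ∀ x l m, η (src K deg σ l * x * tgt K deg σ (.op m)) =
      η' (src K deg σ l * x * tgt K deg σ (.op m)) := by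
    intro x
    induction x using FRTAlg.induction with
    | src f =>
      intro l m
      rw [← map_mul, hst]
    | tgt f =>
      intro l m
      rw [mul_assoc, ← map_mul]
      exact hst _ _
    | L a b => intro l m; rw [hL, hL']
    | Linv a b =>
      intro l m
      rw [apply_src_mul_Linv_mul_tgt hη hL, apply_src_mul_Linv_mul_tgt hη' hL', hst]
    | add a b ha hb => intro l m; simp only [mul_add, add_mul, map_add, ha, hb]
    | mul a b ha hb =>
      intro l m
      have e : src K deg σ l * (a * b) * tgt K deg σ (.op m) =
          (src K deg σ l * a) * (b * tgt K deg σ (.op m)) := by simp only [mul_assoc]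
      rw [e, hη, hη']
      refine Finset.sum_congr rfl fun i _ => ?_
      rw [← mul_assoc (src K deg σ _) b, ha, hb]
  apply LinearMap.ext
  intro x
  have h := key x 1 1
  rwa [MulOpposite.op_one, map_one, map_one, one_mul, mul_one] at h

/-! ### Factoring a homomorphism with antipode as an algebra map -/

section Antipode

variable [WeakBialgebra K (FaceSigma K deg σ)] (hσ : IsFRTFamily deg σ)
  (h : IsFrobeniusWeakBialgebra (F.pi Λ) (FaceSigma.src K deg σ) (FaceSigma.tgt K deg σ)
    (FaceAlg.zeta K (isFaceWeight_wSigma hσ)))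
  (hΔ : Coalgebra.comul (R := K) (A := FaceSigma K deg σ) = faceComul F deg σ)
include h

/-- Supplies the commutation hypothesis of `sum_map_mul_antipode`. A factor f(t(θ(n))) to the right
of g(ell_{cb}) is absorbed as s(n), passes through `ell` as a translate by the degree of c, and
re-emerges on the left of g. Moving it past f(ell_{ac}) undoes the translation. Surjectivity of θ
covers all of the base. -/
theorem FaceSigma.commute_sum_map_mul_antipode {B : Type*} [Ring B] [Algebra K B]
    {f : FaceSigma K deg σ →ₐ[K] B} {g : FaceSigma K deg σ →ₗ[K] B} (hg : IsAntipodeOf f g)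
    (a b : X) (l : (Λ → R)ᵐᵒᵖ) :
    Commute (∑ c, f (ell K deg σ a c) * g (ell K deg σ c b)) (f (tgt K deg σ l)) := by
  induction l using MulOpposite.rec' with
  | h m =>
  obtain ⟨n, rfl⟩ := (F.pi Λ).nakayama_surjective m
  rw [Commute, SemiconjBy, Finset.sum_mul, Finset.mul_sum]
  refine Finset.sum_congr rfl fun c _ => ?_
  have h1 := ell_tgt (K := K) (deg := deg) (σ := σ) ((F.pi Λ).nakayama (n ∘ (deg c).symm)) a c
  have h2 := ell_src (K := K) (deg := deg) (σ := σ) (n ∘ (deg c).symm) c b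
  rw [← F.pi_nakayama_comp, Function.comp_assoc, Equiv.symm_comp_self, Function.comp_id] at h1
  rw [Function.comp_assoc, Equiv.symm_comp_self, Function.comp_id] at h2
  rw [mul_assoc, ← h.antipode_src_mul hg, ← h2, h.antipode_mul_src hg, ← mul_assoc, ← mul_assoc,
    ← map_mul, ← map_mul, h1]

include hΔ

/-- The matrices f(ell) and g(ell) are mutually inverse, and the other hypotheses of `exists_lift`
are images under f of relations that hold in 𝔄(w_σ). -/
theorem exists_comp_Phi_eq {B : Type*} [Ring B] [Algebra K B]
    {f : FaceSigma K deg σ →ₐ[K] B} {g : FaceSigma K deg σ →ₗ[K] B} (hg : IsAntipodeOf f g) :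
    ∃ G : FRTAlg K deg σ →ₐ[K] B, ∀ a, G (Phi K deg σ a) = f a := by
  have hu : ∀ a b, Coalgebra.comul (R := K) (FaceSigma.ell K deg σ a b) =
      (F.pi Λ).idem (FaceSigma.src K deg σ) (FaceSigma.tgt K deg σ) *
        ∑ c, FaceSigma.ell K deg σ a c ⊗ₜ FaceSigma.ell K deg σ c b := by
    intro a b
    rw [hΔ, FaceSigma.faceComul_ell]
  obtain ⟨G, h1, h2, h3, -⟩ := FRTAlg.exists_lift (deg := deg) (σ := σ)
    (f.comp (FaceSigma.src K deg σ)) (f.comp (FaceSigma.tgt K deg σ))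
    (fun l m => (FaceAlg.src_tgt_comm l m).map f)
    (fun a b => f (FaceSigma.ell K deg σ a b)) (fun a b => g (FaceSigma.ell K deg σ a b))
    (fun a b => by
      rw [h.sum_map_mul_antipode hg hu a b
        (FaceSigma.commute_sum_map_mul_antipode hσ h hg a b), FaceSigma.zeta_ell hσ]
      split_ifs
      · exact (congrArg f (map_one (FaceSigma.src K deg σ))).trans (map_one f)
      · rw [map_zero, map_zero])
    (fun a b => by
      rw [h.sum_antipode_mul_map hg hu a b, FaceSigma.kappa_ell hσ, map_one]
      split_ifs
      · exact (congrArg f (map_one (FaceSigma.tgt K deg σ))).trans (map_one f)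
      · rw [MulOpposite.op_zero, map_zero, map_zero])
    (fun l a b => by
      simp only [AlgHom.comp_apply, ← map_mul, FaceSigma.ell_src])
    (fun l a b => by
      simp only [AlgHom.comp_apply, ← map_mul, FaceSigma.ell_tgt])
    (fun a b c d => by
      simp only [AlgHom.comp_apply, ← map_mul, ← map_sum, FaceSigma.yangBaxter])
  refine ⟨G, fun a => ?_⟩
  induction a using FaceSigma.induction with
  | src l => rw [FaceSigma.Phi_src, h1, AlgHom.comp_apply]
  | tgt l => rw [FaceSigma.Phi_tgt, h2, AlgHom.comp_apply]
  | ell a b => rw [FaceSigma.Phi_ell, h3]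
  | add a b ha hb => simp only [map_add, ha, hb]
  | mul a b ha hb => simp only [map_mul, ha, hb]

end Antipode

/-! ### The factorization preserves coproduct and counit -/

section Coalgebra

variable [WeakBialgebra K (FaceSigma K deg σ)] [WeakBialgebra K (FRTAlg K deg σ)]
  {hσ : IsFRTFamily deg σ}
  (hFRT : IsFrobeniusWeakBialgebra (F.pi Λ) (FRTAlg.src K deg σ) (FRTAlg.tgt K deg σ)
    (FRTAlg.chi K hσ))
  {ι : FaceSigma K deg σ →ₐc[K] FRTAlg K deg σ} (hι : ∀ a, ι a = Phi K deg σ a)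
  {B : Type*} [Ring B] [Algebra K B] [WeakBialgebra K B] {f : FaceSigma K deg σ →ₐc[K] B}
  {G : FRTAlg K deg σ →ₐ[K] B} (hG : ∀ a, G (Phi K deg σ a) = f a)

-- On the image of `Phi` the map G inherits compatibility with Δ from the coalgebra maps f and ι.
include hι hG in
theorem map_comp_comul_Phi (a : FaceSigma K deg σ) :
    Algebra.TensorProduct.map G G (Coalgebra.comul (R := K) (Phi K deg σ a)) =
      Coalgebra.comul (R := K) (G (Phi K deg σ a)) := by
  rw [hG, ← hι, ← CoalgHomClass.map_comp_comul_apply, ← CoalgHomClass.map_comp_comul_apply]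
  generalize Coalgebra.comul (R := K) a = z
  induction z with
  | zero => simp
  | add x y hx hy => simp only [map_add, hx, hy]
  | tmul x y => simp [hι, hG]

-- The image of `Phi` contains s(f), t(f) and L. Both sides are multiplicative though not unital, so
-- `linearMap_ext` extends the equality to L⁻¹ and thus to all of A_σ.
include hι hG in
theorem map_comp_comul (a : FRTAlg K deg σ) :
    Algebra.TensorProduct.map G G (Coalgebra.comul (R := K) a) =
      Coalgebra.comul (R := K) (G a) := by
  have h := map_comp_comul_Phi hι hG
  refine LinearMap.congr_fun (FRTAlg.linearMap_ext
    (φ := (Algebra.TensorProduct.map G G).toLinearMap ∘ₗ Coalgebra.comul (R := K))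
    (φ' := Coalgebra.comul (R := K) ∘ₗ G.toLinearMap) (fun a b => ?_) (fun a b => ?_)
    (fun l => ?_) (fun l => ?_) (fun a b => ?_)) a
  · simp only [LinearMap.comp_apply, AlgHom.toLinearMap_apply, WeakBialgebra.comul_mul, map_mul]
  · simp only [LinearMap.comp_apply, AlgHom.toLinearMap_apply, WeakBialgebra.comul_mul, map_mul]
  · rw [← FaceSigma.Phi_src]; exact h _
  · rw [← FaceSigma.Phi_tgt]; exact h _
  · rw [← FaceSigma.Phi_ell]; exact h _

include hFRT hι hG in
theorem counit_comp (a : FRTAlg K deg σ) :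
    Coalgebra.counit (R := K) (G a) = Coalgebra.counit (R := K) a := by
  have h1 : ∀ a, Coalgebra.counit (R := K) (G (Phi K deg σ a)) =
      Coalgebra.counit (R := K) (Phi K deg σ a) := by
    intro a
    rw [hG, ← hι, CoalgHomClass.counit_comp_apply, CoalgHomClass.counit_comp_apply]
  have hL : ∀ l m a b, Coalgebra.counit (R := K)
      (FRTAlg.src K deg σ l * FRTAlg.L K deg σ a b * FRTAlg.tgt K deg σ (.op m)) =
      if a = b then (F.pi Λ).ψ (l * (m ∘ deg a)) else 0 := by
    intro l m a b
    rw [hFRT.counit_eq, actCounit_apply, map_mul, map_mul, Module.End.mul_apply,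
      Module.End.mul_apply, FRTAlg.chi_tgt, FRTAlg.chi_L, FRTAlg.chi_src, one_mul]
    split_ifs <;> simp
  have hPhi : ∀ l m a b, FRTAlg.src K deg σ l * FRTAlg.L K deg σ a b * FRTAlg.tgt K deg σ m =
      Phi K deg σ (FaceSigma.src K deg σ l * FaceSigma.ell K deg σ a b *
        FaceSigma.tgt K deg σ m) := by
    intro l m a b
    simp only [map_mul, FaceSigma.Phi_src, FaceSigma.Phi_tgt, FaceSigma.Phi_ell]
  -- Compatibility of G with Δ at 1 shows that Δ(1) in B is the image of E. The weak
  -- multiplicativity axiom of B with middle argument 1 then takes the form required by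
  -- `counit_ext`.
  have h2 : Coalgebra.comul (R := K) (1 : B) = ∑ i,
      G (FRTAlg.tgt K deg σ (.op ((F.pi Λ).fst i))) ⊗ₜ
        G (FRTAlg.src K deg σ ((F.pi Λ).snd i)) := by
    have h := map_comp_comul hι hG 1
    rw [map_one G, hFRT.comul_one, FrobeniusSystem.idem_eq, map_sum] at h
    rw [← h]
    simp
  refine LinearMap.congr_fun (FRTAlg.counit_ext (F := F)
    (η := Coalgebra.counit (R := K) ∘ₗ G.toLinearMap) (η' := Coalgebra.counit (R := K))
    (fun a c => ?_) (fun a c => ?_) (fun l m => ?_) (fun l m a b => ?_) hL) a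
  · have h := WeakBialgebra.counit_mul_left (K := K) (G a) 1 (G c)
    rw [h2, mul_one] at h
    simpa using h.symm
  · have h := WeakBialgebra.counit_mul_left (K := K) a 1 c
    rw [hFRT.comul_one, FrobeniusSystem.idem_eq, mul_one] at h
    simpa using h.symm
  · rw [← FaceSigma.Phi_src, ← FaceSigma.Phi_tgt, ← map_mul]
    exact h1 _
  · rw [← hL, hPhi]
    exact h1 _

end Coalgebra

theorem isHopfClosure_Phi [WeakBialgebra K (FaceSigma K deg σ)]
    [WeakBialgebra K (FRTAlg K deg σ)]
    {hσ : IsFRTFamily deg σ}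
    (hFace : IsFrobeniusWeakBialgebra (F.pi Λ) (FaceSigma.src K deg σ) (FaceSigma.tgt K deg σ)
      (FaceAlg.zeta K (isFaceWeight_wSigma hσ)))
    (hFRT : IsFrobeniusWeakBialgebra (F.pi Λ) (FRTAlg.src K deg σ) (FRTAlg.tgt K deg σ)
      (FRTAlg.chi K hσ))
    (hΔ : Coalgebra.comul (R := K) (A := FaceSigma K deg σ) = faceComul F deg σ)
    (hΔ' : Coalgebra.comul (R := K) (A := FRTAlg K deg σ) = frtComul F deg σ)
    (hrigid : IsRigid K deg σ) {ι : FaceSigma K deg σ →ₐc[K] FRTAlg K deg σ}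
    (hι : ∀ a, ι a = Phi K deg σ a) : IsHopfClosure.{w} ι where
  isWeakHopf := FRTAlg.exists_isWeakHopfAntipode hFRT hΔ' hrigid
  universal B _ _ _ f g hg := by
    obtain ⟨G, hG⟩ := exists_comp_Phi_eq hσ hFace hΔ hg
    have hG' : ∀ a, G (Phi K deg σ a) = f a := hG
    refine ⟨{ toLinearMap := G.toLinearMap
              counit_comp := LinearMap.ext (counit_comp hFRT hι hG')
              map_comp_comul := LinearMap.ext (map_comp_comul hι hG')
              map_one' := map_one G
              map_mul' := map_mul G }, ?_, ?_⟩
    · refine BialgHom.ext fun a => ?_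
      exact (congrArg G (hι a)).trans (hG' a)
    -- Two extensions agree on the image of `Phi`, hence on s(f), t(f) and L, and hence on the
    -- inverse matrix.
    · intro G₁ h₁
      have h : ∀ a, G₁ (Phi K deg σ a) = G (Phi K deg σ a) := by
        intro a
        rw [hG', ← h₁, ← hι]
        rfl
      refine BialgHom.ext fun a => LinearMap.congr_fun (FRTAlg.linearMap_ext
        (φ := (G₁ : FRTAlg K deg σ →ₐ[K] B).toLinearMap) (φ' := G.toLinearMap)
        (map_mul (G₁ : FRTAlg K deg σ →ₐ[K] B)) (map_mul G) (fun l => ?_) (fun l => ?_)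
        (fun a b => ?_)) a
      · rw [← FaceSigma.Phi_src]; exact h _
      · rw [← FaceSigma.Phi_tgt]; exact h _
      · rw [← FaceSigma.Phi_ell]; exact h _

end Universal

end FRT

end


theorem mainTheorem4 {K R Λ X : Type*} [Field K] [Ring R] [Algebra K R] [Fintype Λ]
    [DecidableEq Λ] [Nonempty Λ] [Fintype X] [DecidableEq X] (F : FRT.FrobeniusSystem K R)
    (deg : X → Equiv.Perm Λ) (σ : X → X → X → X → Λ → R) (hσ : FRT.IsFRTFamily deg σ)
    (hrigid : FRT.IsRigid K deg σ) :
    ∃ (_ : FRT.WeakBialgebra K (FRT.FaceSigma K deg σ))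
      (_ : FRT.WeakBialgebra K (FRT.FRTAlg K deg σ)),
      (Coalgebra.comul (R := K) (A := FRT.FaceSigma K deg σ) = FRT.faceComul F deg σ ∧
        Coalgebra.counit (R := K) (A := FRT.FaceSigma K deg σ) = FRT.faceCounit F hσ) ∧
      (Coalgebra.comul (R := K) (A := FRT.FRTAlg K deg σ) = FRT.frtComul F deg σ ∧
        Coalgebra.counit (R := K) (A := FRT.FRTAlg K deg σ) = FRT.frtCounit F hσ) ∧
      ∃ ι : FRT.FaceSigma K deg σ →ₐc[K] FRT.FRTAlg K deg σ,
        (∀ x, ι x = FRT.Phi K deg σ x) ∧ FRT.IsHopfClosure.{w} ι := by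
  let inst₁ := (FRT.FaceSigma.isBialgebroid F hσ).weakBialgebra
  let inst₂ := (FRT.FRTAlg.isBialgebroid F hσ).weakBialgebra
  have h₁ : FRT.IsFrobeniusWeakBialgebra (F.pi Λ) (FRT.FaceSigma.src K deg σ)
      (FRT.FaceSigma.tgt K deg σ) (FRT.FaceAlg.zeta K (FRT.isFaceWeight_wSigma hσ)) :=
    { FRT.FaceSigma.isBialgebroid F hσ with counit_eq := rfl }
  have h₂ : FRT.IsFrobeniusWeakBialgebra (F.pi Λ) (FRT.FRTAlg.src K deg σ)
      (FRT.FRTAlg.tgt K deg σ) (FRT.FRTAlg.chi K hσ) :=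
    { FRT.FRTAlg.isBialgebroid F hσ with counit_eq := rfl }
  refine ⟨inst₁, inst₂, ⟨rfl, rfl⟩, ⟨rfl, rfl⟩,
    { toLinearMap := (FRT.Phi K deg σ).toLinearMap
      counit_comp := LinearMap.ext fun a => ?_
      map_comp_comul := LinearMap.ext FRT.FaceSigma.map_Phi_faceComul
      map_one' := map_one (FRT.Phi K deg σ)
      map_mul' := map_mul (FRT.Phi K deg σ) }, fun _ => rfl,
    FRT.isHopfClosure_Phi h₁ h₂ rfl rfl hrigid fun _ => rfl⟩
  -- The counits are ψ of the two actions applied to 1, and `chi_Phi` identifies these actions along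
  -- `Phi`.
  exact congrArg (fun φ : Module.End K (Λ → R) => (F.pi Λ).ψ (φ 1))
    (FRT.FaceSigma.chi_Phi hσ a)
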